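/- Setting. Let $p_1<\dots<p_n$ be integers with $p_1>2$, let $\lambda_1,\dots,\lambda_n\ge 0$ with $\sum_i\lambda_i=1$, and let $\xi(x)=\sum_{i=1}^n\lambda_i x^{p_i}$. Let $\mathcal K$ be the set of measures $\nu(dx)=\mathbb 1_{[0,1)}(x)\gamma(x)\,dx+\Delta\,\delta_1(dx)$ on $[0,1]$ with $\gamma$ nonnegative, nondecreasing and right-continuous on $[0,1)$ and $\Delta>0$. The Parisi measure $\nu_P$ is the minimizer over $\mathcal K$ of $$\mathcal Q(\nu)=\tfrac12\Big(\int_0^1\xi'(x)\,\nu(dx)+\int_0^1\frac{dx}{\nu((x,1])}\Big).$$ Block points. Let $t\ge 2$, $s_1,\dots,s_t\ge 0$, $w_j=s_1+\dots+s_j$, $k=w_t$, and for $j=1,\dots,t$ let $q^j_{w_{j-1}}<q^j_{w_{j-1}+1}<\dots<q^j_{w_j}$ be points with $q^1_0=0$, $q^t_{w_t}=1$ and $q^{j}_{w_j}<q^{j+1}_{w_j}$ for $1\le j<t$. We say that $\nu_P$ is $k$-FRSB with these block points if there are $0<m_1<\dots<m_k$, a nonnegative strictly increasing function $\omega$ on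 $\bigcup_{j<t}[q^j_{w_j},q^{j+1}_{w_j})$, and $\Delta>0$ such that $$\nu_P(dx)=\sum_{j=1}^t\sum_{l=w_{j-1}+1}^{w_j}m_l\mathbb 1_{[q^j_{l-1},q^j_l)}(x)\,dx+\sum_{j=1}^{t-1}\omega(x)\mathbb 1_{[q^j_{w_j},q^{j+1}_{w_j})}(x)\,dx+\Delta\,\delta_1(dx),$$ and that $\nu_P$ is $k$-FRSB if this holds for some choice of $t$, of $s_1,\dots,s_t$ with sum $k$, and of block points. Notation. Put $$h(x,y,z)=\xi(y)-\xi(x)-\xi'(x)(y-x)+[\xi'(y)-\xi'(x)](y-x)\Big(\frac1{z-1}-\frac{z\log z}{(z-1)^2}\Big),$$ $$r_1(x,y,z)=\frac{[\xi'(z)-\xi'(y)](z-x)}{(z-y)[\xi'(z)-\xi'(x)]},\qquad r_2(x,y)=\frac{\xi''(y)(y-x)}{\xi'(y)-\xi'(x)}.$$ For $s\ge1$ and $x_0<\dots<x_s$ put $\mathbf r_l=r_1(x_{l-1},x_{l+1},x_l)$, $\epsilon=(-1)^{s-l}$, $P_l=\prod_{i=1}^{\lfloor (s-l)/2\rfloor}\mathbf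 r_{s+1-2i}/\mathbf r_{s-2i}$, and $$\mathcal F^s_l=r_2(x_{l-\epsilon},x_l)\,P_l^{\,\epsilon}\ (0\le l\le s),\qquad \mathcal A^s_l=r_1(x_l,x_{l-\epsilon},x_{l+\epsilon})\,P_l^{-\epsilon}\ (1\le l\le s-1),$$ where for $l=0$ and $s$ even the product $r_2(x_{-1},x_0)/\mathbf r_0$ of two factors of $\mathcal F_0^s$ stands for $r_2(x_1,x_0)$ (the fictitious point $x_{-1}$ cancels). Let $\mathcal Z^s$ be the maximum of the $\mathcal F^s_l$ with $s-l$ odd and the $\mathcal A^s_l$ with $s-l$ even, and let $\mathcal Y^s$ be the maximum of the $\mathcal F^s_l$ with $s-l$ even and the $\mathcal A^s_l$ with $s-l$ odd. Let $F^j_l=\mathcal F^{s_j}_{l-w_{j-1}}$, $A^j_l=\mathcal A^{s_j}_{l-w_{j-1}}$, $Z^j$, $Y^j$ be these quantities at $(q^j_{w_{j-1}},\dots,q^j_{w_j})$. For $w_{j-1}<l\le w_j$ and $y\in(q^j_{l-1},q^j_l)$ let $A^j_l(y)=\mathcal A^{s_j+1}_{l-w_{j-1}}(q^j_{w_{j-1}},\dots,q^j_{l-1},y,q^j_l,\dots,q^j_{w_j})$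 if $l<w_j$, and $A^j_{w_j}(y)=r_1(q^j_{w_j-1},q^j_{w_j},y)$. Finally let $*_j=F^j_{w_j}$ for $j<t$ and $*_t=(F^t_{w_{t-1}})^{(-1)^{s_t}}$. Theorem 9. For every choice of block points, $\nu_P$ is $k$-FRSB with these block points if and only if the following hold (blocks with $s_j=0$ are subject to none of (1)–(3)): (1) $h\big(q^j_{l-1},q^j_l,\,r_2(q^j_{l-1},q^j_l)(F^j_l)^{-1}(*_j)^{(-1)^{w_j-l}}\big)=0$ for $1\le j\le t$ and $w_{j-1}<l\le w_j$, and $F^j_{w_{j-1}}=(F^j_{w_j})^{(-1)^{s_j}}$ for $1<j<t$; (2) $Y^j\le *_j\le (Z^j)^{-1}$ for $1\le j\le t$ (with $0^{-1}=+\infty$), where moreover the inequalities $A^j_l<*_j$ ($w_j-l$ odd) and $*_j<(A^j_l)^{-1}$ ($w_j-l$ even) are strict for $w_{j-1}<l<w_j$; (3) for $1\le j\le t$ and $w_{j-1}<l\le w_j$, $h\big(y,q^j_l,r_1(y,q^j_l,q^j_{l-1})\big)\ge0$ for every $y\in(q^j_{l-1},q^j_l)$ with $(*_j)^{(-1)^{w_j-l}}=A^j_l(y)$;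 (4) $\frac{d^2}{dx^2}\big\{\xi''(x)^{-1/2}\big\}\le0$ for $x\in[q^j_{w_j},q^{j+1}_{w_j}]$, $1\le j<t$. Consequently $\nu_P$ is $k$-FRSB if and only if there are block points with $s_1+\dots+s_t=k$ that satisfy (1)–(4). -/

import Mathlib

open MeasureTheory

noncomputable section

namespace SphericalSpin

/-! ### The model and its Parisi measure at zero temperature -/

/-- The mixture `ξ(x) = ∑ i, λ i * x ^ p i`. -/
def mixture {n : ℕ} (p : Fin n → ℕ) (lam : Fin n → ℝ) (x : ℝ) : ℝ :=
  ∑ i, lam i * x ^ p i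

/-- The collection `𝒦` of the measures `1_{[0,1)}(x) γ(x) dx + Δ δ_1(dx)` on `[0,1]`, with `γ`
nonnegative, nondecreasing and right-continuous on `[0,1)` and `Δ > 0`. -/
def parisiClass : Set (Measure ℝ) :=
  {ν | ∃ (γ : ℝ → ℝ) (Δ : ℝ),
    (∀ x ∈ Set.Ico (0 : ℝ) 1, 0 ≤ γ x) ∧
    MonotoneOn γ (Set.Ico 0 1) ∧
    (∀ x ∈ Set.Ico (0 : ℝ) 1, ContinuousWithinAt γ (Set.Ici x) x) ∧
    0 < Δ ∧
    ν = (volume.restrict (Set.Ico (0 : ℝ) 1)).withDensity (fun x => ENNReal.ofReal (γ x))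
      + ENNReal.ofReal Δ • Measure.dirac 1}

/-- The Crisanti–Sommers functional
`𝒬(ν) = (∫ ξ'(x) ν(dx) + ∫_0^1 dx / ν((x,1])) / 2`, with values in `[0,∞]`; both integrands are
nonnegative on `[0,1]`. -/
def crisantiSommers (ξ : ℝ → ℝ) (ν : Measure ℝ) : ENNReal :=
  ((∫⁻ x in Set.Icc (0 : ℝ) 1, ENNReal.ofReal (deriv ξ x) ∂ν)
    + ∫⁻ x in Set.Icc (0 : ℝ) 1, (ν (Set.Ioc x 1))⁻¹) / 2

/-- `ν` is the Parisi measure at zero temperature: the minimizer of `𝒬` over `𝒦`. -/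
def IsParisiMeasure (ξ : ℝ → ℝ) (ν : Measure ℝ) : Prop :=
  ν ∈ parisiClass ∧ IsMinOn (crisantiSommers ξ) parisiClass ν

/-! ### Full replica symmetry breaking -/

/-- The points of a `k`-FRSB structure. The blocks are numbered `0, …, t - 1`; block `j` has the
points `q j 0 < q j 1 < ⋯ < q j (s j)`, consecutive blocks are separated by the nondegenerate
interval `[q j (s j), q (j+1) 0]` that carries the `j`-th smooth density, the first point is `0`
and the last point is `1`. There is at least one smooth density, so that `t ≥ 2`. (Values of `s`
and `q` at other indices are irrelevant.) -/
structure BlockPoints where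
  /-- the number of blocks -/
  t : ℕ
  /-- the number of steps in each block -/
  s : ℕ → ℕ
  /-- the points of each block -/
  q : ℕ → ℕ → ℝ
  two_le : 2 ≤ t
  first_eq : q 0 0 = 0
  last_eq : q (t - 1) (s (t - 1)) = 1
  lt_step : ∀ j < t, ∀ i < s j, q j i < q j (i + 1)
  lt_gap : ∀ j, j + 1 < t → q j (s j) < q (j + 1) 0

/-- `w j = s 0 + ⋯ + s (j - 1)`, the number of steps in the first `j` blocks. -/
def BlockPoints.w (B : BlockPoints) (j : ℕ) : ℕ := ∑ i ∈ Finset.range j, B.s i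

/-- The total number `k` of steps. -/
def BlockPoints.k (B : BlockPoints) : ℕ := B.w B.t

/-- The union of the smooth-density intervals `[q j (s j), q (j+1) 0)`. -/
def BlockPoints.smoothSet (B : BlockPoints) : Set ℝ :=
  {x | ∃ j, j + 1 < B.t ∧ x ∈ Set.Ico (B.q j (B.s j)) (B.q (j + 1) 0)}

/-- The density with the value `m l` on the `l`-th step (`l = 1, …, k`, counted through all blocks)
and `ω` on the smooth-density intervals. -/
def BlockPoints.density (B : BlockPoints) (m : ℕ → ℝ) (ω : ℝ → ℝ) (x : ℝ) : ℝ :=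
  (∑ j ∈ Finset.range B.t, ∑ i ∈ Finset.Icc 1 (B.s j),
      (Set.Ico (B.q j (i - 1)) (B.q j i)).indicator (fun _ => m (B.w j + i)) x)
    + ∑ j ∈ Finset.range (B.t - 1),
      (Set.Ico (B.q j (B.s j)) (B.q (j + 1) 0)).indicator ω x

/-- `ν` is `k`-FRSB with the block points `B` (and `k = B.k`). -/
def IsFRSBAt (ν : Measure ℝ) (B : BlockPoints) : Prop :=
  ∃ (m : ℕ → ℝ) (ω : ℝ → ℝ) (Δ : ℝ),
    (∀ l ∈ Set.Icc 1 B.k, 0 < m l) ∧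
    StrictMonoOn m (Set.Icc 1 B.k) ∧
    (∀ x ∈ B.smoothSet, 0 ≤ ω x) ∧
    StrictMonoOn ω B.smoothSet ∧
    0 < Δ ∧
    ν = volume.withDensity (fun x => ENNReal.ofReal (B.density m ω x))
      + ENNReal.ofReal Δ • Measure.dirac 1

/-- `ν` is `k`-FRSB. -/
def IsFRSB (k : ℕ) (ν : Measure ℝ) : Prop :=
  ∃ B : BlockPoints, B.k = k ∧ IsFRSBAt ν B

/-! ### The functions of the criterion -/

/-- The function `h(x, y, z)`. -/
def h (ξ : ℝ → ℝ) (x y z : ℝ) : ℝ :=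
  ξ y - ξ x - deriv ξ x * (y - x)
    + (deriv ξ y - deriv ξ x) * (y - x) * (1 / (z - 1) - z / (z - 1) ^ 2 * Real.log z)

/-- The function `r_1(x, y, z)`. -/
def r₁ (ξ : ℝ → ℝ) (x y z : ℝ) : ℝ :=
  ((deriv ξ z - deriv ξ y) * (z - x)) / ((z - y) * (deriv ξ z - deriv ξ x))

/-- The function `r_2(x, y)`. -/
def r₂ (ξ : ℝ → ℝ) (x y : ℝ) : ℝ :=
  (iteratedDeriv 2 ξ y * (y - x)) / (deriv ξ y - deriv ξ x)

/-- `𝐫_l(x) = r_1(x_{l-1}, x_{l+1}, x_l)` for `l ≥ 1`. -/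
def rAt (ξ : ℝ → ℝ) (x : ℕ → ℝ) (l : ℕ) : ℝ :=
  r₁ ξ (x (l - 1)) (x (l + 1)) (x l)

/-- `∏_{i=1}^N 𝐫_{s+1-2i}(x) / 𝐫_{s-2i}(x)`. -/
def ratioProd (ξ : ℝ → ℝ) (s : ℕ) (x : ℕ → ℝ) (N : ℕ) : ℝ :=
  ∏ i ∈ Finset.Icc 1 N, rAt ξ x (s + 1 - 2 * i) / rAt ξ x (s - 2 * i)

/-- `ℱ_l^s(x_0, …, x_s)` for `0 ≤ l ≤ s`, `s ≥ 1`. For `l = 0` and `s` even the factors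
`r_2(x_{-1}, x_0)` and `1 / 𝐫_0(x)` of the general formula involve a point `x_{-1}` that does not
exist; it cancels in their product, which is `r_2(x_1, x_0)`. -/
def blockF (ξ : ℝ → ℝ) (s : ℕ) (x : ℕ → ℝ) (l : ℕ) : ℝ :=
  if Odd (s - l) then
    r₂ ξ (x (l + 1)) (x l) * (ratioProd ξ s x ((s - l) / 2))⁻¹
  else if l = 0 then
    r₂ ξ (x 1) (x 0) * rAt ξ x 1 * ratioProd ξ s x (s / 2 - 1)
  else
    r₂ ξ (x (l - 1)) (x l) * ratioProd ξ s x ((s - l) / 2)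

/-- `𝒜_l^s(x_0, …, x_s)` for `1 ≤ l ≤ s - 1`. -/
def blockA (ξ : ℝ → ℝ) (s : ℕ) (x : ℕ → ℝ) (l : ℕ) : ℝ :=
  if Odd (s - l) then
    r₁ ξ (x l) (x (l + 1)) (x (l - 1)) * ratioProd ξ s x ((s - l) / 2)
  else
    r₁ ξ (x l) (x (l - 1)) (x (l + 1)) * (ratioProd ξ s x ((s - l) / 2))⁻¹

/-- `𝒵^s(x_0, …, x_s)`, the maximum of a finite set (nonempty for `s ≥ 1`). -/
def blockZ (ξ : ℝ → ℝ) (s : ℕ) (x : ℕ → ℝ) : ℝ :=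
  sSup ({v | ∃ l, l ≤ s ∧ Odd (s - l) ∧ v = blockF ξ s x l} ∪
    {v | ∃ l, 1 ≤ l ∧ l < s ∧ Even (s - l) ∧ v = blockA ξ s x l})

/-- `𝒴^s(x_0, …, x_s)`, the maximum of a finite set (nonempty for `s ≥ 1`). -/
def blockY (ξ : ℝ → ℝ) (s : ℕ) (x : ℕ → ℝ) : ℝ :=
  sSup ({v | ∃ l, l ≤ s ∧ Even (s - l) ∧ v = blockF ξ s x l} ∪
    {v | ∃ l, 1 ≤ l ∧ l < s ∧ Odd (s - l) ∧ v = blockA ξ s x l})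

/-- The sequence `(x_0, …, x_{l-1}, y, x_l, x_{l+1}, …)`. -/
def insertPoint (x : ℕ → ℝ) (l : ℕ) (y : ℝ) (i : ℕ) : ℝ :=
  if i < l then x i else if i = l then y else x (i - 1)

/-- The function `A_l(y)` on `(x_{l-1}, x_l)` that determines the critical points in the `l`-th step
of a block, `1 ≤ l ≤ s`. For `l < s` it is `𝒜_l^{s+1}` at the block with `y` inserted; both this and
the value for `l = s` equal `r_1(x_{l-1}, x_l, y)` times the product of the ratios of the `𝐫`s that
occurs in `ℱ_l^s`. -/
def critA (ξ : ℝ → ℝ) (s : ℕ) (x : ℕ → ℝ) (l : ℕ) (y : ℝ) : ℝ :=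
  if l < s then blockA ξ (s + 1) (insertPoint x l y) l
  else r₁ ξ (x (l - 1)) (x l) y

/-- `F_{w_{j-1} + i}^j` for `0 ≤ i ≤ s_j`. -/
def BlockPoints.F (B : BlockPoints) (ξ : ℝ → ℝ) (j i : ℕ) : ℝ :=
  blockF ξ (B.s j) (B.q j) i

/-- The number `*_j`: the last `F^j` of the block if the block is not the last one, and
`(first F^j) ^ ((-1) ^ s_j)` for the last block. -/
def BlockPoints.star (B : BlockPoints) (ξ : ℝ → ℝ) (j : ℕ) : ℝ :=
  if j + 1 < B.t then B.F ξ j (B.s j) else (B.F ξ j 0) ^ ((-1 : ℤ) ^ B.s j)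

/-- The conditions on the block points. A block with `s j = 0` is a single point and is subject to
no condition other than `concave` on the adjacent intervals. -/
structure FRSBCriterion (ξ : ℝ → ℝ) (B : BlockPoints) : Prop where
  /-- the system of `h`-equations -/
  h_eq : ∀ j < B.t, ∀ i, 1 ≤ i → i ≤ B.s j →
    h ξ (B.q j (i - 1)) (B.q j i)
      (r₂ ξ (B.q j (i - 1)) (B.q j i) * (B.F ξ j i)⁻¹
        * (B.star ξ j) ^ ((-1 : ℤ) ^ (B.s j - i))) = 0
  /-- the matching conditions for the blocks that are neither the first nor the last -/
  matching : ∀ j, 0 < j → j + 1 < B.t → 0 < B.s j →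
    B.F ξ j 0 = (B.F ξ j (B.s j)) ^ ((-1 : ℤ) ^ B.s j)
  /-- `Y^j ≤ *_j` -/
  lower : ∀ j < B.t, 0 < B.s j → blockY ξ (B.s j) (B.q j) ≤ B.star ξ j
  /-- `*_j ≤ (Z^j)⁻¹`, where `(Z^j)⁻¹ = +∞` if `Z^j = 0` -/
  upper : ∀ j < B.t, 0 < B.s j → B.star ξ j * blockZ ξ (B.s j) (B.q j) ≤ 1
  /-- in the two bounds, the inequalities with the numbers `A_l^j` are strict -/
  strict : ∀ j < B.t, ∀ i, 1 ≤ i → i < B.s j →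
    (Odd (B.s j - i) → blockA ξ (B.s j) (B.q j) i < B.star ξ j) ∧
    (Even (B.s j - i) → B.star ξ j * blockA ξ (B.s j) (B.q j) i < 1)
  /-- positivity of `h` at the interior critical points -/
  crit : ∀ j < B.t, ∀ i, 1 ≤ i → i ≤ B.s j → ∀ y ∈ Set.Ioo (B.q j (i - 1)) (B.q j i),
    (B.star ξ j) ^ ((-1 : ℤ) ^ (B.s j - i)) = critA ξ (B.s j) (B.q j) i y →
      0 ≤ h ξ y (B.q j i) (r₁ ξ y (B.q j i) (B.q j (i - 1)))
  /-- `(ξ''^{-1/2})'' ≤ 0` on the smooth-density intervals -/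
  concave : ∀ j, j + 1 < B.t → ∀ x ∈ Set.Icc (B.q j (B.s j)) (B.q (j + 1) 0),
    iteratedDeriv 2 (fun y => (iteratedDeriv 2 ξ y) ^ (-(1 / 2 : ℝ))) x ≤ 0

end SphericalSpin

end

/-! Write Γ(x) = ν((x,1]) = Δ + ∫_x^1 γ. In terms of γ and Δ the functional is convex, and
`energy_sub` expands it exactly: a linear term governed by the first variation g(x) = ξ'(x) − ∫_0^x
Γ^{-2}, plus a nonnegative remainder, quadratic in the change of Γ. A nonnegative nondecreasing
density is a superposition of steps 1_{[u,1)}, so the optimality conditions are g(1) = 0, G(u) =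
∫_u^1 g ≥ 0 for every u, and ∫ gγ = 0 (`Stationary`). A minimizer satisfies them
(`IsParisiMeasure.stationary`), and a measure that satisfies them is the only possible minimizer
(`Stationary.eq_of_isParisiMeasure`). By complementary slackness G, and with it g = −G', vanishes
wherever γ increases.

The theorem translates these conditions to the block form. On a smooth interval g = 0, so g' = ξ'' −
Γ^{-2} = 0 and Γ is the profile ξ''^{-1/2}. The density −Γ' increases when the profile is concave,
and strictly so because the profile of a polynomial is affine on no interval. On a step [a,b] the
tail mass is affine. With A = Γ(a) and E = Γ(b), the zeros of g at the ends give (ξ'(b) − ξ'(a))AE =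
b − a, and an explicit antiderivative gives ∫_a^b g = h(a,b,A/E), which has to vanish.

Within a block, the products Γ_{l-1}Γ_l of consecutive tail masses are thus fixed by the points, and
the ratios z_l = Γ_{l-1}/Γ_l satisfy z_l z_{l+1} = 𝐫_l. All ratios follow from the last one, ζ; the
alternating products in ℱ and 𝒜 solve this recursion (`blockRatio`). An end of a block next to a
smooth interval has ξ''Γ² = 1, which fixes ζ; a middle block has two such ends, whence the matching
condition. The bounds by ℱ say ξ''Γ² ≤ 1 at the block points (the second-order condition for the
minima of G), those by 𝒜 say that the step heights increase, and G ≥ 0 inside a step has to be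
tested only at the critical points of G.

Conversely, the criterion yields tail masses on every block with ζ = *_j
(`BlockCriterion.exists_tail`), joined by the profile. The h-equations force all ratios above 1, so
the steps have positive height, and the sign of G near the block ends makes the slopes compare
correctly with the profile at the junctions. The resulting measure is stationary, hence it is the
Parisi measure. -/

namespace SphericalSpin

/-! ### Polynomials with positive third derivative -/

/-- A polynomial function whose first two derivatives vanish at `0` and whose third derivative is
positive on `(0, ∞)`. -/
structure IsCubicLike (ξ : ℝ → ℝ) : Prop where
  poly : ∃ P : Polynomial ℝ, ∀ x, ξ x = P.eval x
  deriv_zero : deriv ξ 0 = 0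
  deriv2_zero : iteratedDeriv 2 ξ 0 = 0
  deriv3_pos : ∀ x, 0 < x → 0 < iteratedDeriv 3 ξ x

theorem iteratedDeriv_two_eq (f : ℝ → ℝ) : iteratedDeriv 2 f = deriv (deriv f) := by
  rw [iteratedDeriv_succ, iteratedDeriv_one]

theorem iteratedDeriv_three_eq (f : ℝ → ℝ) : iteratedDeriv 3 f = deriv (iteratedDeriv 2 f) := by
  rw [iteratedDeriv_succ]

theorem deriv_eval_eq (P : Polynomial ℝ) :
    deriv (fun x => P.eval x) = fun x => P.derivative.eval x := by
  ext x; simp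

/-- Exponents above 2 make ξ' and ξ'' vanish at 0, and ∑ λ = 1 leaves at least one positive
coefficient. The later arguments know the mixture only through these properties. -/
theorem mixture_isCubicLike {n : ℕ} (p : Fin n → ℕ) (lam : Fin n → ℝ)
    (hp : ∀ i, 2 < p i) (hlam : ∀ i, 0 ≤ lam i) (hlam_sum : ∑ i, lam i = 1) :
    IsCubicLike (mixture p lam) := by
  have h1 : deriv (mixture p lam) = fun x => ∑ i, lam i * (p i * x ^ (p i - 1)) := by
    ext x
    refine HasDerivAt.deriv ?_
    unfold mixture
    exact HasDerivAt.fun_sum fun i _ => (hasDerivAt_pow (p i) x).const_mul (lam i)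
  have h2 : iteratedDeriv 2 (mixture p lam) =
      fun x => ∑ i, lam i * (p i * (((p i - 1 : ℕ) : ℝ) * x ^ (p i - 1 - 1))) := by
    rw [iteratedDeriv_two_eq, h1]
    ext x
    refine HasDerivAt.deriv ?_
    exact HasDerivAt.fun_sum fun i _ =>
      ((hasDerivAt_pow (p i - 1) x).const_mul (p i : ℝ)).const_mul (lam i)
  have h3 : iteratedDeriv 3 (mixture p lam) =
      fun x => ∑ i, lam i * (p i * (((p i - 1 : ℕ) : ℝ) *
        (((p i - 1 - 1 : ℕ) : ℝ) * x ^ (p i - 1 - 1 - 1)))) := by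
    rw [iteratedDeriv_three_eq, h2]
    ext x
    refine HasDerivAt.deriv ?_
    exact HasDerivAt.fun_sum fun i _ =>
      (((hasDerivAt_pow (p i - 1 - 1) x).const_mul _).const_mul (p i : ℝ)).const_mul (lam i)
  refine ⟨⟨∑ i, Polynomial.C (lam i) * Polynomial.X ^ p i, fun x => ?_⟩, ?_, ?_, ?_⟩
  · simp [mixture, Polynomial.eval_finsetSum]
  · rw [h1]
    refine Finset.sum_eq_zero fun i _ => ?_
    have := hp i
    simp [show p i - 1 ≠ 0 by omega]
  · rw [h2]
    refine Finset.sum_eq_zero fun i _ => ?_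
    have := hp i
    simp [show p i - 1 - 1 ≠ 0 by omega]
  · intro x hx
    rw [h3]
    have hc : ∀ i, (0 : ℝ) < p i * (((p i - 1 : ℕ) : ℝ) *
        (((p i - 1 - 1 : ℕ) : ℝ) * x ^ (p i - 1 - 1 - 1))) := by
      intro i
      have := hp i
      have a1 : (0 : ℝ) < p i := by exact_mod_cast (by omega : 0 < p i)
      have a2 : (0 : ℝ) < (p i - 1 : ℕ) := by exact_mod_cast (by omega : 0 < p i - 1)
      have a3 : (0 : ℝ) < (p i - 1 - 1 : ℕ) := by exact_mod_cast (by omega : 0 < p i - 1 - 1)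
      positivity
    have : ∃ i, 0 < lam i := by
      by_contra! hcon
      have : ∑ i, lam i ≤ 0 := Finset.sum_nonpos fun i _ => hcon i
      linarith
    obtain ⟨i, hi⟩ := this
    exact Finset.sum_pos' (fun j _ => mul_nonneg (hlam j) (hc j).le)
      ⟨i, Finset.mem_univ i, mul_pos hi (hc i)⟩

/-- The function `ξ''^{-1/2}`. -/
noncomputable def profile (ξ : ℝ → ℝ) (x : ℝ) : ℝ :=
  (iteratedDeriv 2 ξ x) ^ (-(1 / 2 : ℝ))

namespace IsCubicLike

variable {ξ : ℝ → ℝ}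

theorem contDiff (H : IsCubicLike ξ) : ContDiff ℝ ⊤ ξ := by
  obtain ⟨P, hP⟩ := H.poly
  rw [funext hP]
  simpa using P.contDiff_aeval (𝕜 := ℝ) ⊤

theorem hasDerivAt (H : IsCubicLike ξ) (x : ℝ) : HasDerivAt ξ (deriv ξ x) x :=
  (H.contDiff.differentiable (by simp) x).hasDerivAt

theorem hasDerivAt_deriv (H : IsCubicLike ξ) (x : ℝ) :
    HasDerivAt (deriv ξ) (iteratedDeriv 2 ξ x) x := by
  rw [iteratedDeriv_two_eq]
  obtain ⟨P, hP⟩ := H.poly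
  rw [funext hP, deriv_eval_eq]
  exact (Polynomial.differentiable _ x).hasDerivAt

theorem hasDerivAt_deriv2 (H : IsCubicLike ξ) (x : ℝ) :
    HasDerivAt (iteratedDeriv 2 ξ) (iteratedDeriv 3 ξ x) x := by
  rw [iteratedDeriv_three_eq, iteratedDeriv_two_eq]
  obtain ⟨P, hP⟩ := H.poly
  rw [funext hP, deriv_eval_eq, deriv_eval_eq]
  exact (Polynomial.differentiable _ x).hasDerivAt

theorem deriv2_poly (H : IsCubicLike ξ) :
    ∃ P : Polynomial ℝ, ∀ x, iteratedDeriv 2 ξ x = P.eval x := by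
  obtain ⟨P, hP⟩ := H.poly
  refine ⟨P.derivative.derivative, fun x => ?_⟩
  rw [iteratedDeriv_two_eq, funext hP, deriv_eval_eq, deriv_eval_eq]

theorem contDiff_deriv2 (H : IsCubicLike ξ) : ContDiff ℝ ⊤ (iteratedDeriv 2 ξ) := by
  obtain ⟨P, hP⟩ := H.deriv2_poly
  rw [funext hP]
  simpa using P.contDiff_aeval (𝕜 := ℝ) ⊤

theorem continuous (H : IsCubicLike ξ) : Continuous ξ := H.contDiff.continuous

theorem continuous_deriv (H : IsCubicLike ξ) : Continuous (deriv ξ) :=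
  continuous_iff_continuousAt.2 fun x => (H.hasDerivAt_deriv x).continuousAt

theorem continuous_deriv2 (H : IsCubicLike ξ) : Continuous (iteratedDeriv 2 ξ) :=
  continuous_iff_continuousAt.2 fun x => (H.hasDerivAt_deriv2 x).continuousAt

theorem deriv2_strictMonoOn (H : IsCubicLike ξ) :
    StrictMonoOn (iteratedDeriv 2 ξ) (Set.Ici 0) := by
  refine strictMonoOn_of_deriv_pos (convex_Ici 0) H.continuous_deriv2.continuousOn ?_
  intro x hx
  rw [interior_Ici] at hx
  rw [(H.hasDerivAt_deriv2 x).deriv]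
  exact H.deriv3_pos x hx

theorem deriv2_pos (H : IsCubicLike ξ) {x : ℝ} (hx : 0 < x) : 0 < iteratedDeriv 2 ξ x := by
  rw [← H.deriv2_zero]
  exact H.deriv2_strictMonoOn Set.self_mem_Ici hx.le hx

theorem deriv_strictMonoOn (H : IsCubicLike ξ) : StrictMonoOn (deriv ξ) (Set.Ici 0) := by
  refine strictMonoOn_of_deriv_pos (convex_Ici 0) H.continuous_deriv.continuousOn ?_
  intro x hx
  rw [interior_Ici] at hx
  rw [(H.hasDerivAt_deriv x).deriv]
  exact H.deriv2_pos hx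

theorem deriv_lt (H : IsCubicLike ξ) {x y : ℝ} (hx : 0 ≤ x) (hxy : x < y) :
    deriv ξ x < deriv ξ y :=
  H.deriv_strictMonoOn hx (hx.trans hxy.le) hxy

theorem deriv_pos (H : IsCubicLike ξ) {x : ℝ} (hx : 0 < x) : 0 < deriv ξ x := by
  rw [← H.deriv_zero]
  exact H.deriv_lt le_rfl hx

theorem deriv_nonneg (H : IsCubicLike ξ) {x : ℝ} (hx : 0 ≤ x) : 0 ≤ deriv ξ x := by
  rcases hx.eq_or_lt with rfl | hx
  · exact H.deriv_zero.ge
  · exact (H.deriv_pos hx).le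

/-- Strict trapezoid inequality. -/
theorem trapezoid (H : IsCubicLike ξ) {a b : ℝ} (ha : 0 ≤ a) (hab : a < b) :
    ξ b - ξ a - deriv ξ a * (b - a) < (deriv ξ b - deriv ξ a) * (b - a) / 2 := by
  let F : ℝ → ℝ := fun x =>
    (deriv ξ x - deriv ξ a) * (x - a) / 2 - (ξ x - ξ a - deriv ξ a * (x - a))
  have hF : ∀ x, HasDerivAt F
      ((iteratedDeriv 2 ξ x * (x - a) - (deriv ξ x - deriv ξ a)) / 2) x := by
    intro x
    have h1 := (((H.hasDerivAt_deriv x).sub_const (deriv ξ a)).mul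
      ((hasDerivAt_id x).sub_const a)).div_const 2
    have h2 := ((H.hasDerivAt x).sub_const (ξ a)).sub
      (((hasDerivAt_id x).sub_const a).const_mul (deriv ξ a))
    convert! h1.sub h2 using 1
    simp
    ring
  -- The mean value theorem writes ξ'(x) − ξ'(a) as ξ''(c)(x − a) with c < x, and ξ'' is strictly
  -- increasing.
  have hpos : ∀ x, a < x → 0 < iteratedDeriv 2 ξ x * (x - a) - (deriv ξ x - deriv ξ a) := by
    intro x hx
    obtain ⟨c, hc, hc'⟩ := exists_deriv_eq_slope (deriv ξ) hx H.continuous_deriv.continuousOn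
      (fun y _ => (H.hasDerivAt_deriv y).differentiableAt.differentiableWithinAt)
    rw [(H.hasDerivAt_deriv c).deriv, eq_div_iff (by linarith)] at hc'
    rw [← hc']
    have := H.deriv2_strictMonoOn (show 0 ≤ c by linarith [hc.1]) (show 0 ≤ x by linarith) hc.2
    nlinarith
  have hmono : StrictMonoOn F (Set.Ici a) := by
    refine strictMonoOn_of_deriv_pos (convex_Ici a)
      (fun x _ => (hF x).continuousAt.continuousWithinAt) ?_
    intro x hx
    rw [interior_Ici] at hx
    rw [(hF x).deriv]
    have := hpos x hx
    linarith
  have := hmono Set.self_mem_Ici hab.le hab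
  simp only [F, sub_self, mul_zero, zero_div] at this
  linarith

/-! ### The profile `ξ''^{-1/2}` -/

theorem profile_pos (H : IsCubicLike ξ) {x : ℝ} (hx : 0 < x) : 0 < profile ξ x :=
  Real.rpow_pos_of_pos (H.deriv2_pos hx) _

theorem deriv2_mul_profile_sq (H : IsCubicLike ξ) {x : ℝ} (hx : 0 < x) :
    iteratedDeriv 2 ξ x * profile ξ x ^ 2 = 1 := by
  have h := H.deriv2_pos hx
  rw [profile, ← Real.rpow_natCast, ← Real.rpow_mul h.le]
  norm_num
  rw [Real.rpow_neg_one]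
  exact mul_inv_cancel₀ h.ne'

theorem eq_profile (H : IsCubicLike ξ) {x c : ℝ} (hx : 0 < x) (hc : 0 < c)
    (h : iteratedDeriv 2 ξ x * c ^ 2 = 1) : c = profile ξ x := by
  have h1 := H.deriv2_mul_profile_sq hx
  have h2 : c ^ 2 = profile ξ x ^ 2 := by
    have := (H.deriv2_pos hx).ne'
    exact mul_left_cancel₀ this (h.trans h1.symm)
  exact (pow_left_inj₀ hc.le (H.profile_pos hx).le (by norm_num)).1 h2

theorem contDiffAt_profile (H : IsCubicLike ξ) {x : ℝ} (hx : 0 < x) :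
    ContDiffAt ℝ ⊤ (profile ξ) x :=
  H.contDiff_deriv2.contDiffAt.rpow_const_of_ne (H.deriv2_pos hx).ne'

theorem hasDerivAt_profile (H : IsCubicLike ξ) {x : ℝ} (hx : 0 < x) :
    HasDerivAt (profile ξ) (deriv (profile ξ) x) x :=
  ((H.contDiffAt_profile hx).differentiableAt (by simp)).hasDerivAt

theorem contDiffOn_profile (H : IsCubicLike ξ) : ContDiffOn ℝ ⊤ (profile ξ) (Set.Ioi 0) :=
  fun _ hx => (H.contDiffAt_profile hx).contDiffWithinAt

theorem contDiffOn_deriv_profile (H : IsCubicLike ξ) :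
    ContDiffOn ℝ ⊤ (deriv (profile ξ)) (Set.Ioi 0) :=
  H.contDiffOn_profile.deriv_of_isOpen isOpen_Ioi (by simp)

theorem hasDerivAt_deriv_profile (H : IsCubicLike ξ) {x : ℝ} (hx : 0 < x) :
    HasDerivAt (deriv (profile ξ)) (iteratedDeriv 2 (profile ξ) x) x := by
  rw [iteratedDeriv_two_eq]
  exact ((H.contDiffOn_deriv_profile.contDiffAt (Ioi_mem_nhds hx)).differentiableAt
    (by simp)).hasDerivAt

theorem continuousOn_deriv2_profile (H : IsCubicLike ξ) :
    ContinuousOn (iteratedDeriv 2 (profile ξ)) (Set.Ioi 0) := by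
  rw [iteratedDeriv_two_eq]
  exact (H.contDiffOn_deriv_profile.deriv_of_isOpen (m := ⊤) isOpen_Ioi (by simp)).continuousOn

/-- Differentiating the identity ξ''·profile² = 1 excludes a nonnegative derivative, because ξ''' >
0. -/
theorem deriv_profile_neg (H : IsCubicLike ξ) {x : ℝ} (hx : 0 < x) :
    deriv (profile ξ) x < 0 := by
  have h1 := (H.hasDerivAt_deriv2 x).mul ((H.hasDerivAt_profile hx).pow 2)
  have h2 : HasDerivAt (fun _ : ℝ => (1 : ℝ)) 0 x := hasDerivAt_const x 1
  have h3 : (fun y => iteratedDeriv 2 ξ y * profile ξ y ^ 2) =ᶠ[nhds x] fun _ => 1 := by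
    filter_upwards [Ioi_mem_nhds hx] with y hy
    exact H.deriv2_mul_profile_sq hy
  have h4 := h1.unique (h2.congr_of_eventuallyEq h3)
  simp only [Nat.cast_ofNat, Nat.add_one_sub_one, pow_one, Pi.pow_apply] at h4
  by_contra! hcon
  have a := H.deriv3_pos x hx
  have b := H.profile_pos hx
  have c := H.deriv2_pos hx
  have : 0 < iteratedDeriv 3 ξ x * profile ξ x ^ 2 := by positivity
  have : 0 ≤ iteratedDeriv 2 ξ x * (2 * profile ξ x * deriv (profile ξ) x) := by positivity
  linarith

/-- The profile is not affine on any interval. -/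
theorem profile_not_affine (H : IsCubicLike ξ) {c d A B : ℝ} (hc : 0 < c) (hcd : c < d)
    (h : ∀ x ∈ Set.Ioo c d, profile ξ x = A + B * x) : False := by
  obtain ⟨P, hP⟩ := H.deriv2_poly
  -- The relation ξ''·profile² = 1 becomes an identity of polynomials, since it holds at infinitely
  -- many points. The affine factor is then a unit, hence constant, against the negative derivative
  -- of the profile.
  have hpoly : P * (Polynomial.C A + Polynomial.C B * Polynomial.X) ^ 2 = 1 := by
    refine Polynomial.eq_of_infinite_eval_eq _ _ ((Set.Ioo_infinite hcd).mono fun x hx => ?_)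
    have := H.deriv2_mul_profile_sq (hc.trans hx.1)
    rw [h x hx, hP] at this
    simpa using this
  have hunit : IsUnit (Polynomial.C A + Polynomial.C B * Polynomial.X) :=
    IsUnit.of_mul_eq_one (P * (Polynomial.C A + Polynomial.C B * Polynomial.X))
      (by rw [← hpoly]; ring)
  have hB : B = 0 := by
    by_contra hB
    have := Polynomial.natDegree_eq_zero_of_isUnit hunit
    rw [add_comm, Polynomial.natDegree_linear hB] at this
    exact one_ne_zero this
  obtain ⟨x, hx⟩ := Set.nonempty_Ioo.2 hcd
  have hx0 : 0 < x := hc.trans hx.1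
  have hneg := H.deriv_profile_neg hx0
  have : HasDerivAt (profile ξ) 0 x := by
    refine (hasDerivAt_const x A).congr_of_eventuallyEq ?_
    filter_upwards [Ioo_mem_nhds hx.1 hx.2] with y hy
    rw [h y hy, hB]; ring
  rw [this.deriv] at hneg
  exact lt_irrefl _ hneg

/-- If the profile has nonpositive second derivative on an interval, its derivative is strictly
decreasing there. -/
theorem deriv_profile_strictAntiOn (H : IsCubicLike ξ) {a b : ℝ} (ha : 0 < a)
    (h : ∀ x ∈ Set.Icc a b, iteratedDeriv 2 (profile ξ) x ≤ 0) :
    StrictAntiOn (deriv (profile ξ)) (Set.Icc a b) := by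
  have hanti : AntitoneOn (deriv (profile ξ)) (Set.Icc a b) := by
    refine antitoneOn_of_deriv_nonpos (convex_Icc a b)
      (fun x hx => (H.hasDerivAt_deriv_profile (ha.trans_le hx.1)).continuousAt.continuousWithinAt)
      (fun x hx => ?_) (fun x hx => ?_)
    · rw [interior_Icc] at hx
      exact (H.hasDerivAt_deriv_profile (ha.trans hx.1)).differentiableAt.differentiableWithinAt
    · rw [interior_Icc] at hx
      rw [(H.hasDerivAt_deriv_profile (ha.trans hx.1)).deriv]
      exact h x (Set.Ioo_subset_Icc_self hx)
  intro x hx y hy hxy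
  -- Equal derivatives at x < y would freeze the derivative between them and make the profile affine
  -- there.
  refine lt_of_le_of_ne (hanti hx hy hxy.le) fun heq => ?_
  have hx0 : 0 < x := ha.trans_le hx.1
  set B := deriv (profile ξ) x with hB
  have hconst : ∀ z ∈ Set.Icc x y, deriv (profile ξ) z = B := by
    intro z hz
    have hz' : z ∈ Set.Icc a b := ⟨hx.1.trans hz.1, hz.2.trans hy.2⟩
    exact le_antisymm (hanti hx hz' hz.1) (heq ▸ hanti hz' hy hz.2)
  refine H.profile_not_affine (c := x) (d := y) (A := profile ξ x - B * x) (B := B) hx0 hxy ?_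
  intro z hz
  obtain ⟨c, hc, hc'⟩ := exists_deriv_eq_slope (profile ξ) hz.1
    (fun w hw => (H.hasDerivAt_profile (hx0.trans_le hw.1)).continuousAt.continuousWithinAt)
    (fun w hw => (H.hasDerivAt_profile
      (hx0.trans hw.1)).differentiableAt.differentiableWithinAt)
  rw [hconst c ⟨hc.1.le, hc.2.le.trans hz.2.le⟩, eq_div_iff (by linarith [hz.1])] at hc'
  linarith

end IsCubicLike

end SphericalSpin

namespace SphericalSpin

/-! ### The functional in terms of the density -/

/-- The mass `Δ + ∫_x^1 γ` that the measure with density `γ` and atom `Δ` gives to `(x, 1]`. -/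
noncomputable def tailMass (γ : ℝ → ℝ) (Δ x : ℝ) : ℝ := Δ + ∫ t in x..1, γ t

/-- The measure `1_{[0,1)}(x) γ(x) dx + Δ δ_1(dx)`. -/
noncomputable def densityMeasure (γ : ℝ → ℝ) (Δ : ℝ) : Measure ℝ :=
  (volume.restrict (Set.Ico (0 : ℝ) 1)).withDensity (fun x => ENNReal.ofReal (γ x))
    + ENNReal.ofReal Δ • Measure.dirac 1

/-- The density and the atom of a measure of finite mass in `parisiClass`. -/
structure Admissible (γ : ℝ → ℝ) (Δ : ℝ) : Prop where
  nonneg : ∀ x ∈ Set.Ico (0 : ℝ) 1, 0 ≤ γ x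
  mono : MonotoneOn γ (Set.Ico 0 1)
  right : ∀ x ∈ Set.Ico (0 : ℝ) 1, ContinuousWithinAt γ (Set.Ici x) x
  atom_pos : 0 < Δ
  integrable : IntervalIntegrable γ volume 0 1

/-- Twice the Crisanti–Sommers functional. -/
noncomputable def energy (ξ γ : ℝ → ℝ) (Δ : ℝ) : ℝ :=
  (∫ x in (0 : ℝ)..1, deriv ξ x * γ x) + deriv ξ 1 * Δ + ∫ x in (0 : ℝ)..1, (tailMass γ Δ x)⁻¹

/-- The first variation `ξ'(x) - ∫_0^x ν((t,1])^{-2} dt` of the functional. -/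
noncomputable def variation (ξ γ : ℝ → ℝ) (Δ x : ℝ) : ℝ :=
  deriv ξ x - ∫ t in (0 : ℝ)..x, (tailMass γ Δ t ^ 2)⁻¹

namespace Admissible

variable {ξ γ γ' : ℝ → ℝ} {Δ Δ' : ℝ}

theorem mem_parisiClass (h : Admissible γ Δ) : densityMeasure γ Δ ∈ parisiClass :=
  ⟨γ, Δ, h.nonneg, h.mono, h.right, h.atom_pos, rfl⟩

theorem integrable_sub (h : Admissible γ Δ) {x y : ℝ} (hx : x ∈ Set.Icc (0 : ℝ) 1)
    (hy : y ∈ Set.Icc (0 : ℝ) 1) : IntervalIntegrable γ volume x y :=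
  h.integrable.mono_set (by
    rw [Set.uIcc_of_le zero_le_one]
    exact Set.uIcc_subset_Icc hx hy)

theorem tailMass_sub (h : Admissible γ Δ) {x y : ℝ} (hx : x ∈ Set.Icc (0 : ℝ) 1)
    (hy : y ∈ Set.Icc (0 : ℝ) 1) : tailMass γ Δ x = tailMass γ Δ y + ∫ t in x..y, γ t := by
  have h1 : (1 : ℝ) ∈ Set.Icc (0 : ℝ) 1 := by simp
  rw [tailMass, tailMass, ← intervalIntegral.integral_add_adjacent_intervals
    (h.integrable_sub hx hy) (h.integrable_sub hy h1)]
  ring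

theorem integral_nonneg (h : Admissible γ Δ) {x y : ℝ} (hx : 0 ≤ x) (hxy : x ≤ y) (hy : y ≤ 1) :
    0 ≤ ∫ t in x..y, γ t := by
  rw [intervalIntegral.integral_of_le hxy, integral_Ioc_eq_integral_Ioo]
  exact setIntegral_nonneg measurableSet_Ioo
    fun t ht => h.nonneg t ⟨hx.trans ht.1.le, ht.2.trans_le hy⟩

theorem atom_le (h : Admissible γ Δ) {x : ℝ} (hx : x ∈ Set.Icc (0 : ℝ) 1) :
    Δ ≤ tailMass γ Δ x := by
  have := h.integral_nonneg hx.1 hx.2 le_rfl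
  rw [tailMass]; linarith

theorem tailMass_pos (h : Admissible γ Δ) {x : ℝ} (hx : x ∈ Set.Icc (0 : ℝ) 1) :
    0 < tailMass γ Δ x := h.atom_pos.trans_le (h.atom_le hx)

theorem continuousOn_tailMass (h : Admissible γ Δ) :
    ContinuousOn (tailMass γ Δ) (Set.Icc 0 1) := by
  have := intervalIntegral.continuousOn_primitive_interval_left (a := 0) (b := 1) (f := γ)
    (μ := volume) (by
      have := (intervalIntegrable_iff_integrableOn_Icc_of_le zero_le_one).1 h.integrable
      rwa [Set.uIcc_of_le zero_le_one])
  rw [Set.uIcc_of_le zero_le_one] at this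
  exact continuousOn_const.add this

theorem continuousOn_inv_sq (h : Admissible γ Δ) :
    ContinuousOn (fun t => (tailMass γ Δ t ^ 2)⁻¹) (Set.Icc 0 1) :=
  (h.continuousOn_tailMass.pow 2).inv₀ fun _ hx => (pow_pos (h.tailMass_pos hx) 2).ne'

theorem intervalIntegrable_inv_sq (h : Admissible γ Δ) {x y : ℝ} (hx : x ∈ Set.Icc (0 : ℝ) 1)
    (hy : y ∈ Set.Icc (0 : ℝ) 1) :
    IntervalIntegrable (fun t => (tailMass γ Δ t ^ 2)⁻¹) volume x y :=
  (h.continuousOn_inv_sq.mono (Set.uIcc_subset_Icc hx hy)).intervalIntegrable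

theorem continuousOn_variation (hξ : IsCubicLike ξ) (h : Admissible γ Δ) :
    ContinuousOn (variation ξ γ Δ) (Set.Icc 0 1) := by
  have := intervalIntegral.continuousOn_primitive_interval (a := 0) (b := 1)
    (f := fun t => (tailMass γ Δ t ^ 2)⁻¹) (μ := volume) (by
      rw [Set.uIcc_of_le zero_le_one]
      exact h.continuousOn_inv_sq.integrableOn_Icc)
  rw [Set.uIcc_of_le zero_le_one] at this
  exact hξ.continuous_deriv.continuousOn.sub this

theorem variation_sub (h : Admissible γ Δ) {x y : ℝ} (hx : x ∈ Set.Icc (0 : ℝ) 1)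
    (hy : y ∈ Set.Icc (0 : ℝ) 1) : variation ξ γ Δ y - variation ξ γ Δ x =
      deriv ξ y - deriv ξ x - ∫ t in x..y, (tailMass γ Δ t ^ 2)⁻¹ := by
  have h0 : (0 : ℝ) ∈ Set.Icc (0 : ℝ) 1 := by simp
  rw [variation, variation, ← intervalIntegral.integral_add_adjacent_intervals
    (h.intervalIntegrable_inv_sq h0 hx) (h.intervalIntegrable_inv_sq hx hy)]
  ring

theorem hasDerivAt_variation (hξ : IsCubicLike ξ) (h : Admissible γ Δ) {x : ℝ}
    (hx : x ∈ Set.Ioo (0 : ℝ) 1) :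
    HasDerivAt (variation ξ γ Δ) (iteratedDeriv 2 ξ x - (tailMass γ Δ x ^ 2)⁻¹) x := by
  have hx' := Set.Ioo_subset_Icc_self hx
  refine (hξ.hasDerivAt_deriv x).sub ?_
  refine intervalIntegral.integral_hasDerivAt_right
    (h.intervalIntegrable_inv_sq (by simp) hx')
    (h.continuousOn_inv_sq.stronglyMeasurableAtFilter_nhdsWithin measurableSet_Icc x |>.filter_mono
      ?_) (h.continuousOn_inv_sq.continuousAt (Icc_mem_nhds hx.1 hx.2))
  rw [nhdsWithin_eq_nhds.2 (Icc_mem_nhds hx.1 hx.2)]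

/-- `ν((x,1])` for `x ∈ [0,1)`. -/
theorem densityMeasure_Ioc (h : Admissible γ Δ) {x : ℝ} (hx : x ∈ Set.Ico (0 : ℝ) 1) :
    densityMeasure γ Δ (Set.Ioc x 1) = ENNReal.ofReal (tailMass γ Δ x) := by
  have hint := h.integrable_sub (Set.Ico_subset_Icc_self hx) (y := 1) (by simp)
  rw [densityMeasure, Measure.add_apply, withDensity_apply _ measurableSet_Ioc,
    Measure.restrict_restrict measurableSet_Ioc, Measure.smul_apply,
    Measure.dirac_apply' _ measurableSet_Ioc, Set.indicator_of_mem (by exact ⟨hx.2, le_rfl⟩)]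
  have hset : Set.Ioc x 1 ∩ Set.Ico 0 1 = Set.Ioo x 1 := by
    ext t; simp only [Set.mem_inter_iff, Set.mem_Ioc, Set.mem_Ico, Set.mem_Ioo]
    constructor
    · rintro ⟨⟨a, _⟩, _, b⟩; exact ⟨a, b⟩
    · rintro ⟨a, b⟩; exact ⟨⟨a, b.le⟩, hx.1.trans a.le, b⟩
  rw [hset, tailMass, ENNReal.ofReal_add h.atom_pos.le (h.integral_nonneg hx.1 hx.2.le le_rfl),
    intervalIntegral.integral_of_le hx.2.le, integral_Ioc_eq_integral_Ioo,
    ofReal_integral_eq_lintegral_ofReal]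
  · simp [add_comm]
  · exact ((intervalIntegrable_iff_integrableOn_Ioo_of_le hx.2.le).1 hint)
  · refine (ae_restrict_iff' measurableSet_Ioo).2 (Filter.Eventually.of_forall fun t ht => ?_)
    exact h.nonneg t ⟨hx.1.trans ht.1.le, ht.2⟩

end Admissible

theorem lintegral_densityMeasure {γ f : ℝ → ℝ} {Δ : ℝ} (hf : Continuous f)
    (hf0 : ∀ x ∈ Set.Icc (0 : ℝ) 1, 0 ≤ f x) (hγ : MonotoneOn γ (Set.Ico 0 1)) :
    ∫⁻ x in Set.Icc (0 : ℝ) 1, ENNReal.ofReal (f x) ∂(densityMeasure γ Δ) =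
      (∫⁻ x in Set.Ico (0 : ℝ) 1, ENNReal.ofReal (f x * γ x))
        + ENNReal.ofReal (f 1) * ENNReal.ofReal Δ := by
  have hmeas : AEMeasurable (fun x => ENNReal.ofReal (γ x))
      (volume.restrict (Set.Ico (0 : ℝ) 1)) :=
    (aemeasurable_restrict_of_monotoneOn measurableSet_Ico hγ).ennreal_ofReal
  have hset : Set.Icc (0 : ℝ) 1 ∩ Set.Ico 0 1 = Set.Ico 0 1 :=
    Set.inter_eq_right.2 Set.Ico_subset_Icc_self
  rw [densityMeasure, Measure.restrict_add, lintegral_add_measure, Measure.restrict_smul,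
    lintegral_smul_measure, restrict_withDensity measurableSet_Icc,
    Measure.restrict_restrict measurableSet_Icc, hset,
    lintegral_withDensity_eq_lintegral_mul₀ hmeas
      hf.measurable.ennreal_ofReal.aemeasurable,
    Measure.restrict_eq_self_of_ae_mem (μ := Measure.dirac (1 : ℝ)) (by
      rw [ae_dirac_eq]; simp), lintegral_dirac]
  congr 1
  · refine setLIntegral_congr_fun measurableSet_Ico fun x hx => ?_
    rw [ENNReal.ofReal_mul (hf0 x (Set.Ico_subset_Icc_self hx)), mul_comm]
    rfl
  · simp [mul_comm]

variable {ξ γ γ' : ℝ → ℝ} {Δ Δ' : ℝ}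

theorem crisantiSommers_densityMeasure (hξ : IsCubicLike ξ) (h : Admissible γ Δ) :
    crisantiSommers ξ (densityMeasure γ Δ) = ENNReal.ofReal (energy ξ γ Δ) / 2 := by
  have hnn : ∀ x ∈ Set.Ico (0 : ℝ) 1, 0 ≤ deriv ξ x * γ x :=
    fun x hx => mul_nonneg (hξ.deriv_nonneg hx.1) (h.nonneg x hx)
  have hint : IntervalIntegrable (fun x => deriv ξ x * γ x) volume 0 1 :=
    h.integrable.continuousOn_mul hξ.continuous_deriv.continuousOn
  have hinv : ContinuousOn (fun x => (tailMass γ Δ x)⁻¹) (Set.Icc 0 1) :=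
    h.continuousOn_tailMass.inv₀ fun x hx => (h.tailMass_pos hx).ne'
  have e1 : ∫⁻ x in Set.Ico (0 : ℝ) 1, ENNReal.ofReal (deriv ξ x * γ x) =
      ENNReal.ofReal (∫ x in (0 : ℝ)..1, deriv ξ x * γ x) := by
    rw [intervalIntegral.integral_of_le zero_le_one, ← integral_Ico_eq_integral_Ioc,
      ofReal_integral_eq_lintegral_ofReal]
    · exact (intervalIntegrable_iff_integrableOn_Ico_of_le zero_le_one).1 hint
    · exact (ae_restrict_iff' measurableSet_Ico).2 (Filter.Eventually.of_forall hnn)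
  have e2 : ∫⁻ x in Set.Icc (0 : ℝ) 1, (densityMeasure γ Δ (Set.Ioc x 1))⁻¹ =
      ENNReal.ofReal (∫ x in (0 : ℝ)..1, (tailMass γ Δ x)⁻¹) := by
    rw [intervalIntegral.integral_of_le zero_le_one, ← integral_Ico_eq_integral_Ioc,
      ofReal_integral_eq_lintegral_ofReal]
    · rw [Measure.restrict_congr_set (Ico_ae_eq_Icc (μ := volume) (a := (0 : ℝ)) (b := 1)).symm]
      refine setLIntegral_congr_fun measurableSet_Ico fun x hx => ?_
      rw [h.densityMeasure_Ioc hx,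
        ENNReal.ofReal_inv_of_pos (h.tailMass_pos (Set.Ico_subset_Icc_self hx))]
    · exact hinv.integrableOn_Icc.mono_set Set.Ico_subset_Icc_self
    · exact (ae_restrict_iff' measurableSet_Ico).2 (Filter.Eventually.of_forall fun x hx =>
        inv_nonneg.2 (h.tailMass_pos (Set.Ico_subset_Icc_self hx)).le)
  have n1 : 0 ≤ ∫ x in (0 : ℝ)..1, deriv ξ x * γ x := by
    rw [intervalIntegral.integral_of_le zero_le_one, ← integral_Ico_eq_integral_Ioc]
    exact setIntegral_nonneg measurableSet_Ico hnn
  have n2 : 0 ≤ ∫ x in (0 : ℝ)..1, (tailMass γ Δ x)⁻¹ :=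
    intervalIntegral.integral_nonneg zero_le_one fun x hx => inv_nonneg.2 (h.tailMass_pos hx).le
  have n3 : 0 ≤ deriv ξ 1 := hξ.deriv_nonneg zero_le_one
  rw [crisantiSommers, lintegral_densityMeasure hξ.continuous_deriv
    (fun x hx => hξ.deriv_nonneg hx.1) h.mono, e1, e2, energy,
    ENNReal.ofReal_add (by have := h.atom_pos; positivity) n2,
    ENNReal.ofReal_add n1 (by have := h.atom_pos; positivity), ENNReal.ofReal_mul n3]

theorem energy_nonneg (hξ : IsCubicLike ξ) (h : Admissible γ Δ) : 0 ≤ energy ξ γ Δ := by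
  have n1 : 0 ≤ ∫ x in (0 : ℝ)..1, deriv ξ x * γ x := by
    rw [intervalIntegral.integral_of_le zero_le_one, ← integral_Ico_eq_integral_Ioc]
    exact setIntegral_nonneg measurableSet_Ico
      fun x hx => mul_nonneg (hξ.deriv_nonneg hx.1) (h.nonneg x hx)
  have n2 : 0 ≤ ∫ x in (0 : ℝ)..1, (tailMass γ Δ x)⁻¹ :=
    intervalIntegral.integral_nonneg zero_le_one fun x hx => inv_nonneg.2 (h.tailMass_pos hx).le
  have n3 := mul_nonneg (hξ.deriv_nonneg zero_le_one) h.atom_pos.le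
  rw [energy]; linarith

theorem crisantiSommers_le_iff (hξ : IsCubicLike ξ) (h : Admissible γ Δ)
    (h' : Admissible γ' Δ') :
    crisantiSommers ξ (densityMeasure γ Δ) ≤ crisantiSommers ξ (densityMeasure γ' Δ') ↔
      energy ξ γ Δ ≤ energy ξ γ' Δ' := by
  rw [crisantiSommers_densityMeasure hξ h, crisantiSommers_densityMeasure hξ h',
    ENNReal.div_le_iff (by simp) (by simp), ENNReal.div_mul_cancel (by simp) (by simp),
    ENNReal.ofReal_le_ofReal_iff (energy_nonneg hξ h')]

theorem admissible_zero_one : Admissible (fun _ => 0) 1 :=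
  ⟨fun _ _ => le_rfl, fun _ _ _ _ _ => le_rfl, fun _ _ => continuousWithinAt_const, one_pos,
    intervalIntegrable_const⟩

/-- The Parisi measure has finite mass. -/
theorem IsParisiMeasure.exists_admissible (hξ : IsCubicLike ξ) {ν : Measure ℝ}
    (hν : IsParisiMeasure ξ ν) : ∃ γ Δ, Admissible γ Δ ∧ ν = densityMeasure γ Δ := by
  obtain ⟨⟨γ, Δ, h0, hm, hr, hΔ, rfl⟩, hmin⟩ := hν
  refine ⟨γ, Δ, ⟨h0, hm, hr, hΔ, ?_⟩, rfl⟩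
  -- Comparison with δ_1, whose energy is finite, makes ξ'γ integrable. It remains to remove the
  -- weight ξ', which vanishes only at 0.
  have hle := hmin admissible_zero_one.mem_parisiClass
  rw [Set.mem_ofPred_eq, crisantiSommers_densityMeasure hξ admissible_zero_one] at hle
  have hfin : crisantiSommers ξ (densityMeasure γ Δ) < ⊤ :=
    lt_of_le_of_lt hle (ENNReal.div_lt_top ENNReal.ofReal_ne_top (by simp))
  rw [crisantiSommers, lintegral_densityMeasure hξ.continuous_deriv
    (fun x hx => hξ.deriv_nonneg hx.1) hm] at hfin
  have hfin' : ∫⁻ x in Set.Ico (0 : ℝ) 1, ENNReal.ofReal (deriv ξ x * γ x) < ⊤ := by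
    by_contra hcon
    rw [not_lt, top_le_iff] at hcon
    rw [hcon] at hfin
    simp [ENNReal.top_div] at hfin
  have hmeas : AEMeasurable γ (volume.restrict (Set.Ico (0 : ℝ) 1)) :=
    aemeasurable_restrict_of_monotoneOn measurableSet_Ico hm
  have hI : IntegrableOn (fun x => deriv ξ x * γ x) (Set.Ico 0 1) := by
    refine (lintegral_ofReal_ne_top_iff_integrable ?_ ?_).1 hfin'.ne
    · exact (hξ.continuous_deriv.measurable.aemeasurable.mul hmeas).aestronglyMeasurable
    · exact (ae_restrict_iff' measurableSet_Ico).2 (Filter.Eventually.of_forall fun x hx =>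
        mul_nonneg (hξ.deriv_nonneg hx.1) (h0 x hx))
  -- Up to 1/2 the monotone density is bounded; beyond it ξ' ≥ ξ'(1/2) > 0 and the weight can be
  -- divided out.
  have hhalf : (0 : ℝ) < 1 / 2 := by norm_num
  have hc := hξ.deriv_pos hhalf
  have i1 : IntervalIntegrable γ volume 0 (1 / 2) := by
    refine MonotoneOn.intervalIntegrable (hm.mono ?_)
    rw [Set.uIcc_of_le hhalf.le]
    exact fun x hx => ⟨hx.1, hx.2.trans_lt (by norm_num)⟩
  have i2 : IntervalIntegrable γ volume (1 / 2) 1 := by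
    rw [intervalIntegrable_iff_integrableOn_Ico_of_le (by norm_num)]
    have hsub : Set.Ico (1 / 2 : ℝ) 1 ⊆ Set.Ico 0 1 := Set.Ico_subset_Ico_left hhalf.le
    refine Integrable.mono' ((hI.mono_set hsub).const_mul (deriv ξ (1 / 2))⁻¹)
      (hmeas.mono_set hsub).aestronglyMeasurable ?_
    refine (ae_restrict_iff' measurableSet_Ico).2 (Filter.Eventually.of_forall fun x hx => ?_)
    have hx0 := h0 x (hsub hx)
    rw [Real.norm_of_nonneg hx0, le_inv_mul_iff₀ hc]
    refine mul_le_mul_of_nonneg_right ?_ hx0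
    exact hξ.deriv_strictMonoOn.monotoneOn hhalf.le (hhalf.le.trans hx.1) hx.1
  exact i1.trans i2

theorem IsParisiMeasure.energy_le (hξ : IsCubicLike ξ) (h : Admissible γ Δ)
    (hν : IsParisiMeasure ξ (densityMeasure γ Δ)) (h' : Admissible γ' Δ') :
    energy ξ γ Δ ≤ energy ξ γ' Δ' :=
  (crisantiSommers_le_iff hξ h h').1 (hν.2 h'.mem_parisiClass)

/-! ### The first variation -/

/-- Integration by parts for absolutely continuous primitives; the boundary terms vanish because one
primitive starts at 0 and the other at 1. It moves the change of the tail mass onto the change of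
the density. -/
theorem integral_mul_primitive {k δ : ℝ → ℝ} (hk : IntervalIntegrable k volume 0 1)
    (hδ : IntervalIntegrable δ volume 0 1) :
    ∫ x in (0 : ℝ)..1, k x * ∫ y in x..1, δ y =
      ∫ x in (0 : ℝ)..1, (∫ y in (0 : ℝ)..x, k y) * δ x := by
  have hK := hk.absolutelyContinuousOnInterval_intervalIntegral (c := 0) (by simp)
  have hD := (hδ.absolutelyContinuousOnInterval_intervalIntegral (c := 1) (by simp)).neg
  have key := hK.integral_mul_deriv_eq_deriv_mul hD
  have dK : ∀ᵐ x, x ∈ Set.uIoc (0 : ℝ) 1 →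
      deriv (fun x => ∫ y in (0 : ℝ)..x, k y) x * (∫ y in x..1, δ y) = k x * ∫ y in x..1, δ y := by
    filter_upwards [hk.ae_hasDerivAt_integral] with x hx hx'
    rw [(hx (Set.uIoc_subset_uIcc hx') 0 (by simp)).deriv]
  have dD : ∀ᵐ x, x ∈ Set.uIoc (0 : ℝ) 1 →
      (∫ y in (0 : ℝ)..x, k y) * deriv (-fun x => ∫ y in (1 : ℝ)..x, δ y) x =
        - ((∫ y in (0 : ℝ)..x, k y) * δ x) := by
    filter_upwards [hδ.ae_hasDerivAt_integral] with x hx hx'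
    rw [(hx (Set.uIoc_subset_uIcc hx') 1 (by simp)).neg.deriv]
    ring
  rw [intervalIntegral.integral_congr_ae dD] at key
  have e : ∀ x, (-fun x => ∫ y in (1 : ℝ)..x, δ y) x = ∫ y in x..1, δ y := fun x => by
    rw [Pi.neg_apply, ← intervalIntegral.integral_symm]
  simp only [e] at key
  rw [intervalIntegral.integral_congr_ae dK] at key
  simp only [intervalIntegral.integral_same, mul_zero, zero_mul, sub_zero, zero_sub,
    intervalIntegral.integral_neg, neg_inj] at key
  exact key.symm

/-- The exact second order expansion of the functional. -/
theorem energy_sub (hξ : IsCubicLike ξ) (h : Admissible γ Δ) (h' : Admissible γ' Δ') :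
    energy ξ γ' Δ' - energy ξ γ Δ =
      (∫ x in (0 : ℝ)..1, variation ξ γ Δ x * (γ' x - γ x)) + variation ξ γ Δ 1 * (Δ' - Δ)
      + ∫ x in (0 : ℝ)..1, (tailMass γ' Δ' x - tailMass γ Δ x) ^ 2 /
          (tailMass γ' Δ' x * tailMass γ Δ x ^ 2) := by
  have hd : IntervalIntegrable (fun x => γ' x - γ x) volume 0 1 := h'.integrable.sub h.integrable
  have hk := h.intervalIntegrable_inv_sq (x := 0) (y := 1) (by simp) (by simp)
  have c0 : ContinuousOn (fun x => ∫ t in (0 : ℝ)..x, (tailMass γ Δ t ^ 2)⁻¹) (Set.uIcc 0 1) := by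
    refine intervalIntegral.continuousOn_primitive_interval ?_
    rw [Set.uIcc_of_le zero_le_one]
    exact h.continuousOn_inv_sq.integrableOn_Icc
  have cG := h.continuousOn_tailMass
  have cG' := h'.continuousOn_tailMass
  have pG : ∀ x ∈ Set.Icc (0 : ℝ) 1, tailMass γ Δ x ≠ 0 := fun x hx => (h.tailMass_pos hx).ne'
  have pG' : ∀ x ∈ Set.Icc (0 : ℝ) 1, tailMass γ' Δ' x ≠ 0 := fun x hx => (h'.tailMass_pos hx).ne'
  have ci : ∀ f : ℝ → ℝ, ContinuousOn f (Set.Icc 0 1) → IntervalIntegrable f volume 0 1 := by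
    intro f hf
    refine ContinuousOn.intervalIntegrable ?_
    rwa [Set.uIcc_of_le zero_le_one]
  have i1 := ci (fun x => (tailMass γ' Δ' x)⁻¹) (cG'.inv₀ pG')
  have i2 := ci (fun x => (tailMass γ Δ x)⁻¹) (cG.inv₀ pG)
  have i3 : IntervalIntegrable (fun x => (tailMass γ' Δ' x - tailMass γ Δ x) ^ 2 /
          (tailMass γ' Δ' x * tailMass γ Δ x ^ 2)) volume 0 1 :=
    ci _ (((cG'.sub cG).pow 2).div (cG'.mul (cG.pow 2))
      fun x hx => mul_ne_zero (pG' x hx) (pow_ne_zero 2 (pG x hx)))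
  have i4 : IntervalIntegrable (fun x => (tailMass γ Δ x ^ 2)⁻¹ *
      (tailMass γ' Δ' x - tailMass γ Δ x)) volume 0 1 :=
    ci _ (h.continuousOn_inv_sq.mul (cG'.sub cG))
  -- The Taylor formula of 1/Γ with its exact remainder. The two parts are kept apart because only
  -- the linear one is integrated by parts.
  have e1 : (∫ x in (0 : ℝ)..1, (tailMass γ' Δ' x)⁻¹) - ∫ x in (0 : ℝ)..1, (tailMass γ Δ x)⁻¹ =
      (∫ x in (0 : ℝ)..1, (tailMass γ' Δ' x - tailMass γ Δ x) ^ 2 /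
          (tailMass γ' Δ' x * tailMass γ Δ x ^ 2)) -
      ∫ x in (0 : ℝ)..1, (tailMass γ Δ x ^ 2)⁻¹ * (tailMass γ' Δ' x - tailMass γ Δ x) := by
    rw [← intervalIntegral.integral_sub i1 i2, ← intervalIntegral.integral_sub i3 i4]
    refine intervalIntegral.integral_congr fun x hx => ?_
    rw [Set.uIcc_of_le zero_le_one] at hx
    have a := pG x hx
    have b := pG' x hx
    field_simp
    ring
  have e2 : ∫ x in (0 : ℝ)..1, (tailMass γ Δ x ^ 2)⁻¹ * (tailMass γ' Δ' x - tailMass γ Δ x) =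
      (∫ x in (0 : ℝ)..1, (tailMass γ Δ x ^ 2)⁻¹) * (Δ' - Δ) +
      ∫ x in (0 : ℝ)..1, (∫ t in (0 : ℝ)..x, (tailMass γ Δ t ^ 2)⁻¹) * (γ' x - γ x) := by
    rw [← integral_mul_primitive hk hd, ← intervalIntegral.integral_mul_const,
      ← intervalIntegral.integral_add]
    · refine intervalIntegral.integral_congr fun x hx => ?_
      rw [Set.uIcc_of_le zero_le_one] at hx
      rw [intervalIntegral.integral_sub (h'.integrable_sub hx (by simp))
        (h.integrable_sub hx (by simp)), tailMass, tailMass]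
      ring
    · exact hk.mul_const _
    · refine ci _ (h.continuousOn_inv_sq.mul ?_)
      have := intervalIntegral.continuousOn_primitive_interval_left (a := 0) (b := 1)
        (f := fun x => γ' x - γ x) (μ := volume) (by
          rw [Set.uIcc_of_le zero_le_one]
          exact (intervalIntegrable_iff_integrableOn_Icc_of_le zero_le_one).1 hd)
      rwa [Set.uIcc_of_le zero_le_one] at this
  have e3 : (∫ x in (0 : ℝ)..1, variation ξ γ Δ x * (γ' x - γ x)) =
      (∫ x in (0 : ℝ)..1, deriv ξ x * γ' x) - (∫ x in (0 : ℝ)..1, deriv ξ x * γ x) -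
      ∫ x in (0 : ℝ)..1, (∫ t in (0 : ℝ)..x, (tailMass γ Δ t ^ 2)⁻¹) * (γ' x - γ x) := by
    rw [← intervalIntegral.integral_sub
      (h'.integrable.continuousOn_mul hξ.continuous_deriv.continuousOn)
      (h.integrable.continuousOn_mul hξ.continuous_deriv.continuousOn),
      ← intervalIntegral.integral_sub]
    · refine intervalIntegral.integral_congr fun x _ => ?_
      simp only [variation]
      ring
    · exact (h'.integrable.continuousOn_mul hξ.continuous_deriv.continuousOn).sub
        (h.integrable.continuousOn_mul hξ.continuous_deriv.continuousOn)
    · exact hd.continuousOn_mul c0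
  rw [energy, energy, e3, variation]
  linarith

end SphericalSpin

namespace SphericalSpin

/-! ### Layer cake comparison for monotone densities -/

/-- By the layer-cake formula each integral is ∫_0^∞ μ(φ > τ) dτ, so the comparison of superlevel
sets can be integrated over τ; the levels between τ₁ and τ₂ contribute the surplus. -/
theorem lintegral_ofReal_add_le_of_meas_lt {μ₁ μ₂ : Measure ℝ} {φ : ℝ → ℝ}
    (h1 : 0 ≤ᵐ[μ₁] φ) (h2 : 0 ≤ᵐ[μ₂] φ) (m1 : AEMeasurable φ μ₁) (m2 : AEMeasurable φ μ₂)
    {τ₁ τ₂ : ℝ} (hτ : 0 ≤ τ₁) (c : ENNReal)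
    (h : ∀ τ, 0 < τ → μ₂ {x | τ < φ x} + (Set.Ioo τ₁ τ₂).indicator (fun _ => c) τ
      ≤ μ₁ {x | τ < φ x}) :
    (∫⁻ x, ENNReal.ofReal (φ x) ∂μ₂) + c * ENNReal.ofReal (τ₂ - τ₁) ≤
      ∫⁻ x, ENNReal.ofReal (φ x) ∂μ₁ := by
  rw [lintegral_eq_lintegral_meas_lt μ₁ h1 m1, lintegral_eq_lintegral_meas_lt μ₂ h2 m2]
  have : c * ENNReal.ofReal (τ₂ - τ₁) =
      ∫⁻ τ in Set.Ioi (0 : ℝ), (Set.Ioo τ₁ τ₂).indicator (fun _ => c) τ := by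
    rw [lintegral_indicator measurableSet_Ioo, lintegral_const,
      Measure.restrict_restrict measurableSet_Ioo, Measure.restrict_apply_univ,
      Set.inter_eq_left.2 (show Set.Ioo τ₁ τ₂ ⊆ Set.Ioi 0 from fun x hx => hτ.trans_lt hx.1),
      Real.volume_Ioo]
  rw [this, ← lintegral_add_right _ (measurable_const.indicator measurableSet_Ioo)]
  exact setLIntegral_mono_ae' measurableSet_Ioi (Filter.Eventually.of_forall fun τ hτ => h τ hτ)

/-- An upper subset of `(0,1)` is up to null sets an interval `(u, 1)`. -/
theorem exists_inter_Ioo_ae_eq {S : Set ℝ}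
    (hS : ∀ x ∈ S ∩ Set.Ioo 0 1, ∀ y ∈ Set.Ioo (0 : ℝ) 1, x ≤ y → y ∈ S) :
    ∃ u ∈ Set.Icc (0 : ℝ) 1, ((S ∩ Set.Ioo 0 1 : Set ℝ) =ᵐ[volume] Set.Ioo u 1) ∧
      (∀ x ∈ Set.Ioo (0 : ℝ) 1, x ∈ S → u ≤ x) ∧
      (∀ x ∈ Set.Ioo (0 : ℝ) 1, x ∉ S → x ≤ u) := by
  rcases (S ∩ Set.Ioo 0 1).eq_empty_or_nonempty with he | hne
  · refine ⟨1, by simp, by simp [he], fun x hx hxS => ?_, fun x hx _ => hx.2.le⟩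
    have : x ∈ S ∩ Set.Ioo 0 1 := ⟨hxS, hx⟩
    rw [he] at this
    exact this.elim
  set u := sInf (S ∩ Set.Ioo 0 1)
  have hbdd : BddBelow (S ∩ Set.Ioo (0 : ℝ) 1) := ⟨0, fun x hx => hx.2.1.le⟩
  have hle : ∀ x ∈ S ∩ Set.Ioo 0 1, u ≤ x := fun x hx => csInf_le hbdd hx
  have hu0 : 0 ≤ u := le_csInf hne fun x hx => hx.2.1.le
  have hgt : ∀ x ∈ Set.Ioo u 1, x ∈ S := by
    intro x hx
    obtain ⟨y, hy, hyx⟩ := exists_lt_of_csInf_lt hne hx.1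
    exact hS y hy x ⟨hu0.trans_lt hx.1, hx.2⟩ hyx.le
  refine ⟨u, ⟨hu0, ?_⟩, ?_, fun x hx hxS => hle x ⟨hxS, hx⟩, fun x hx hxS => ?_⟩
  · obtain ⟨x, hx⟩ := hne
    exact (hle x hx).trans hx.2.2.le
  · have h1 : Set.Ioo u 1 ⊆ S ∩ Set.Ioo 0 1 := fun x hx => ⟨hgt x hx, hu0.trans_lt hx.1, hx.2⟩
    have h2 : S ∩ Set.Ioo 0 1 ⊆ Set.Ico u 1 := fun x hx => ⟨hle x hx, hx.2.2⟩
    exact Filter.EventuallyLE.antisymm (h2.eventuallyLE.trans Ioo_ae_eq_Ico.symm.le)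
      h1.eventuallyLE
  · by_contra! hlt
    exact hxS (hgt x ⟨hlt, hx.2⟩)

/-- If all the tails `∫_u^1 ψ` are nonnegative, and are at least `c` for the `u` in `[α, β]`, then
`∫ ψ φ` is at least `c` times the increase of the nonnegative monotone `φ` over `[α, β]`. -/
theorem integral_mul_monotone_ge {ψ φ : ℝ → ℝ} (hψ : ContinuousOn ψ (Set.Icc 0 1))
    (hφ0 : ∀ x ∈ Set.Ioo (0 : ℝ) 1, 0 ≤ φ x) (hφ : MonotoneOn φ (Set.Ioo 0 1))
    (hφi : IntervalIntegrable φ volume 0 1)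
    (htail : ∀ u ∈ Set.Icc (0 : ℝ) 1, 0 ≤ ∫ x in u..1, ψ x)
    {α β τ₁ τ₂ c : ℝ} (hc : 0 ≤ c) (hτ₁ : 0 ≤ τ₁) (hτ : τ₁ ≤ τ₂)
    (h1 : ∀ x ∈ Set.Ioo 0 1, x < α → φ x ≤ τ₁) (h2 : ∀ x ∈ Set.Ioo 0 1, β ≤ x → τ₂ ≤ φ x)
    (hα : 0 ≤ α) (hαβ : α ≤ β) (hβ : β < 1) (htail' : ∀ u ∈ Set.Icc α β, c ≤ ∫ x in u..1, ψ x) :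
    c * (τ₂ - τ₁) ≤ ∫ x in (0 : ℝ)..1, ψ x * φ x := by
  -- ψ may change sign. With a bound M of |ψ|, both ψ + M and M are densities of positive measures,
  -- and on a superlevel set of φ, which is an interval (u,1) up to null sets, their masses differ
  -- by the tail ∫_u^1 ψ.
  obtain ⟨M, hM⟩ := isCompact_Icc.exists_bound_of_continuousOn hψ
  have hψi : ∀ {x y : ℝ}, x ∈ Set.Icc (0 : ℝ) 1 → y ∈ Set.Icc (0 : ℝ) 1 →
      IntervalIntegrable ψ volume x y := fun hx hy =>
    (hψ.mono (Set.uIcc_subset_Icc hx hy)).intervalIntegrable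
  have hM0 : 0 ≤ M := (norm_nonneg _).trans (hM 0 (by simp))
  set ρ := volume.restrict (Set.Ioo (0 : ℝ) 1) with hρ
  have hψm : AEMeasurable ψ ρ :=
    ((hψ.mono Set.Ioo_subset_Icc_self).aestronglyMeasurable measurableSet_Ioo).aemeasurable
  have hφm : AEMeasurable φ ρ := aemeasurable_restrict_of_monotoneOn measurableSet_Ioo hφ
  have hwm : AEMeasurable (fun x => ENNReal.ofReal (ψ x + M)) ρ :=
    (hψm.add_const M).ennreal_ofReal
  set μ₁ := ρ.withDensity fun x => ENNReal.ofReal (ψ x + M) with hμ₁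
  set μ₂ := ρ.withDensity fun _ => ENNReal.ofReal M with hμ₂
  have nn : ∀ᵐ x ∂ρ, 0 ≤ φ x :=
    (ae_restrict_iff' measurableSet_Ioo).2 (Filter.Eventually.of_forall hφ0)
  have nM : ∀ x ∈ Set.Icc (0 : ℝ) 1, 0 ≤ ψ x + M := fun x hx => by
    have := (abs_le.1 (hM x hx)).1
    linarith
  have nnM : ∀ᵐ x ∂ρ, 0 ≤ ψ x + M :=
    (ae_restrict_iff' measurableSet_Ioo).2 (Filter.Eventually.of_forall fun x hx =>
      nM x (Set.Ioo_subset_Icc_self hx))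
  have ac1 : μ₁ ≪ ρ := withDensity_absolutelyContinuous _ _
  have ac2 : μ₂ ≪ ρ := withDensity_absolutelyContinuous _ _
  have key := lintegral_ofReal_add_le_of_meas_lt (μ₁ := μ₁) (μ₂ := μ₂) (φ := φ)
    (ac1.ae_le nn) (ac2.ae_le nn) (hφm.mono_ac ac1) (hφm.mono_ac ac2) (τ₂ := τ₂) hτ₁
    (ENNReal.ofReal c) (by
    intro τ hτ0
    obtain ⟨u, hu, hae, hu1, hu2⟩ := exists_inter_Ioo_ae_eq (S := {x | τ < φ x}) (by
      intro x hx y hy hxy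
      exact lt_of_lt_of_le hx.1 (hφ hx.2 hy hxy))
    have hm : ∀ w : ℝ → ENNReal, (ρ.withDensity w) {x | τ < φ x} = ∫⁻ x in Set.Ioo u 1, w x := by
      intro w
      have hnull : NullMeasurableSet {x | τ < φ x} ρ := nullMeasurableSet_lt aemeasurable_const hφm
      rw [withDensity_apply₀ _ hnull, hρ, Measure.restrict_restrict₀ hnull]
      exact congrArg (fun m => ∫⁻ x, w x ∂m) (Measure.restrict_congr_set hae)
    have hI1 : ∫⁻ x in Set.Ioo u 1, ENNReal.ofReal (ψ x + M) =
        ENNReal.ofReal ((∫ x in u..1, ψ x) + (1 - u) * M) := by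
      rw [← ofReal_integral_eq_lintegral_ofReal, ← integral_Ioc_eq_integral_Ioo,
        ← intervalIntegral.integral_of_le hu.2, intervalIntegral.integral_add (hψi hu (by simp))
        intervalIntegrable_const, intervalIntegral.integral_const, smul_eq_mul]
      · exact ((intervalIntegrable_iff_integrableOn_Ioo_of_le hu.2).1
          ((hψi hu (by simp)).add intervalIntegrable_const))
      · exact (ae_restrict_iff' measurableSet_Ioo).2 (Filter.Eventually.of_forall fun x hx =>
          nM x ⟨hu.1.trans hx.1.le, hx.2.le⟩)
    have hI2 : ∫⁻ x in Set.Ioo u 1, ENNReal.ofReal M = ENNReal.ofReal ((1 - u) * M) := by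
      rw [setLIntegral_const, Real.volume_Ioo, mul_comm,
        ← ENNReal.ofReal_mul (by linarith [hu.2])]
    rw [hμ₁, hμ₂, hm, hm, hI1, hI2]
    have hnn : 0 ≤ (1 - u) * M := mul_nonneg (by linarith [hu.2]) hM0
    by_cases hmem : τ ∈ Set.Ioo τ₁ τ₂
    · rw [Set.indicator_of_mem hmem, ← ENNReal.ofReal_add hnn hc]
      refine ENNReal.ofReal_le_ofReal ?_
      -- A level strictly between τ₁ and τ₂ is crossed inside [α, β], where the tail is at least c.
      have huα : α ≤ u := by
        by_contra! hlt
        have hα1 : α ≤ 1 := by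
          by_contra! h'
          obtain ⟨x, hx1, hx2⟩ := exists_between (max_lt hβ one_pos)
          have hx : x ∈ Set.Ioo (0 : ℝ) 1 := ⟨(le_max_right _ _).trans_lt hx1, hx2⟩
          have a := h1 x hx (hx2.trans h')
          have b := h2 x hx ((le_max_left _ _).trans hx1.le)
          linarith [hmem.1, hmem.2]
        obtain ⟨x, hx1, hx2⟩ := exists_between hlt
        have hx : x ∈ Set.Ioo (0 : ℝ) 1 := ⟨hu.1.trans_lt hx1, hx2.trans_le hα1⟩
        have a := h1 x hx hx2
        have b := hu2 x hx (by simpa using a.trans hmem.1.le)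
        linarith
      have huβ : u ≤ β := by
        by_contra! hlt
        have hu0 : 0 < u := (hα.trans hαβ).trans_lt hlt
        obtain ⟨x, hx1, hx2⟩ := exists_between (max_lt hlt hu0)
        have hx : x ∈ Set.Ioo (0 : ℝ) 1 :=
          ⟨(le_max_right _ _).trans_lt hx1, hx2.trans_le hu.2⟩
        have a := h2 x hx ((le_max_left _ _).trans hx1.le)
        have b := hu1 x hx (show τ < φ x from hmem.2.trans_le a)
        linarith
      have := htail' u ⟨huα, huβ⟩
      linarith
    · rw [Set.indicator_of_notMem hmem, add_zero]
      refine ENNReal.ofReal_le_ofReal ?_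
      have := htail u hu
      linarith)
  have conv : ∀ w : ℝ → ℝ, AEMeasurable (fun x => ENNReal.ofReal (w x)) ρ →
      (∀ᵐ x ∂ρ, 0 ≤ w x) → IntervalIntegrable (fun x => w x * φ x) volume 0 1 →
      ∫⁻ x, ENNReal.ofReal (φ x) ∂(ρ.withDensity fun x => ENNReal.ofReal (w x)) =
        ENNReal.ofReal (∫ x in (0 : ℝ)..1, w x * φ x) := by
    intro w hw hw0 hwi
    rw [lintegral_withDensity_eq_lintegral_mul₀ hw hφm.ennreal_ofReal,
      intervalIntegral.integral_of_le zero_le_one, integral_Ioc_eq_integral_Ioo,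
      ofReal_integral_eq_lintegral_ofReal]
    · refine lintegral_congr_ae ?_
      filter_upwards [hw0] with x hx
      rw [ENNReal.ofReal_mul hx]; rfl
    · exact (intervalIntegrable_iff_integrableOn_Ioo_of_le zero_le_one).1 hwi
    · filter_upwards [hw0, nn] with x hx hx' using mul_nonneg hx hx'
  have iψφ : IntervalIntegrable (fun x => ψ x * φ x) volume 0 1 :=
    hφi.continuousOn_mul (by rwa [Set.uIcc_of_le zero_le_one])
  have iM : IntervalIntegrable (fun x => M * φ x) volume 0 1 := hφi.const_mul M
  have i1 : IntervalIntegrable (fun x => (ψ x + M) * φ x) volume 0 1 := by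
    simpa only [add_mul] using iψφ.add iM
  rw [hμ₁, hμ₂, conv _ hwm nnM i1, conv (fun _ => M) aemeasurable_const (by simp [hM0]) iM,
    ← ENNReal.ofReal_mul hc, ← ENNReal.ofReal_add, ENNReal.ofReal_le_ofReal_iff] at key
  · have : ∫ x in (0 : ℝ)..1, (ψ x + M) * φ x =
        (∫ x in (0 : ℝ)..1, ψ x * φ x) + ∫ x in (0 : ℝ)..1, M * φ x := by
      rw [← intervalIntegral.integral_add iψφ iM]
      exact intervalIntegral.integral_congr fun x _ => add_mul _ _ _
    linarith
  · rw [intervalIntegral.integral_of_le zero_le_one, integral_Ioc_eq_integral_Ioo]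
    refine integral_nonneg_of_ae ?_
    filter_upwards [nnM, nn] with x hx hx' using mul_nonneg hx hx'
  · rw [intervalIntegral.integral_of_le zero_le_one, integral_Ioc_eq_integral_Ioo]
    refine integral_nonneg_of_ae ?_
    filter_upwards [nn] with x hx' using mul_nonneg hM0 hx'
  · exact mul_nonneg hc (by linarith)

end SphericalSpin

namespace SphericalSpin

/-! ### Characterization of the minimizer -/

variable {ξ γ δ : ℝ → ℝ} {Δ d : ℝ}

/-- The optimality conditions for the Crisanti–Sommers functional. -/
structure Stationary (ξ γ : ℝ → ℝ) (Δ : ℝ) : Prop where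
  variation_one : variation ξ γ Δ 1 = 0
  tail_nonneg : ∀ u ∈ Set.Icc (0 : ℝ) 1, 0 ≤ ∫ x in u..1, variation ξ γ Δ x
  slack : ∫ x in (0 : ℝ)..1, variation ξ γ Δ x * γ x = 0

theorem tailMass_perturb (hγ : IntervalIntegrable γ volume 0 1)
    (hδ : IntervalIntegrable δ volume 0 1) (ε : ℝ) {x : ℝ} (hx : x ∈ Set.Icc (0 : ℝ) 1) :
    tailMass (fun y => γ y + ε * δ y) (Δ + ε * d) x = tailMass γ Δ x + ε * tailMass δ d x := by
  have hsub : Set.uIcc x 1 ⊆ Set.uIcc 0 1 := by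
    rw [Set.uIcc_of_le hx.2, Set.uIcc_of_le zero_le_one]
    exact Set.Icc_subset_Icc_left hx.1
  rw [tailMass, tailMass, tailMass, intervalIntegral.integral_add (hγ.mono_set hsub)
    ((hδ.mono_set hsub).const_mul ε), intervalIntegral.integral_const_mul]
  ring

/-- First order condition along an admissible direction. -/
theorem IsParisiMeasure.first_variation_nonneg (hξ : IsCubicLike ξ) (h : Admissible γ Δ)
    (hν : IsParisiMeasure ξ (densityMeasure γ Δ)) (hδ : IntervalIntegrable δ volume 0 1)
    (hadm : ∀ ε : ℝ, 0 < ε → ε ≤ 1 / 2 → Admissible (fun y => γ y + ε * δ y) (Δ + ε * d)) :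
    0 ≤ (∫ x in (0 : ℝ)..1, variation ξ γ Δ x * δ x) + variation ξ γ Δ 1 * d := by
  set L := (∫ x in (0 : ℝ)..1, variation ξ γ Δ x * δ x) + variation ξ γ Δ 1 * d with hL
  -- κ bounds the atom, hence the tail mass, of every perturbation with ε ≤ 1/2 from below, so that
  -- the quadratic remainder is at most ε²C with C independent of ε.
  set κ := min Δ (Δ + 1 / 2 * d) with hκ
  have hκ0 : 0 < κ := lt_min h.atom_pos (hadm (1 / 2) (by norm_num) le_rfl).atom_pos
  set C := ∫ x in (0 : ℝ)..1, tailMass δ d x ^ 2 / (κ * tailMass γ Δ x ^ 2) with hC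
  have cδ : ContinuousOn (tailMass δ d) (Set.Icc 0 1) := by
    have := intervalIntegral.continuousOn_primitive_interval_left (a := 0) (b := 1) (f := δ)
      (μ := volume) (by
        have := (intervalIntegrable_iff_integrableOn_Icc_of_le zero_le_one).1 hδ
        rwa [Set.uIcc_of_le zero_le_one])
    rw [Set.uIcc_of_le zero_le_one] at this
    exact continuousOn_const.add this
  have ci : ∀ f : ℝ → ℝ, ContinuousOn f (Set.Icc 0 1) → IntervalIntegrable f volume 0 1 := by
    intro f hf
    refine ContinuousOn.intervalIntegrable ?_
    rwa [Set.uIcc_of_le zero_le_one]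
  have key : ∀ ε : ℝ, 0 < ε → ε ≤ 1 / 2 → 0 ≤ L + ε * C := by
    intro ε hε hε'
    have h' := hadm ε hε hε'
    have e := energy_sub hξ h h'
    have hle := hν.energy_le hξ h h'
    have e1 : ∫ x in (0 : ℝ)..1, variation ξ γ Δ x * (γ x + ε * δ x - γ x) =
        ε * ∫ x in (0 : ℝ)..1, variation ξ γ Δ x * δ x := by
      rw [← intervalIntegral.integral_const_mul]
      exact intervalIntegral.integral_congr fun x _ => by ring
    have e2 : ∫ x in (0 : ℝ)..1,
        (tailMass (fun y => γ y + ε * δ y) (Δ + ε * d) x - tailMass γ Δ x) ^ 2 /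
          (tailMass (fun y => γ y + ε * δ y) (Δ + ε * d) x * tailMass γ Δ x ^ 2) ≤ ε ^ 2 * C := by
      rw [hC, ← intervalIntegral.integral_const_mul]
      refine intervalIntegral.integral_mono_on zero_le_one ?_ ?_ fun x hx => ?_
      · exact ci _ (((h'.continuousOn_tailMass.sub h.continuousOn_tailMass).pow 2).div
          (h'.continuousOn_tailMass.mul (h.continuousOn_tailMass.pow 2)) fun x hx =>
          mul_ne_zero (h'.tailMass_pos hx).ne' (pow_ne_zero 2 (h.tailMass_pos hx).ne'))
      · exact ci _ (continuousOn_const.mul ((cδ.pow 2).div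
          (continuousOn_const.mul (h.continuousOn_tailMass.pow 2)) fun x hx =>
          mul_ne_zero hκ0.ne' (pow_ne_zero 2 (h.tailMass_pos hx).ne')))
      · have hΓ := h.tailMass_pos hx
        have hκ' : κ ≤ tailMass (fun y => γ y + ε * δ y) (Δ + ε * d) x := by
          refine le_trans ?_ (h'.atom_le hx)
          rcases le_total 0 d with hd | hd
          · exact (min_le_left _ _).trans (by nlinarith)
          · exact (min_le_right _ _).trans (by nlinarith)
        have hnum : tailMass (fun y => γ y + ε * δ y) (Δ + ε * d) x - tailMass γ Δ x =
            ε * tailMass δ d x := by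
          rw [tailMass_perturb h.integrable hδ ε hx]; ring
        rw [hnum, mul_pow, mul_div_assoc]
        refine mul_le_mul_of_nonneg_left ?_ (sq_nonneg ε)
        exact div_le_div_of_nonneg_left (sq_nonneg _) (by positivity)
          (mul_le_mul_of_nonneg_right hκ' (sq_nonneg _))
    rw [e1] at e
    have : 0 ≤ ε * (L + ε * C) := by
      rw [hL]
      nlinarith
    exact nonneg_of_mul_nonneg_right this hε
  by_contra! hneg
  have hC0 : 0 < C := by
    have := key (1 / 2) (by norm_num) le_rfl
    linarith
  -- If L < 0, this ε satisfies εC ≤ −L/2, so that L + εC would be negative.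
  have hε := key (min (1 / 2) (-L / (2 * C))) (lt_min (by norm_num) (by
    apply div_pos <;> linarith)) (min_le_left _ _)
  have : min (1 / 2) (-L / (2 * C)) * C ≤ -L / 2 := by
    calc min (1 / 2) (-L / (2 * C)) * C ≤ -L / (2 * C) * C :=
          mul_le_mul_of_nonneg_right (min_le_right _ _) hC0.le
      _ = -L / 2 := by field_simp
  linarith

theorem Admissible.scale (h : Admissible γ Δ) {c : ℝ} (hc : 0 ≤ c) :
    Admissible (fun y => c * γ y) Δ :=
  ⟨fun x hx => mul_nonneg hc (h.nonneg x hx),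
    fun _ hx _ hy hxy => mul_le_mul_of_nonneg_left (h.mono hx hy hxy) hc,
    fun x hx => continuousWithinAt_const.mul (h.right x hx), h.atom_pos, h.integrable.const_mul c⟩

theorem Admissible.add_step (h : Admissible γ Δ) {c u : ℝ} (hc : 0 ≤ c) :
    Admissible (fun y => γ y + c * (Set.Ici u).indicator (fun _ => (1 : ℝ)) y) Δ := by
  have hi0 : ∀ y, 0 ≤ (Set.Ici u).indicator (fun _ => (1 : ℝ)) y :=
    fun y => Set.indicator_nonneg (fun _ _ => zero_le_one) y
  have hmono : Monotone ((Set.Ici u).indicator (fun _ => (1 : ℝ))) := by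
    intro x y hxy
    by_cases hx : x ∈ Set.Ici u
    · rw [Set.indicator_of_mem hx, Set.indicator_of_mem (Set.mem_Ici.2 (le_trans hx hxy))]
    · rw [Set.indicator_of_notMem hx]
      exact hi0 y
  refine ⟨fun x hx => add_nonneg (h.nonneg x hx) (mul_nonneg hc (hi0 x)),
    fun x hx y hy hxy => add_le_add (h.mono hx hy hxy)
      (mul_le_mul_of_nonneg_left (hmono hxy) hc),
    fun x hx => (h.right x hx).add (continuousWithinAt_const.mul ?_), h.atom_pos,
    h.integrable.add ((hmono.intervalIntegrable).const_mul c)⟩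
  rcases lt_or_ge x u with hxu | hxu
  · refine ContinuousAt.continuousWithinAt ?_
    refine (continuousAt_const (y := (0 : ℝ))).congr ?_
    filter_upwards [Iio_mem_nhds hxu] with y hy
    rw [Set.indicator_of_notMem (by simpa using hy)]
  · refine (continuousWithinAt_const (b := (1 : ℝ))).congr (fun y hy => ?_) ?_
    · rw [Set.indicator_of_mem (Set.mem_Ici.2 (hxu.trans hy))]
    · rw [Set.indicator_of_mem (Set.mem_Ici.2 hxu)]

/-- A few directions suffice: changing the atom both ways gives the value at 1, adding a step that
starts at u gives the sign of the tail from u, and scaling γ up and down gives the slackness. -/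
theorem IsParisiMeasure.stationary (hξ : IsCubicLike ξ) (h : Admissible γ Δ)
    (hν : IsParisiMeasure ξ (densityMeasure γ Δ)) : Stationary ξ γ Δ := by
  have hatom : ∀ d : ℝ, 0 < Δ + 1 / 2 * d → 0 ≤ variation ξ γ Δ 1 * d := by
    intro d hd
    have := hν.first_variation_nonneg hξ h (δ := fun _ => 0) (d := d)
      intervalIntegrable_const (by
        intro ε hε hε'
        have : (fun y => γ y + ε * (fun _ : ℝ => (0 : ℝ)) y) = γ := by ext y; simp
        rw [this]
        refine ⟨h.nonneg, h.mono, h.right, ?_, h.integrable⟩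
        have := h.atom_pos
        rcases le_total 0 d with hd' | hd' <;> nlinarith)
    simpa using this
  have hv1 : variation ξ γ Δ 1 = 0 := by
    have hΔ := h.atom_pos
    have a := hatom Δ (by linarith)
    have b := hatom (-Δ) (by linarith)
    nlinarith
  refine ⟨hv1, fun u hu => ?_, le_antisymm ?_ ?_⟩
  · have := hν.first_variation_nonneg hξ h (δ := (Set.Ici u).indicator fun _ => 1) (d := 0)
      (by
        have := (admissible_zero_one.add_step (c := 1) (u := u) zero_le_one).integrable
        simpa using this) (fun ε hε _ => by
        rw [mul_zero, add_zero]
        exact h.add_step hε.le)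
    rw [mul_zero, add_zero] at this
    have e : ∫ x in (0 : ℝ)..1, variation ξ γ Δ x * (Set.Ici u).indicator (fun _ => (1 : ℝ)) x =
        ∫ x in u..1, variation ξ γ Δ x := by
      have e1 : (fun x => variation ξ γ Δ x * (Set.Ici u).indicator (fun _ => (1 : ℝ)) x) =
          (Set.Ici u).indicator (variation ξ γ Δ) := by
        ext x
        by_cases hx : x ∈ Set.Ici u <;> simp [hx, Set.indicator]
      rw [e1, intervalIntegral.integral_of_le zero_le_one, intervalIntegral.integral_of_le hu.2,
        setIntegral_indicator measurableSet_Ici]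
      have hset : (Set.Ioc 0 1 ∩ Set.Ici u : Set ℝ) =ᵐ[volume] Set.Ioc u 1 := by
        have h1 : Set.Ioc u 1 ⊆ Set.Ioc 0 1 ∩ Set.Ici u :=
          fun x hx => ⟨⟨hu.1.trans_lt hx.1, hx.2⟩, hx.1.le⟩
        have h2 : (Set.Ioc 0 1 ∩ Set.Ici u : Set ℝ) ⊆ Set.Icc u 1 := fun x hx => ⟨hx.2, hx.1.2⟩
        exact Filter.EventuallyLE.antisymm (h2.eventuallyLE.trans Ioc_ae_eq_Icc.symm.le)
          h1.eventuallyLE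
      rw [Measure.restrict_congr_set hset]
    rwa [e] at this
  · have := hν.first_variation_nonneg hξ h (δ := fun y => -γ y) (d := 0) h.integrable.neg
      (fun ε hε hε' => by
        have : (fun y => γ y + ε * (fun y => -γ y) y) = fun y => (1 - ε) * γ y := by
          ext y; ring
        rw [this, mul_zero, add_zero]
        exact h.scale (by linarith))
    simp only [mul_neg, intervalIntegral.integral_neg, mul_zero, add_zero] at this
    linarith
  · have := hν.first_variation_nonneg hξ h (δ := γ) (d := 0) h.integrable
      (fun ε hε hε' => by
        have : (fun y => γ y + ε * γ y) = fun y => (1 + ε) * γ y := by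
          ext y; ring
        rw [this, mul_zero, add_zero]
        exact h.scale (by linarith))
    simpa using this

namespace Stationary

/-- A stationary measure is the unique minimizer. -/
theorem eq_of_isParisiMeasure (hξ : IsCubicLike ξ) (h : Admissible γ Δ)
    (hs : Stationary ξ γ Δ) {ν : Measure ℝ} (hν : IsParisiMeasure ξ ν) :
    ν = densityMeasure γ Δ := by
  obtain ⟨γ', Δ', h', rfl⟩ := hν.exists_admissible hξ
  have hle := hν.energy_le hξ h' h
  have e := energy_sub hξ h h'
  have cv : ContinuousOn (variation ξ γ Δ) (Set.uIcc 0 1) := by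
    rw [Set.uIcc_of_le zero_le_one]
    exact h.continuousOn_variation hξ
  have hL : 0 ≤ ∫ x in (0 : ℝ)..1, variation ξ γ Δ x * (γ' x - γ x) := by
    -- With c = 0 and trivial levels, this is just the nonnegativity of the pairing of the variation
    -- with γ'.
    have hge := integral_mul_monotone_ge (h.continuousOn_variation hξ)
      (fun x hx => h'.nonneg x (Set.Ioo_subset_Ico_self hx)) (h'.mono.mono Set.Ioo_subset_Ico_self)
      h'.integrable hs.tail_nonneg (α := 0) (β := 0) (τ₁ := 0) (τ₂ := 0) (c := 0) le_rfl le_rfl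
      le_rfl (fun x hx hx0 => absurd hx.1 hx0.not_gt)
      (fun x hx _ => h'.nonneg x (Set.Ioo_subset_Ico_self hx)) le_rfl le_rfl one_pos
      (fun u hu => hs.tail_nonneg u ⟨hu.1, hu.2.trans zero_le_one⟩)
    have e1 : ∫ x in (0 : ℝ)..1, variation ξ γ Δ x * (γ' x - γ x) =
        (∫ x in (0 : ℝ)..1, variation ξ γ Δ x * γ' x) -
          ∫ x in (0 : ℝ)..1, variation ξ γ Δ x * γ x := by
      rw [← intervalIntegral.integral_sub (h'.integrable.continuousOn_mul cv)
        (h.integrable.continuousOn_mul cv)]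
      exact intervalIntegral.integral_congr fun x _ => mul_sub _ _ _
    rw [e1, hs.slack]
    linarith
  rw [hs.variation_one, zero_mul, add_zero] at e
  have cR : ContinuousOn (fun x => (tailMass γ' Δ' x - tailMass γ Δ x) ^ 2 /
      (tailMass γ' Δ' x * tailMass γ Δ x ^ 2)) (Set.Icc 0 1) :=
    ((h'.continuousOn_tailMass.sub h.continuousOn_tailMass).pow 2).div
      (h'.continuousOn_tailMass.mul (h.continuousOn_tailMass.pow 2)) fun x hx =>
      mul_ne_zero (h'.tailMass_pos hx).ne' (pow_ne_zero 2 (h.tailMass_pos hx).ne')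
  have nR : ∀ x ∈ Set.Icc (0 : ℝ) 1, 0 ≤ (tailMass γ' Δ' x - tailMass γ Δ x) ^ 2 /
      (tailMass γ' Δ' x * tailMass γ Δ x ^ 2) := fun x hx =>
    div_nonneg (sq_nonneg _) (mul_nonneg (h'.tailMass_pos hx).le (sq_nonneg _))
  -- The linear term is nonnegative, so minimality leaves no room for a positive quadratic
  -- remainder.
  have heq : ∀ x ∈ Set.Icc (0 : ℝ) 1, tailMass γ' Δ' x = tailMass γ Δ x := by
    intro x hx
    by_contra hne
    have hpos := intervalIntegral.integral_pos zero_lt_one cR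
      (fun y hy => nR y (Set.Ioc_subset_Icc_self hy)) ⟨x, hx, by
        have a := h'.tailMass_pos hx
        have b := h.tailMass_pos hx
        have c : tailMass γ' Δ' x - tailMass γ Δ x ≠ 0 := sub_ne_zero.2 hne
        positivity⟩
    linarith
  have hΔ : Δ' = Δ := by
    have := heq 1 (by simp)
    simpa [tailMass] using this
  subst hΔ
  -- Both densities are, almost everywhere, the derivative of the same primitive.
  have hγ : ∀ᵐ x, x ∈ Set.uIcc (0 : ℝ) 1 → x ∈ Set.Ioo (0 : ℝ) 1 → γ' x = γ x := by
    filter_upwards [h.integrable.ae_hasDerivAt_integral, h'.integrable.ae_hasDerivAt_integral]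
      with x hx hx' hmem hmem'
    have d1 := hx hmem 1 (by simp)
    have d2 := hx' hmem 1 (by simp)
    refine d2.unique (d1.congr_of_eventuallyEq ?_)
    filter_upwards [Icc_mem_nhds hmem'.1 hmem'.2] with y hy
    have := heq y hy
    rw [tailMass, tailMass] at this
    rw [intervalIntegral.integral_symm, intervalIntegral.integral_symm y 1]
    linarith
  rw [densityMeasure, densityMeasure]
  congr 1
  refine withDensity_congr_ae ?_
  rw [Measure.restrict_congr_set (Ioo_ae_eq_Ico (μ := volume) (a := (0 : ℝ)) (b := 1)).symm]
  refine (ae_restrict_iff' measurableSet_Ioo).2 ?_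
  filter_upwards [hγ] with x hx hmem
  rw [hx (by rw [Set.uIcc_of_le zero_le_one]; exact Set.Ioo_subset_Icc_self hmem) hmem]

theorem continuousOn_tail (hξ : IsCubicLike ξ) (h : Admissible γ Δ) :
    ContinuousOn (fun u => ∫ x in u..1, variation ξ γ Δ x) (Set.Icc 0 1) := by
  have := intervalIntegral.continuousOn_primitive_interval_left (a := 0) (b := 1)
    (f := variation ξ γ Δ) (μ := volume) (by
      rw [Set.uIcc_of_le zero_le_one]
      exact (h.continuousOn_variation hξ).integrableOn_Icc)
  rwa [Set.uIcc_of_le zero_le_one] at this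

/-- The tail integral of the variation vanishes somewhere on each interval on which the density
increases. -/
theorem exists_tail_eq_zero (hξ : IsCubicLike ξ) (h : Admissible γ Δ) (hs : Stationary ξ γ Δ)
    {α β : ℝ} (hα : 0 ≤ α) (hαβ : α ≤ β) (hβ : β < 1) (hlt : γ α < γ β) :
    ∃ u ∈ Set.Icc α β, ∫ x in u..1, variation ξ γ Δ x = 0 := by
  by_contra! hne
  have hsub : Set.Icc α β ⊆ Set.Icc 0 1 := Set.Icc_subset_Icc hα hβ.le
  -- A positive minimum c of the tail over [α, β] would force ∫ gγ ≥ c(γ β − γ α) > 0, against the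
  -- slackness.
  obtain ⟨u, hu, hmin⟩ := isCompact_Icc.exists_isMinOn (Set.nonempty_Icc.2 hαβ)
    ((continuousOn_tail hξ h).mono hsub)
  have hc : 0 < ∫ x in u..1, variation ξ γ Δ x :=
    lt_of_le_of_ne (hs.tail_nonneg u (hsub hu)) (hne u hu).symm
  have hge := integral_mul_monotone_ge (h.continuousOn_variation hξ)
      (fun x hx => h.nonneg x (Set.Ioo_subset_Ico_self hx)) (h.mono.mono Set.Ioo_subset_Ico_self)
      h.integrable hs.tail_nonneg (α := α) (β := β) (τ₁ := γ α) (τ₂ := γ β) hc.le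
      (h.nonneg α ⟨hα, hαβ.trans_lt hβ⟩) hlt.le
      (fun x hx hxα => h.mono (Set.Ioo_subset_Ico_self hx) ⟨hα, hαβ.trans_lt hβ⟩ hxα.le)
      (fun x hx hxβ => h.mono ⟨hα.trans hαβ, hβ⟩ (Set.Ioo_subset_Ico_self hx) hxβ) hα hαβ hβ
      (fun w hw => hmin hw)
  rw [hs.slack] at hge
  have := mul_pos hc (sub_pos.2 hlt)
  linarith

/-- At 0 the density counts as jumping from 0 to `γ 0`, since nothing lies to the left; the
slackness then gives G(0)·γ(0) ≤ 0. -/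
theorem tail_zero_of_pos (hξ : IsCubicLike ξ) (h : Admissible γ Δ) (hs : Stationary ξ γ Δ)
    (hpos : 0 < γ 0) : ∫ x in (0 : ℝ)..1, variation ξ γ Δ x = 0 := by
  refine le_antisymm ?_ (hs.tail_nonneg 0 (by simp))
  have hge := integral_mul_monotone_ge (h.continuousOn_variation hξ)
      (fun x hx => h.nonneg x (Set.Ioo_subset_Ico_self hx)) (h.mono.mono Set.Ioo_subset_Ico_self)
      h.integrable hs.tail_nonneg (α := 0) (β := 0) (τ₁ := 0) (τ₂ := γ 0)
      (hs.tail_nonneg 0 (by simp)) le_rfl hpos.le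
      (fun x hx hx0 => absurd hx.1 hx0.not_gt)
      (fun x hx _ => h.mono (by simp) (Set.Ioo_subset_Ico_self hx) hx.1.le) le_rfl le_rfl one_pos
      (fun u hu => by rw [le_antisymm hu.2 hu.1])
  rw [hs.slack, sub_zero] at hge
  exact nonpos_of_mul_nonpos_left hge hpos

end Stationary

end SphericalSpin

namespace SphericalSpin

/-! ### A single step -/

/-- The affine function on `[a, b]` with the values `A` at `a` and `E` at `b`. -/
noncomputable def affineTail (a b A E x : ℝ) : ℝ := E + (A - E) / (b - a) * (b - x)

/-- The first variation on a step with an affine tail mass, normalized to vanish at `a`. -/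
noncomputable def stepVariation (ξ : ℝ → ℝ) (a b A E x : ℝ) : ℝ :=
  deriv ξ x - deriv ξ a - (x - a) / (A * affineTail a b A E x)

/-- The numbers `A > E` are the tail masses at the ends of a step on which the first variation
has mean zero derivative. -/
structure IsStep (ξ : ℝ → ℝ) (a b A E : ℝ) : Prop where
  nonneg : 0 ≤ a
  lt : a < b
  pos : 0 < E
  tail_lt : E < A
  mean : (deriv ξ b - deriv ξ a) * (A * E) = b - a

/-- For 0 < z < 1 the bracket in `h` is at most −1/2, and the strict trapezoid inequality makes `h`
negative. This is what turns solutions of the h-equations into decreasing tail masses. -/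
theorem one_lt_of_h_eq_zero {ξ : ℝ → ℝ} (hξ : IsCubicLike ξ) {a b z : ℝ} (ha : 0 ≤ a)
    (hab : a < b) (hz : 0 < z) (h0 : h ξ a b z = 0) : 1 < z := by
  by_contra! hz1
  have hT := hξ.trapezoid ha hab
  have hconv : 0 < ξ b - ξ a - deriv ξ a * (b - a) := by
    obtain ⟨c, hc, hc'⟩ := exists_deriv_eq_slope ξ hab hξ.continuous.continuousOn
      (fun y _ => (hξ.hasDerivAt y).differentiableAt.differentiableWithinAt)
    rw [eq_div_iff (by linarith)] at hc'
    have := hξ.deriv_lt ha hc.1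
    nlinarith
  rcases hz1.eq_or_lt with rfl | hz1
  -- At z = 1 the divisions by zero erase the bracket, and `h` is the convexity gap of ξ, which is
  -- positive.
  · simp only [h, sub_self, div_zero, zero_pow two_ne_zero, zero_mul, mul_zero, add_zero] at h0
    exact hconv.ne' h0
  · have hlog : (z - 1) ^ 2 / 2 ≤ z * Real.log z - z + 1 := by
      -- F is nonincreasing because log x ≤ x − 1, and F(1) = 0.
      let F : ℝ → ℝ := fun x => x * Real.log x - x + 1 - (x - 1) ^ 2 / 2
      have hF : ∀ x, 0 < x → HasDerivAt F (Real.log x - (x - 1)) x := by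
        intro x hx
        have e := ((((hasDerivAt_id x).mul (Real.hasDerivAt_log hx.ne')).sub
          (hasDerivAt_id x)).add_const 1).sub
          ((((hasDerivAt_id x).sub_const 1).pow 2).div_const 2)
        convert! e using 1
        simp [hx.ne']
      have hanti : AntitoneOn F (Set.Ioi 0) := by
        refine antitoneOn_of_deriv_nonpos (convex_Ioi 0)
          (fun x hx => (hF x hx).continuousAt.continuousWithinAt)
          (fun x hx => ?_) (fun x hx => ?_)
        · rw [interior_Ioi] at hx
          exact (hF x hx).differentiableAt.differentiableWithinAt
        · rw [interior_Ioi] at hx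
          rw [(hF x hx).deriv]
          have := Real.log_le_sub_one_of_pos hx
          linarith
      have := hanti hz (Set.mem_Ioi.2 one_pos) hz1.le
      simp only [F, Real.log_one] at this
      linarith
    have hne : z - 1 ≠ 0 := by linarith
    have hsq : 0 < (z - 1) ^ 2 := by positivity
    have e : 1 / (z - 1) - z / (z - 1) ^ 2 * Real.log z =
        -((z * Real.log z - z + 1) / (z - 1) ^ 2) := by
      field_simp; ring
    have hge : 1 / 2 ≤ (z * Real.log z - z + 1) / (z - 1) ^ 2 := by
      rw [le_div_iff₀ hsq]; linarith
    rw [h, e] at h0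
    have hd := hξ.deriv_lt ha hab
    have hpos : 0 < (deriv ξ b - deriv ξ a) * (b - a) := mul_pos (by linarith) (by linarith)
    nlinarith

/-- If the derivative of `V` is positive to the left of a zero `b`, then `∫ V < 0` there. -/
theorem integral_neg_of_deriv_pos_left {V V' : ℝ → ℝ} {c b : ℝ} (hcb : c < b)
    (hV : ContinuousOn V (Set.Icc c b)) (hV' : ∀ x ∈ Set.Ioo c b, HasDerivAt V (V' x) x)
    (hpos : ∀ x ∈ Set.Ioo c b, 0 < V' x) (hb : V b = 0) : ∫ x in c..b, V x < 0 := by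
  have hmono : StrictMonoOn V (Set.Icc c b) := by
    refine strictMonoOn_of_deriv_pos (convex_Icc c b) hV fun x hx => ?_
    rw [interior_Icc] at hx
    rw [(hV' x hx).deriv]
    exact hpos x hx
  have := intervalIntegral.intervalIntegral_pos_of_pos_on (f := fun x => -V x) (a := c) (b := b)
    (by
      refine ContinuousOn.intervalIntegrable ?_
      rw [Set.uIcc_of_le hcb.le]
      exact hV.neg) (fun x hx => by
      have := hmono (Set.Ioo_subset_Icc_self hx) (Set.right_mem_Icc.2 hcb.le) hx.2
      linarith) hcb
  rw [intervalIntegral.integral_neg] at this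
  linarith

/-- If the derivative of `V` is positive to the right of a zero `a`, then `∫ V > 0` there. -/
theorem integral_pos_of_deriv_pos_right {V V' : ℝ → ℝ} {a c : ℝ} (hac : a < c)
    (hV : ContinuousOn V (Set.Icc a c)) (hV' : ∀ x ∈ Set.Ioo a c, HasDerivAt V (V' x) x)
    (hpos : ∀ x ∈ Set.Ioo a c, 0 < V' x) (ha : V a = 0) : 0 < ∫ x in a..c, V x := by
  have hmono : StrictMonoOn V (Set.Icc a c) := by
    refine strictMonoOn_of_deriv_pos (convex_Icc a c) hV fun x hx => ?_
    rw [interior_Icc] at hx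
    rw [(hV' x hx).deriv]
    exact hpos x hx
  refine intervalIntegral.intervalIntegral_pos_of_pos_on ?_ (fun x hx => ?_) hac
  · refine ContinuousOn.intervalIntegrable ?_
    rwa [Set.uIcc_of_le hac.le]
  · have := hmono (Set.left_mem_Icc.2 hac.le) (Set.Ioo_subset_Icc_self hx) hx.1
    linarith

theorem affineTail_right {a b A E : ℝ} : affineTail a b A E b = E := by simp [affineTail]

theorem affineTail_left {a b A E : ℝ} (hab : a < b) : affineTail a b A E a = A := by
  have : b - a ≠ 0 := (sub_pos.2 hab).ne'
  rw [affineTail]; field_simp; ring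

theorem affineTail_pos {a b A E x : ℝ} (hab : a < b) (hE : 0 < E) (hEA : E < A) (hx : x ≤ b) :
    0 < affineTail a b A E x := by
  have := mul_nonneg (div_pos (sub_pos.2 hEA) (sub_pos.2 hab)).le (sub_nonneg.2 hx)
  rw [affineTail]; linarith

theorem hasDerivAt_affineTail {a b A E : ℝ} (x : ℝ) :
    HasDerivAt (affineTail a b A E) (-((A - E) / (b - a))) x := by
  have := (((hasDerivAt_id x).const_sub b).const_mul ((A - E) / (b - a))).const_add E
  convert! this using 1
  simp

/-- For the affine tail Γ of slope −m one has Γ(x) + m(x − a) = A, so the quotient rule leaves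
A²/(AΓ)². This makes the first variation on a step explicit. -/
theorem hasDerivAt_div_affineTail {a b A E x : ℝ} (hab : a < b) (hA : 0 < A)
    (hp : 0 < affineTail a b A E x) :
    HasDerivAt (fun x => (x - a) / (A * affineTail a b A E x)) (affineTail a b A E x ^ 2)⁻¹ x := by
  have hba : b - a ≠ 0 := (sub_pos.2 hab).ne'
  have h1 := ((hasDerivAt_id x).sub_const a).div
    ((hasDerivAt_affineTail (a := a) (b := b) (A := A) (E := E) x).const_mul A)
    (mul_pos hA hp).ne'
  refine h1.congr_deriv ?_
  have e : affineTail a b A E x + (x - a) * ((A - E) / (b - a)) = A := by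
    rw [affineTail]; field_simp; ring
  have hp' := hp.ne'
  simp only [id]
  rw [div_eq_iff (by positivity)]
  have : (affineTail a b A E x ^ 2)⁻¹ * (A * affineTail a b A E x) ^ 2 = A * A := by
    field_simp
  rw [this]
  linear_combination A * e

theorem integral_inv_sq_affineTail {a b A E x : ℝ} (hab : a < b) (hE : 0 < E) (hEA : E < A)
    (hx : x ∈ Set.Icc a b) :
    ∫ t in a..x, (affineTail a b A E t ^ 2)⁻¹ = (x - a) / (A * affineTail a b A E x) := by
  have hp : ∀ t ∈ Set.uIcc a x, 0 < affineTail a b A E t := by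
    intro t ht
    rw [Set.uIcc_of_le hx.1] at ht
    exact affineTail_pos hab hE hEA (ht.2.trans hx.2)
  rw [intervalIntegral.integral_eq_sub_of_hasDerivAt
    (fun t ht => hasDerivAt_div_affineTail hab (hE.trans hEA) (hp t ht))]
  · simp
  · refine ContinuousOn.intervalIntegrable fun t ht => ?_
    exact (((hasDerivAt_affineTail t).continuousAt.pow 2).inv₀
      (pow_pos (hp t ht) 2).ne').continuousWithinAt

/-! ### The first variation on one step: integrals, critical points, second-order conditions. -/

namespace IsStep

variable {ξ : ℝ → ℝ} {a b A E : ℝ}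

theorem slope_pos (S : IsStep ξ a b A E) : 0 < (A - E) / (b - a) :=
  div_pos (sub_pos.2 S.tail_lt) (sub_pos.2 S.lt)

theorem left_pos (S : IsStep ξ a b A E) : 0 < A := S.pos.trans S.tail_lt

theorem affineTail_pos (S : IsStep ξ a b A E) {x : ℝ} (hx : x ≤ b) :
    0 < affineTail a b A E x := SphericalSpin.affineTail_pos S.lt S.pos S.tail_lt hx

theorem affineTail_left (S : IsStep ξ a b A E) : affineTail a b A E a = A :=
  SphericalSpin.affineTail_left S.lt

theorem hasDerivAt_stepVariation (hξ : IsCubicLike ξ) (S : IsStep ξ a b A E) {x : ℝ}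
    (hx : x ≤ b) : HasDerivAt (stepVariation ξ a b A E)
      (iteratedDeriv 2 ξ x - (affineTail a b A E x ^ 2)⁻¹) x :=
  ((hξ.hasDerivAt_deriv x).sub_const (deriv ξ a)).sub
    (hasDerivAt_div_affineTail S.lt S.left_pos (S.affineTail_pos hx))

theorem continuousOn_stepVariation (hξ : IsCubicLike ξ) (S : IsStep ξ a b A E) :
    ContinuousOn (stepVariation ξ a b A E) (Set.Icc a b) := fun _ hx =>
  (S.hasDerivAt_stepVariation hξ hx.2).continuousAt.continuousWithinAt

theorem intervalIntegrable_stepVariation (hξ : IsCubicLike ξ) (S : IsStep ξ a b A E) {x y : ℝ}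
    (hx : x ∈ Set.Icc a b) (hy : y ∈ Set.Icc a b) :
    IntervalIntegrable (stepVariation ξ a b A E) volume x y :=
  ((S.continuousOn_stepVariation hξ).mono (Set.uIcc_subset_Icc hx hy)).intervalIntegrable

theorem stepVariation_left : stepVariation ξ a b A E a = 0 := by simp [stepVariation]

theorem stepVariation_right (S : IsStep ξ a b A E) : stepVariation ξ a b A E b = 0 := by
  have hA := S.left_pos
  have hE := S.pos
  rw [stepVariation, affineTail_right, ← S.mean]
  field_simp
  ring

/-- The integral of the first variation over the part of a step to the right of a critical
point. -/
theorem integral_stepVariation (hξ : IsCubicLike ξ) (S : IsStep ξ a b A E) {y : ℝ}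
    (hy : y ∈ Set.Ico a b) (h0 : stepVariation ξ a b A E y = 0) :
    ∫ x in y..b, stepVariation ξ a b A E x = h ξ y b (affineTail a b A E y / E) := by
  have hA := S.left_pos
  have hE := S.pos
  set m := (A - E) / (b - a) with hm
  have hm0 : 0 < m := S.slope_pos
  have hba : 0 < b - a := sub_pos.2 S.lt
  have hlin : ∀ x, affineTail a b A E x = A - m * (x - a) := by
    intro x
    have : m * (b - a) = A - E := by rw [hm]; field_simp
    rw [affineTail, ← hm]
    linear_combination this
  -- An antiderivative of the first variation: (x − a)/(AΓ) = (A/Γ − 1)/(Am), and 1/Γ integrates to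
  -- −(log Γ)/m.
  let Φ : ℝ → ℝ := fun x => ξ x - deriv ξ a * x -
    1 / (A * m) * (-(A / m) * Real.log (affineTail a b A E x) - x)
  have hΦ : ∀ x ∈ Set.uIcc y b, HasDerivAt Φ (stepVariation ξ a b A E x) x := by
    intro x hx
    rw [Set.uIcc_of_le hy.2.le] at hx
    have hp := S.affineTail_pos hx.2
    have h1 := ((hξ.hasDerivAt x).sub ((hasDerivAt_id x).const_mul (deriv ξ a))).sub
      (((((hasDerivAt_affineTail (a := a) (b := b) (A := A) (E := E) x).log hp.ne').const_mul
        (-(A / m))).sub (hasDerivAt_id x)).const_mul (1 / (A * m)))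
    refine h1.congr_deriv ?_
    rw [stepVariation, ← hm, mul_one]
    congr 1
    rw [hlin] at hp ⊢
    have hp' := hp.ne'
    field_simp
    ring
  have hint := intervalIntegral.integral_eq_sub_of_hasDerivAt hΦ
    (S.intervalIntegrable_stepVariation hξ ⟨hy.1, hy.2.le⟩ (Set.right_mem_Icc.2 S.lt.le))
  have hp := S.affineTail_pos hy.2.le
  set Y := affineTail a b A E y with hY
  have hYE : Y - E = m * (b - y) := by rw [hY, affineTail, ← hm]; ring
  have hAY : Y = A - m * (y - a) := hlin y
  have hby : 0 < b - y := sub_pos.2 hy.2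
  have hξy : deriv ξ y = deriv ξ a + (y - a) / (A * Y) := by
    rw [stepVariation, ← hY] at h0; linarith
  -- Thus [y, b] with the tail masses Y and E satisfies the mean condition of a step in its own
  -- right.
  have hξb : deriv ξ b - deriv ξ y = (b - y) / (Y * E) := by
    have : deriv ξ b - deriv ξ a = (b - a) / (A * E) := by
      rw [eq_div_iff (by positivity), S.mean]
    rw [hξy, ← sub_sub, this]
    have e1 : E = A - m * (b - a) := by rw [← hlin b, affineTail_right]
    rw [div_sub_div _ _ (by positivity) (by positivity), div_eq_div_iff (by positivity)
      (by positivity)]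
    have key : (b - a) * Y - E * (y - a) = A * (b - y) := by rw [hAY, e1]; ring
    linear_combination (A * Y * E) * key
  have hz : Y / E - 1 = m * (b - y) / E := by rw [← hYE]; field_simp
  have hlog : Real.log (Y / E) = Real.log Y - Real.log E := Real.log_div hp.ne' hE.ne'
  rw [hint, h, hξb, hz, hlog]
  simp only [Φ]
  rw [affineTail_right, ← hY, hξy]
  have e1 : (b - y) / (Y * E) * (b - y) * (1 / (m * (b - y) / E) -
      Y / E / (m * (b - y) / E) ^ 2 * (Real.log Y - Real.log E)) =
      (b - y) / (m * Y) - (Real.log Y - Real.log E) / m ^ 2 := by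
    field_simp
  have e2 : (y - a) / (A * Y) * (b - y) = (b - y) / (m * Y) - (b - y) / (A * m) := by
    rw [div_sub_div _ _ (by positivity) (by positivity), div_mul_eq_mul_div,
      div_eq_div_iff (by positivity) (by positivity)]
    linear_combination ((b - y) * A * Y * m) * hAY
  rw [e1, add_mul, e2]
  field_simp
  ring

theorem integral_stepVariation_eq_h (hξ : IsCubicLike ξ) (S : IsStep ξ a b A E) :
    ∫ x in a..b, stepVariation ξ a b A E x = h ξ a b (A / E) := by
  rw [S.integral_stepVariation hξ ⟨le_rfl, S.lt⟩ stepVariation_left, S.affineTail_left]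

/-- The critical points in a step. -/
theorem stepVariation_eq_zero_iff (hξ : IsCubicLike ξ) (S : IsStep ξ a b A E) {y : ℝ}
    (hy : y ∈ Set.Ioo a b) :
    (stepVariation ξ a b A E y = 0 ↔ A / E = r₁ ξ a b y) ∧
      (stepVariation ξ a b A E y = 0 → affineTail a b A E y / E = r₁ ξ y b a) := by
  have hA := S.left_pos
  have hE := S.pos
  have hba : 0 < b - a := sub_pos.2 S.lt
  have hp := S.affineTail_pos hy.2.le
  set Y := affineTail a b A E y with hY
  have hYba : Y * (b - a) = A * (b - y) + E * (y - a) := by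
    rw [hY, affineTail]; field_simp; ring
  obtain ⟨p, hpdef⟩ : ∃ p, p = deriv ξ y - deriv ξ a := ⟨_, rfl⟩
  obtain ⟨q, hqdef⟩ : ∃ q, q = deriv ξ b - deriv ξ y := ⟨_, rfl⟩
  have hp0 : 0 < p := by have := hξ.deriv_lt S.nonneg hy.1; linarith
  have hq0 : 0 < q := by have := hξ.deriv_lt (S.nonneg.trans hy.1.le) hy.2; linarith
  have hpq : (p + q) * (A * E) = b - a := by rw [← S.mean, hpdef, hqdef]; ring
  have hya : 0 < y - a := sub_pos.2 hy.1
  have hby : 0 < b - y := sub_pos.2 hy.2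
  have hcrit : stepVariation ξ a b A E y = 0 ↔ p * (A * Y) = y - a := by
    rw [stepVariation, ← hY, ← hpdef, sub_eq_zero, eq_div_iff (by positivity)]
  have hr : r₁ ξ a b y = q * (y - a) / ((b - y) * p) := by
    rw [r₁, ← hpdef, show deriv ξ y - deriv ξ b = -q by rw [hqdef]; ring,
      show y - b = -(b - y) by ring, neg_mul, neg_mul, neg_div_neg_eq]
  have hr' : r₁ ξ y b a = (p + q) * (y - a) / ((b - a) * p) := by
    rw [r₁, show deriv ξ a - deriv ξ b = -(p + q) by rw [hpdef, hqdef]; ring,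
      show deriv ξ a - deriv ξ y = -p by rw [hpdef]; ring,
      show a - y = -(y - a) by ring, show a - b = -(b - a) by ring, neg_mul_neg, neg_mul_neg]
  refine ⟨?_, fun h0 => ?_⟩
  · rw [hcrit, hr, div_eq_div_iff hE.ne' (by positivity)]
    -- Once Y is written in its affine form and the mean condition is used, the two equations differ
    -- only by the nonzero factors b − a and A.
    have key : (p * (A * Y) - (y - a)) * (b - a) = A * (A * ((b - y) * p) - q * (y - a) * E) := by
      linear_combination p * A * hYba + (y - a) * hpq
    constructor
    · intro h0
      rw [h0, sub_self, zero_mul] at key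
      have := (mul_eq_zero.1 key.symm).resolve_left hA.ne'
      linarith
    · intro h0
      rw [h0, sub_self, mul_zero] at key
      have := (mul_eq_zero.1 key).resolve_right hba.ne'
      linarith
  · rw [hcrit] at h0
    rw [hr', div_eq_div_iff hE.ne' (by positivity), ← h0, ← hpq]
    ring

/-- The tail integrals of the first variation in a step are nonnegative as soon as they are at
the critical points. -/
theorem integral_nonneg (hξ : IsCubicLike ξ) (S : IsStep ξ a b A E) (h0 : h ξ a b (A / E) = 0)
    (hcrit : ∀ y ∈ Set.Ioo a b, A / E = r₁ ξ a b y → 0 ≤ h ξ y b (r₁ ξ y b a)) :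
    ∀ x ∈ Set.Icc a b, 0 ≤ ∫ t in x..b, stepVariation ξ a b A E t := by
  have hcont : ContinuousOn (fun x => ∫ t in x..b, stepVariation ξ a b A E t) (Set.Icc a b) := by
    have := intervalIntegral.continuousOn_primitive_interval_left (a := a) (b := b)
      (f := stepVariation ξ a b A E) (μ := volume) (by
        rw [Set.uIcc_of_le S.lt.le]
        exact (S.continuousOn_stepVariation hξ).integrableOn_Icc)
    rwa [Set.uIcc_of_le S.lt.le] at this
  -- The minimum of the tail integral is attained at an end of the step, where the value is 0, or at
  -- a zero of the first variation, where the value is the `h` of the hypothesis.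
  obtain ⟨u, hu, hmin⟩ := isCompact_Icc.exists_isMinOn (Set.nonempty_Icc.2 S.lt.le) hcont
  suffices 0 ≤ ∫ t in u..b, stepVariation ξ a b A E t from fun x hx => this.trans (hmin hx)
  rcases hu.1.eq_or_lt with rfl | hau
  · rw [S.integral_stepVariation_eq_h hξ, h0]
  rcases hu.2.eq_or_lt with rfl | hub
  · simp
  have hloc : IsLocalMin (fun x => ∫ t in x..b, stepVariation ξ a b A E t) u :=
    hmin.isLocalMin (Icc_mem_nhds hau hub)
  have hder : HasDerivAt (fun x => ∫ t in x..b, stepVariation ξ a b A E t)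
      (-stepVariation ξ a b A E u) u := by
    refine intervalIntegral.integral_hasDerivAt_left
      (S.intervalIntegrable_stepVariation hξ hu (Set.right_mem_Icc.2 S.lt.le)) ?_
      (S.hasDerivAt_stepVariation hξ hu.2).continuousAt
    have := (S.continuousOn_stepVariation hξ).stronglyMeasurableAtFilter_nhdsWithin
      measurableSet_Icc (μ := volume) u
    rwa [nhdsWithin_eq_nhds.2 (Icc_mem_nhds hau hub)] at this
  have hz : stepVariation ξ a b A E u = 0 := neg_eq_zero.1 (hloc.hasDerivAt_eq_zero hder)
  have hc := S.stepVariation_eq_zero_iff hξ ⟨hau, hub⟩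
  rw [S.integral_stepVariation hξ ⟨hau.le, hub⟩ hz, hc.2 hz]
  exact hcrit u ⟨hau, hub⟩ (hc.1.1 hz)

theorem continuousAt_second (hξ : IsCubicLike ξ) (S : IsStep ξ a b A E) {x : ℝ} (hx : x ≤ b) :
    ContinuousAt (fun x => iteratedDeriv 2 ξ x - (affineTail a b A E x ^ 2)⁻¹) x :=
  (hξ.continuous_deriv2.continuousAt).sub
    (((hasDerivAt_affineTail x).continuousAt.pow 2).inv₀ (pow_pos (S.affineTail_pos hx) 2).ne')

/-- Otherwise the first variation would increase strictly to its zero at b, and the tail integral at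
c would be negative. -/
theorem exists_nonpos_left (hξ : IsCubicLike ξ) (S : IsStep ξ a b A E)
    (hnn : ∀ x ∈ Set.Icc a b, 0 ≤ ∫ t in x..b, stepVariation ξ a b A E t) {c : ℝ}
    (hc : c ∈ Set.Ico a b) :
    ∃ x ∈ Set.Ioo c b, iteratedDeriv 2 ξ x - (affineTail a b A E x ^ 2)⁻¹ ≤ 0 := by
  by_contra! hpos
  have hlt := integral_neg_of_deriv_pos_left hc.2
    ((S.continuousOn_stepVariation hξ).mono (Set.Icc_subset_Icc_left hc.1))
    (fun x hx => S.hasDerivAt_stepVariation hξ hx.2.le) hpos S.stepVariation_right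
  have := hnn c ⟨hc.1, hc.2.le⟩
  linarith

/-- Mirror image at a: the first variation would be positive on (a, c), and since its integral over
the whole step is 0, the tail integral at c would be negative. -/
theorem exists_nonpos_right (hξ : IsCubicLike ξ) (S : IsStep ξ a b A E)
    (hnn : ∀ x ∈ Set.Icc a b, 0 ≤ ∫ t in x..b, stepVariation ξ a b A E t)
    (h0 : h ξ a b (A / E) = 0) {c : ℝ} (hc : c ∈ Set.Ioc a b) :
    ∃ x ∈ Set.Ioo a c, iteratedDeriv 2 ξ x - (affineTail a b A E x ^ 2)⁻¹ ≤ 0 := by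
  by_contra! hpos
  have hlt := integral_pos_of_deriv_pos_right hc.1
    ((S.continuousOn_stepVariation hξ).mono (Set.Icc_subset_Icc_right hc.2))
    (fun x hx => S.hasDerivAt_stepVariation hξ (hx.2.le.trans hc.2)) hpos stepVariation_left
  have h1 := hnn c ⟨hc.1.le, hc.2⟩
  have h2 := intervalIntegral.integral_add_adjacent_intervals
    (S.intervalIntegrable_stepVariation hξ (Set.left_mem_Icc.2 S.lt.le) ⟨hc.1.le, hc.2⟩)
    (S.intervalIntegrable_stepVariation hξ ⟨hc.1.le, hc.2⟩ (Set.right_mem_Icc.2 S.lt.le))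
  rw [S.integral_stepVariation_eq_h hξ, h0] at h2
  linarith

/-- If the bound failed, the derivative ξ'' − Γ^{-2} of the first variation would be positive near b
by continuity, against `exists_nonpos_left`. -/
theorem second_order_right (hξ : IsCubicLike ξ) (S : IsStep ξ a b A E)
    (hnn : ∀ x ∈ Set.Icc a b, 0 ≤ ∫ t in x..b, stepVariation ξ a b A E t) :
    iteratedDeriv 2 ξ b * E ^ 2 ≤ 1 := by
  by_contra! hgt
  have hE := S.pos
  have hpos : 0 < iteratedDeriv 2 ξ b - (affineTail a b A E b ^ 2)⁻¹ := by
    rw [affineTail_right, sub_pos, inv_lt_iff_one_lt_mul₀ (by positivity)]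
    linarith
  have hev := (S.continuousAt_second hξ le_rfl).eventually (lt_mem_nhds hpos)
  obtain ⟨c, hc, hsub⟩ := exists_Ioc_subset_of_mem_nhds hev ⟨a, S.lt⟩
  obtain ⟨x, hx, hle⟩ := S.exists_nonpos_left hξ hnn (c := max a c)
    ⟨le_max_left _ _, max_lt S.lt hc⟩
  have := hsub ⟨(le_max_right _ _).trans_lt hx.1, hx.2.le⟩
  simp only [Set.mem_ofPred_eq] at this
  linarith

theorem second_order_left (hξ : IsCubicLike ξ) (S : IsStep ξ a b A E)
    (hnn : ∀ x ∈ Set.Icc a b, 0 ≤ ∫ t in x..b, stepVariation ξ a b A E t)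
    (h0 : h ξ a b (A / E) = 0) : iteratedDeriv 2 ξ a * A ^ 2 ≤ 1 := by
  by_contra! hgt
  have hA := S.left_pos
  have hpos : 0 < iteratedDeriv 2 ξ a - (affineTail a b A E a ^ 2)⁻¹ := by
    rw [S.affineTail_left, sub_pos, inv_lt_iff_one_lt_mul₀ (by positivity)]
    linarith
  have hev := (S.continuousAt_second hξ S.lt.le).eventually (lt_mem_nhds hpos)
  obtain ⟨c, hc, hsub⟩ := exists_Ico_subset_of_mem_nhds hev ⟨b, S.lt⟩
  obtain ⟨x, hx, hle⟩ := S.exists_nonpos_right hξ hnn h0 (c := min b c)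
    ⟨lt_min S.lt hc, min_le_left _ _⟩
  have := hsub ⟨hx.1.le, hx.2.trans_le (min_le_right _ _)⟩
  simp only [Set.mem_ofPred_eq] at this
  linarith

/-- Comparison of the tail with the profile. -/
theorem second_pos_of_profile_lt (hξ : IsCubicLike ξ) (S : IsStep ξ a b A E) {x : ℝ} (hx0 : 0 < x)
    (hxb : x ≤ b)
    (hlt : profile ξ x < affineTail a b A E x) :
    0 < iteratedDeriv 2 ξ x - (affineTail a b A E x ^ 2)⁻¹ := by
  have hp := S.affineTail_pos hxb
  rw [sub_pos, inv_lt_iff_one_lt_mul₀ (by positivity), ← hξ.deriv2_mul_profile_sq hx0]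
  refine mul_lt_mul_of_pos_left ?_ (hξ.deriv2_pos hx0)
  exact pow_lt_pow_left₀ hlt (hξ.profile_pos hx0).le two_ne_zero

/-- A steeper affine tail meeting the profile at b would lie above it just left of b, where the
first variation would then increase. This gives the monotonicity of the density where a step
precedes a smooth interval. -/
theorem slope_le_of_profile (hξ : IsCubicLike ξ) (S : IsStep ξ a b A E)
    (hnn : ∀ x ∈ Set.Icc a b, 0 ≤ ∫ t in x..b, stepVariation ξ a b A E t) (hb : E = profile ξ b) :
    (A - E) / (b - a) ≤ -deriv (profile ξ) b := by
  by_contra! hgt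
  have hb0 : 0 < b := S.nonneg.trans_lt S.lt
  have hder := (hasDerivAt_affineTail (a := a) (b := b) (A := A) (E := E) b).sub
    (hξ.hasDerivAt_profile hb0)
  have hneg : -((A - E) / (b - a)) - deriv (profile ξ) b < 0 := by linarith
  have hev := (hasDerivWithinAt_iff_tendsto_slope' (s := Set.Iio b) (by simp)).1
    hder.hasDerivWithinAt |>.eventually (gt_mem_nhds hneg)
  obtain ⟨c, hc, hsub⟩ := (mem_nhdsLT_iff_exists_Ioo_subset' S.lt).1 hev
  obtain ⟨x, hx, hle⟩ := S.exists_nonpos_left hξ hnn (c := max a c)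
    ⟨le_max_left _ _, max_lt S.lt hc⟩
  have hs : slope (affineTail a b A E - profile ξ) b x < 0 :=
    hsub ⟨(le_max_right _ _).trans_lt hx.1, hx.2⟩
  rw [slope_def_field, Pi.sub_apply, Pi.sub_apply, affineTail_right, ← hb, sub_self, sub_zero,
    div_neg_iff] at hs
  have hx0 : 0 < x := S.nonneg.trans_lt ((le_max_left _ _).trans_lt hx.1)
  have := S.second_pos_of_profile_lt hξ hx0 hx.2.le (by
    rcases hs with hs | hs
    · linarith [hs.1]
    · linarith [hs.2, hx.2])
  linarith

/-- The same comparison where a step follows a smooth interval: a flatter affine tail would lie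
above the profile just right of a. -/
theorem le_slope_of_profile (hξ : IsCubicLike ξ) (S : IsStep ξ a b A E)
    (hnn : ∀ x ∈ Set.Icc a b, 0 ≤ ∫ t in x..b, stepVariation ξ a b A E t)
    (h0 : h ξ a b (A / E) = 0) (ha0 : 0 < a) (ha : A = profile ξ a) :
    -deriv (profile ξ) a ≤ (A - E) / (b - a) := by
  by_contra! hgt
  have hder := (hasDerivAt_affineTail (a := a) (b := b) (A := A) (E := E) a).sub
    (hξ.hasDerivAt_profile ha0)
  have hneg : 0 < -((A - E) / (b - a)) - deriv (profile ξ) a := by linarith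
  have hev := (hasDerivWithinAt_iff_tendsto_slope' (s := Set.Ioi a) (by simp)).1
    hder.hasDerivWithinAt |>.eventually (lt_mem_nhds hneg)
  obtain ⟨c, hc, hsub⟩ := (mem_nhdsGT_iff_exists_Ioo_subset' S.lt).1 hev
  obtain ⟨x, hx, hle⟩ := S.exists_nonpos_right hξ hnn h0 (c := min b c)
    ⟨lt_min S.lt hc, min_le_left _ _⟩
  have hs : 0 < slope (affineTail a b A E - profile ξ) a x :=
    hsub ⟨hx.1, hx.2.trans_le (min_le_right _ _)⟩
  rw [slope_def_field, Pi.sub_apply, Pi.sub_apply, S.affineTail_left, ← ha, sub_self, sub_zero,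
    div_pos_iff] at hs
  have hxb : x ≤ b := hx.2.le.trans (min_le_left _ _)
  have := S.second_pos_of_profile_lt hξ (ha0.trans hx.1) hxb (by
    rcases hs with hs | hs
    · linarith [hs.1]
    · linarith [hs.2, hx.1])
  linarith

end IsStep

end SphericalSpin

namespace SphericalSpin

/-! ### The algebra of a block -/

/-- The inverse difference quotient of `ξ'`. -/
noncomputable def invSlope (ξ : ℝ → ℝ) (a b : ℝ) : ℝ := (b - a) / (deriv ξ b - deriv ξ a)

theorem invSlope_comm (ξ : ℝ → ℝ) (a b : ℝ) : invSlope ξ a b = invSlope ξ b a := by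
  rw [invSlope, invSlope, ← neg_sub a b, ← neg_sub (deriv ξ a), neg_div_neg_eq]

theorem invSlope_pos {ξ : ℝ → ℝ} (hξ : IsCubicLike ξ) {a b : ℝ} (ha : 0 ≤ a) (hab : a < b) :
    0 < invSlope ξ a b :=
  div_pos (sub_pos.2 hab) (sub_pos.2 (hξ.deriv_lt ha hab))

/-- On a step the inverse slope is the product of the two tail masses, so this form turns the
functions of the criterion into expressions in tail masses. -/
theorem r₁_eq (ξ : ℝ → ℝ) (x y z : ℝ) : r₁ ξ x y z = invSlope ξ x z / invSlope ξ y z := by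
  rw [r₁, invSlope, invSlope, div_div_div_eq, mul_comm (z - x), mul_comm (z - y)]

theorem r₂_eq (ξ : ℝ → ℝ) (x y : ℝ) : r₂ ξ x y = iteratedDeriv 2 ξ y * invSlope ξ x y := by
  rw [r₂, invSlope, mul_div_assoc]

/-- The points of a block. -/
structure IsBlock (s : ℕ) (x : ℕ → ℝ) : Prop where
  nonneg_zero : 0 ≤ x 0
  lt : ∀ i < s, x i < x (i + 1)

/-- The ratios of consecutive tail masses in a block whose last ratio is `ζ`. -/
noncomputable def blockRatio (ξ : ℝ → ℝ) (s : ℕ) (x : ℕ → ℝ) (ζ : ℝ) (l : ℕ) : ℝ :=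
  if Odd (s - l) then rAt ξ x l * ratioProd ξ s x ((s - l) / 2) / ζ
  else ζ / ratioProd ξ s x ((s - l) / 2)

theorem ratioProd_zero (ξ : ℝ → ℝ) (s : ℕ) (x : ℕ → ℝ) : ratioProd ξ s x 0 = 1 := by
  simp [ratioProd]

theorem ratioProd_succ (ξ : ℝ → ℝ) (s : ℕ) (x : ℕ → ℝ) (N : ℕ) :
    ratioProd ξ s x (N + 1) = ratioProd ξ s x N *
      (rAt ξ x (s + 1 - 2 * (N + 1)) / rAt ξ x (s - 2 * (N + 1))) := by
  rw [ratioProd, ratioProd, Finset.prod_Icc_succ_top (by omega)]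

theorem rAt_eq (ξ : ℝ → ℝ) (x : ℕ → ℝ) (l : ℕ) :
    rAt ξ x l = invSlope ξ (x (l - 1)) (x l) / invSlope ξ (x l) (x (l + 1)) := by
  rw [rAt, r₁_eq, invSlope_comm ξ (x (l + 1))]

theorem zpow_neg_one_pow_of_even {n : ℕ} (hn : Even n) (a : ℝ) : a ^ ((-1 : ℤ) ^ n) = a := by
  rw [hn.neg_one_pow, zpow_one]

theorem zpow_neg_one_pow_of_odd {n : ℕ} (hn : Odd n) (a : ℝ) : a ^ ((-1 : ℤ) ^ n) = a⁻¹ := by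
  rw [hn.neg_one_pow, zpow_neg_one]

namespace IsBlock

variable {ξ : ℝ → ℝ} {s : ℕ} {x : ℕ → ℝ}

theorem nonneg (B : IsBlock s x) : ∀ i ≤ s, 0 ≤ x i := by
  intro i
  induction i with
  | zero => exact fun _ => B.nonneg_zero
  | succ i ih => exact fun hi => (ih (by omega)).trans (B.lt i (by omega)).le

theorem lt' (B : IsBlock s x) {l : ℕ} (h1 : 1 ≤ l) (hl : l ≤ s) : x (l - 1) < x l := by
  have := B.lt (l - 1) (by omega)
  rwa [Nat.sub_add_cancel h1] at this

theorem pos (B : IsBlock s x) {l : ℕ} (h1 : 1 ≤ l) (hl : l ≤ s) : 0 < x l :=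
  (B.nonneg (l - 1) (by omega)).trans_lt (B.lt' h1 hl)

theorem invSlope_pos (hξ : IsCubicLike ξ) (B : IsBlock s x) {l : ℕ} (h1 : 1 ≤ l) (hl : l ≤ s) :
    0 < invSlope ξ (x (l - 1)) (x l) :=
  SphericalSpin.invSlope_pos hξ (B.nonneg (l - 1) (by omega)) (B.lt' h1 hl)

theorem rAt_pos (hξ : IsCubicLike ξ) (B : IsBlock s x) {l : ℕ} (h1 : 1 ≤ l) (hl : l < s) :
    0 < rAt ξ x l := by
  rw [rAt_eq]
  exact div_pos (B.invSlope_pos hξ h1 hl.le)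
    (B.invSlope_pos hξ (l := l + 1) (by omega) (by omega))

theorem ratioProd_pos (hξ : IsCubicLike ξ) (B : IsBlock s x) {N : ℕ} (hN : 2 * N < s) :
    0 < ratioProd ξ s x N := by
  rw [ratioProd]
  refine Finset.prod_pos fun i hi => ?_
  rw [Finset.mem_Icc] at hi
  exact div_pos (B.rAt_pos hξ (by omega) (by omega)) (B.rAt_pos hξ (by omega) (by omega))

theorem blockRatio_last (ζ : ℝ) : blockRatio ξ s x ζ s = ζ := by
  simp [blockRatio, ratioProd_zero]

/-- The alternating products of the 𝐫's come from running the recursion z_l z_{l+1} = 𝐫_l backwards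
from z_s = ζ; the parity of s − l decides whether ζ or its inverse appears. -/
theorem blockRatio_mul (hξ : IsCubicLike ξ) (B : IsBlock s x) {ζ : ℝ} (hζ : 0 < ζ) {l : ℕ}
    (h1 : 1 ≤ l) (hl : l < s) :
    blockRatio ξ s x ζ l * blockRatio ξ s x ζ (l + 1) = rAt ξ x l := by
  by_cases ho : Odd (s - l)
  · have he : ¬ Odd (s - (l + 1)) := by
      rw [Nat.odd_iff] at ho ⊢; omega
    have hd : (s - (l + 1)) / 2 = (s - l) / 2 := by
      rw [Nat.odd_iff] at ho; omega
    have hP := B.ratioProd_pos hξ (N := (s - l) / 2) (by omega)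
    rw [blockRatio, blockRatio, if_pos ho, if_neg he, hd]
    field_simp
  · have he : Odd (s - (l + 1)) := by
      rw [Nat.odd_iff] at ho ⊢; omega
    obtain ⟨n, hn⟩ : ∃ n, s = l + 2 * (n + 1) := by
      rw [Nat.odd_iff] at ho
      exact ⟨(s - l) / 2 - 1, by omega⟩
    have hd : (s - (l + 1)) / 2 = n := by omega
    have hd' : (s - l) / 2 = n + 1 := by omega
    have hP := B.ratioProd_pos hξ (N := n) (by omega)
    have hr := B.rAt_pos hξ h1 hl
    have hr' := B.rAt_pos hξ (l := l + 1) (by omega) (by omega)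
    rw [blockRatio, blockRatio, if_neg ho, if_pos he, hd, hd', ratioProd_succ,
      show s + 1 - 2 * (n + 1) = l + 1 by omega, show s - 2 * (n + 1) = l by omega]
    field_simp

theorem blockRatio_pos (hξ : IsCubicLike ξ) (B : IsBlock s x) {ζ : ℝ} (hζ : 0 < ζ) {l : ℕ}
    (h1 : 1 ≤ l) (hl : l ≤ s) : 0 < blockRatio ξ s x ζ l := by
  have hP := B.ratioProd_pos hξ (N := (s - l) / 2) (by omega)
  rw [blockRatio]
  split_ifs with ho
  · have : l < s := by
      rcases hl.eq_or_lt with rfl | h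
      · simp at ho
      · exact h
    have := B.rAt_pos hξ h1 this
    positivity
  · positivity

/-- Each z_l follows from z_{l+1} by division, so the last value determines all of them. -/
theorem eq_blockRatio (hξ : IsCubicLike ξ) (B : IsBlock s x) {z : ℕ → ℝ}
    (hz : ∀ l, 1 ≤ l → l ≤ s → 0 < z l)
    (hmul : ∀ l, 1 ≤ l → l < s → z l * z (l + 1) = rAt ξ x l) :
    ∀ l, 1 ≤ l → l ≤ s → z l = blockRatio ξ s x (z s) l := by
  have key : ∀ d l, 1 ≤ l → l + d = s → z l = blockRatio ξ s x (z s) l := by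
    intro d
    induction d with
    | zero =>
      intro l h1 hd
      rw [add_zero] at hd
      rw [hd, blockRatio_last]
    | succ d ih =>
      intro l h1 hd
      have hs : 0 < z s := hz s (by omega) le_rfl
      have e := ih (l + 1) (by omega) (by omega)
      have m1 := hmul l h1 (by omega)
      have m2 := B.blockRatio_mul hξ hs h1 (by omega)
      rw [← m2, ← e] at m1
      exact mul_right_cancel₀ (hz (l + 1) (by omega) (by omega)).ne' m1
  exact fun l h1 hl => key (s - l) l h1 (by omega)

theorem r₂_pos (hξ : IsCubicLike ξ) (B : IsBlock s x) {l : ℕ} (h1 : 1 ≤ l) (hl : l ≤ s) :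
    0 < r₂ ξ (x (l - 1)) (x l) := by
  rw [r₂_eq]
  exact mul_pos (hξ.deriv2_pos (B.pos h1 hl)) (B.invSlope_pos hξ h1 hl)

theorem r₂_succ_eq (hξ : IsCubicLike ξ) (B : IsBlock s x) {l : ℕ} (h1 : 1 ≤ l) (hl : l < s) :
    r₂ ξ (x (l - 1)) (x l) = rAt ξ x l * r₂ ξ (x (l + 1)) (x l) := by
  have := B.invSlope_pos hξ (l := l + 1) (by omega) hl
  rw [Nat.add_sub_cancel] at this
  rw [r₂_eq, r₂_eq, rAt_eq, invSlope_comm ξ (x (l + 1))]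
  field_simp

/-- The argument of `h` in the criterion is the ratio of the tail masses. -/
theorem h_arg_eq (hξ : IsCubicLike ξ) (B : IsBlock s x) (ζ : ℝ) {l : ℕ}
    (h1 : 1 ≤ l) (hl : l ≤ s) :
    r₂ ξ (x (l - 1)) (x l) * (blockF ξ s x l)⁻¹ * ζ ^ ((-1 : ℤ) ^ (s - l)) =
      blockRatio ξ s x ζ l := by
  have hP := B.ratioProd_pos hξ (N := (s - l) / 2) (by omega)
  have hr := B.r₂_pos hξ h1 hl
  by_cases ho : Odd (s - l)
  · have hls : l < s := by
      rcases hl.eq_or_lt with rfl | h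
      · simp at ho
      · exact h
    have e := B.r₂_succ_eq hξ h1 hls
    have hr' : r₂ ξ (x (l + 1)) (x l) ≠ 0 := by
      intro h0
      rw [e, h0, mul_zero] at hr
      exact lt_irrefl _ hr
    rw [blockF, blockRatio, if_pos ho, if_pos ho, zpow_neg_one_pow_of_odd ho, e]
    field_simp
  · rw [blockF, blockRatio, if_neg ho, if_neg ho, if_neg (by omega),
      zpow_neg_one_pow_of_even (Nat.not_odd_iff_even.1 ho)]
    field_simp

theorem blockF_last (hs : 1 ≤ s) : blockF ξ s x s = r₂ ξ (x (s - 1)) (x s) := by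
  rw [blockF, if_neg (by simp), if_neg (by omega)]
  simp [ratioProd_zero]

/-- The bounds on `ζ` by the numbers `ℱ` that enter `𝒴`, for interior and last points. -/
theorem blockF_le_iff (hξ : IsCubicLike ξ) (B : IsBlock s x) (ζ : ℝ) {l : ℕ}
    (h1 : 1 ≤ l) (hl : l ≤ s) (he : Even (s - l)) :
    blockF ξ s x l ≤ ζ ↔ r₂ ξ (x (l - 1)) (x l) ≤ blockRatio ξ s x ζ l := by
  have hP := B.ratioProd_pos hξ (N := (s - l) / 2) (by omega)
  rw [blockF, blockRatio, if_neg (Nat.not_odd_iff_even.2 he), if_neg (Nat.not_odd_iff_even.2 he),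
    if_neg (by omega), le_div_iff₀ hP]

theorem blockF_zero_even (hs : 1 ≤ s) (he : Even s) :
    blockF ξ s x 0 = r₂ ξ (x 1) (x 0) * (rAt ξ x 1 * ratioProd ξ s x ((s - 1) / 2)) := by
  have : s / 2 - 1 = (s - 1) / 2 := by
    rw [Nat.even_iff] at he; omega
  rw [blockF, if_neg (by simpa using he), if_pos rfl, this, mul_assoc]

theorem blockRatio_one_even (hs : 1 ≤ s) (he : Even s) (ζ : ℝ) :
    blockRatio ξ s x ζ 1 = rAt ξ x 1 * ratioProd ξ s x ((s - 1) / 2) / ζ := by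
  rw [blockRatio, if_pos]
  rw [Nat.even_iff] at he; rw [Nat.odd_iff]; omega

theorem blockF_zero_le_iff (hs : 1 ≤ s) (he : Even s) {ζ : ℝ} (hζ : 0 < ζ) :
    blockF ξ s x 0 ≤ ζ ↔ r₂ ξ (x 1) (x 0) * blockRatio ξ s x ζ 1 ≤ 1 := by
  rw [blockF_zero_even hs he, blockRatio_one_even hs he, ← mul_div_assoc, div_le_one hζ]

/-- The bounds on `ζ` by the numbers `ℱ` that enter `𝒵`. -/
theorem mul_blockF_le_iff (ζ : ℝ) {l : ℕ} (ho : Odd (s - l)) :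
    ζ * blockF ξ s x l ≤ 1 ↔ r₂ ξ (x (l + 1)) (x l) * blockRatio ξ s x ζ (l + 1) ≤ 1 := by
  have he : ¬ Odd (s - (l + 1)) := by
    rw [Nat.odd_iff] at ho ⊢; omega
  have hd : (s - (l + 1)) / 2 = (s - l) / 2 := by
    rw [Nat.odd_iff] at ho; omega
  rw [blockF, blockRatio, if_pos ho, if_neg he, hd, mul_left_comm, div_eq_mul_inv]

/-- In tail masses this is ξ''(x_0)Γ_0² = 1, the contact with the profile at the left end. The
exponent (−1)^s reflects whether z_1 is proportional to ζ or to 1/ζ. -/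
theorem blockF_zero_eq_iff (hξ : IsCubicLike ξ) (B : IsBlock s x) (hs : 1 ≤ s) {ζ : ℝ}
    (hζ : 0 < ζ) : blockF ξ s x 0 = ζ ^ ((-1 : ℤ) ^ s) ↔
      r₂ ξ (x 1) (x 0) * blockRatio ξ s x ζ 1 = 1 := by
  by_cases he : Even s
  · rw [blockF_zero_even hs he, blockRatio_one_even hs he, ← mul_div_assoc,
      div_eq_one_iff_eq hζ.ne', zpow_neg_one_pow_of_even he]
  · rw [Nat.not_even_iff_odd] at he
    have he' : ¬ Odd (s - 1) := by
      rw [Nat.odd_iff] at he ⊢; omega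
    have hd : (s - 1) / 2 = (s - 0) / 2 := by
      rw [Nat.odd_iff] at he; omega
    have hP := B.ratioProd_pos hξ (N := (s - 1) / 2) (by omega)
    rw [blockF, blockRatio, if_pos (by simpa using he), if_neg he', ← hd,
      zpow_neg_one_pow_of_odd he, zero_add, ← mul_div_assoc, div_eq_one_iff_eq hP.ne',
      mul_inv_eq_iff_eq_mul₀ hP.ne', eq_inv_mul_iff_mul_eq₀ hζ.ne', mul_comm ζ]

theorem blockA_lt_iff (hξ : IsCubicLike ξ) (B : IsBlock s x) (ζ : ℝ) {l : ℕ}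
    (h1 : 1 ≤ l) (ho : Odd (s - l)) :
    blockA ξ s x l < ζ ↔ r₁ ξ (x l) (x (l + 1)) (x (l - 1)) < blockRatio ξ s x ζ (l + 1) := by
  have he : ¬ Odd (s - (l + 1)) := by
    rw [Nat.odd_iff] at ho ⊢; omega
  have hd : (s - (l + 1)) / 2 = (s - l) / 2 := by
    rw [Nat.odd_iff] at ho; omega
  have hP := B.ratioProd_pos hξ (N := (s - l) / 2) (by
    rw [Nat.odd_iff] at ho; omega)
  rw [blockA, blockRatio, if_pos ho, if_neg he, hd, lt_div_iff₀ hP]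

theorem mul_blockA_lt_iff (ζ : ℝ) {l : ℕ} (he : Even (s - l)) :
    ζ * blockA ξ s x l < 1 ↔ r₁ ξ (x l) (x (l - 1)) (x (l + 1)) * blockRatio ξ s x ζ l < 1 := by
  rw [blockA, blockRatio, if_neg (Nat.not_odd_iff_even.2 he), if_neg (Nat.not_odd_iff_even.2 he),
    mul_left_comm, div_eq_mul_inv]

/-- Only the 𝐫's to the right of the inserted point and its neighbour enter, and the insertion
merely shifts their indices by one. -/
theorem ratioProd_insert {l : ℕ} (y : ℝ) {N : ℕ} (hN : l + 2 * N < s) :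
    ratioProd ξ (s + 1) (insertPoint x l y) N = ratioProd ξ s x N := by
  rw [ratioProd, ratioProd]
  refine Finset.prod_congr rfl fun i hi => ?_
  rw [Finset.mem_Icc] at hi
  have e : ∀ k, l + 1 ≤ k → rAt ξ (insertPoint x l y) (k + 1) = rAt ξ x k := by
    intro k hk
    rw [rAt, rAt]
    congr 1
    · simp only [insertPoint]; rw [if_neg (by omega), if_neg (by omega)]; congr 1
    · simp only [insertPoint]; rw [if_neg (by omega), if_neg (by omega)]; congr 1
    · simp only [insertPoint]; rw [if_neg (by omega), if_neg (by omega)]; congr 1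
  rw [show s + 1 + 1 - 2 * i = (s + 1 - 2 * i) + 1 by omega, e _ (by omega),
    show s + 1 - 2 * i = (s - 2 * i) + 1 by omega, e _ (by omega)]

/-- The equation for the critical points in a step. -/
theorem eq_critA_iff (hξ : IsCubicLike ξ) (B : IsBlock s x) (ζ : ℝ) {l : ℕ}
    (h1 : 1 ≤ l) (hl : l ≤ s) {y : ℝ} (hy : y ∈ Set.Ioo (x (l - 1)) (x l)) :
    ζ ^ ((-1 : ℤ) ^ (s - l)) = critA ξ s x l y ↔
      blockRatio ξ s x ζ l = r₁ ξ (x (l - 1)) (x l) y := by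
  rcases hl.eq_or_lt with rfl | hls
  · rw [critA, if_neg (lt_irrefl _), blockRatio_last, Nat.sub_self, pow_zero, zpow_one]
  have hy0 : 0 ≤ y := (B.nonneg (l - 1) (by omega)).trans hy.1.le
  have dab := B.invSlope_pos hξ h1 hl
  have day : 0 < invSlope ξ (x (l - 1)) y :=
    SphericalSpin.invSlope_pos hξ (B.nonneg (l - 1) (by omega)) hy.1
  have dyb : 0 < invSlope ξ y (x l) := SphericalSpin.invSlope_pos hξ hy0 hy.2
  have dbc := B.invSlope_pos hξ (l := l + 1) (by omega) hls
  rw [Nat.add_sub_cancel] at dbc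
  have i0 : insertPoint x l y (l - 1) = x (l - 1) := by
    rw [insertPoint, if_pos (by omega)]
  have i1 : insertPoint x l y l = y := by
    rw [insertPoint, if_neg (by omega), if_pos rfl]
  have i2 : insertPoint x l y (l + 1) = x l := by
    rw [insertPoint, if_neg (by omega), if_neg (by omega), Nat.add_sub_cancel]
  have i3 : insertPoint x l y (l + 2) = x (l + 1) := by
    rw [insertPoint, if_neg (by omega), if_neg (by omega)]; rfl
  have hr1 : rAt ξ (insertPoint x l y) (l + 1) =
      invSlope ξ y (x l) / invSlope ξ (x l) (x (l + 1)) := by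
    rw [rAt_eq, Nat.add_sub_cancel, i1, i2, i3]
  have hr0 : rAt ξ (insertPoint x l y) l = invSlope ξ (x (l - 1)) y / invSlope ξ y (x l) := by
    rw [rAt_eq, i0, i1, i2]
  have hrl : r₁ ξ (x (l - 1)) (x l) y = invSlope ξ (x (l - 1)) y / invSlope ξ y (x l) := by
    rw [r₁_eq, invSlope_comm ξ (x l)]
  have hral := rAt_eq ξ x l
  rw [critA, if_pos hls]
  by_cases ho : Odd (s - l)
  · obtain ⟨n, hn⟩ : ∃ n, s = l + 2 * n + 1 := by
      rw [Nat.odd_iff] at ho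
      exact ⟨(s - l) / 2, by omega⟩
    have hP := B.ratioProd_pos hξ (N := n) (by omega)
    -- The insertion replaces 𝐫_l by two numbers; their quotient combines with the leading r₁ to
    -- r₁(x_{l-1}, x_l, y)/𝐫_l, while the factors further right are unchanged.
    have ha : blockA ξ (s + 1) (insertPoint x l y) l =
        r₁ ξ (x (l - 1)) (x l) y * (rAt ξ x l * ratioProd ξ s x n)⁻¹ := by
      have he : ¬ Odd (s + 1 - l) := by
        rw [Nat.odd_iff]; omega
      rw [blockA, if_neg he, show (s + 1 - l) / 2 = n + 1 by omega, ratioProd_succ,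
        ratioProd_insert y (by omega), i0, i1, i2,
        show s + 1 + 1 - 2 * (n + 1) = l + 1 by omega, show s + 1 - 2 * (n + 1) = l by omega,
        hr1, hr0, hrl, hral, r₁_eq, invSlope_comm ξ (x (l - 1)) (x l), invSlope_comm ξ (x l)]
      have : invSlope ξ (x (l - 1)) (x l) = invSlope ξ (x l) (x (l - 1)) := invSlope_comm _ _ _
      rw [this] at dab
      field_simp
    have hr := B.rAt_pos hξ h1 hls
    rw [ha, zpow_neg_one_pow_of_odd ho, blockRatio, if_pos ho,
      show (s - l) / 2 = n by omega]
    generalize r₁ ξ (x (l - 1)) (x l) y = ρ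
    have hQ : rAt ξ x l * ratioProd ξ s x n ≠ 0 := (mul_pos hr hP).ne'
    rw [eq_mul_inv_iff_mul_eq₀ hQ, div_eq_mul_inv, mul_comm]
  · obtain ⟨n, hn⟩ : ∃ n, s = l + 2 * (n + 1) := by
      rw [Nat.odd_iff] at ho
      exact ⟨(s - l) / 2 - 1, by omega⟩
    have hP := B.ratioProd_pos hξ (N := n) (by omega)
    have hr := B.rAt_pos hξ h1 hls
    have hr' := B.rAt_pos hξ (l := l + 1) (by omega) (by omega)
    have ha : blockA ξ (s + 1) (insertPoint x l y) l =
        r₁ ξ (x (l - 1)) (x l) y * ratioProd ξ s x (n + 1) := by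
      have he : Odd (s + 1 - l) := by
        rw [Nat.odd_iff]; omega
      have hx2 : rAt ξ (insertPoint x l y) (l + 2) = rAt ξ x (l + 1) := by
        have i4 : insertPoint x l y (l + 3) = x (l + 2) := by
          rw [insertPoint, if_neg (by omega), if_neg (by omega)]; rfl
        rw [rAt_eq, rAt_eq, show l + 2 - 1 = l + 1 by omega, i2, i3, i4, Nat.add_sub_cancel]
      rw [blockA, if_pos he, show (s + 1 - l) / 2 = n + 1 by omega, ratioProd_succ,
        ratioProd_succ ξ s, ratioProd_insert y (by omega), i0, i1, i2,
        show s + 1 + 1 - 2 * (n + 1) = l + 2 by omega, show s + 1 - 2 * (n + 1) = l + 1 by omega,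
        show s - 2 * (n + 1) = l by omega, hr1, hx2, hrl, hral, r₁_eq,
        invSlope_comm ξ y (x (l - 1)), invSlope_comm ξ (x l) (x (l - 1))]
      field_simp
    have hQ := B.ratioProd_pos hξ (N := n + 1) (by omega)
    rw [ha, zpow_neg_one_pow_of_even (Nat.not_odd_iff_even.1 ho), blockRatio, if_neg ho,
      show (s - l) / 2 = n + 1 by omega, div_eq_iff hQ.ne']

end IsBlock

end SphericalSpin

namespace SphericalSpin

/-! ### Tail masses on a block -/

theorem IsStep.invSlope_eq {ξ : ℝ → ℝ} (hξ : IsCubicLike ξ) {a b A E : ℝ}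
    (S : IsStep ξ a b A E) : invSlope ξ a b = A * E := by
  have := sub_pos.2 (hξ.deriv_lt S.nonneg S.lt)
  rw [invSlope, ← S.mean]
  field_simp

/-- Concavity of the tail mass at a point between two steps. -/
theorem IsStep.slope_lt_iff {ξ : ℝ → ℝ} (hξ : IsCubicLike ξ) {a b c A E F : ℝ}
    (S : IsStep ξ a b A E) (T : IsStep ξ b c E F) :
    ((A - E) / (b - a) < (E - F) / (c - b) ↔ r₁ ξ b c a < E / F) ∧
      ((A - E) / (b - a) < (E - F) / (c - b) ↔ r₁ ξ b a c * (A / E) < 1) := by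
  have hA := S.left_pos
  have hE := S.pos
  have hF := T.pos
  have hba : 0 < b - a := sub_pos.2 S.lt
  have hcb : 0 < c - b := sub_pos.2 T.lt
  have hca : 0 < c - a := by linarith
  have hp : deriv ξ b - deriv ξ a = (b - a) / (A * E) := by
    rw [eq_div_iff (by positivity), S.mean]
  have hq : deriv ξ c - deriv ξ b = (c - b) / (E * F) := by
    rw [eq_div_iff (by positivity), T.mean]
  have hac : invSlope ξ a c = (c - a) / ((b - a) / (A * E) + (c - b) / (E * F)) := by
    rw [invSlope, ← hp, ← hq]
    congr 1
    ring
  -- The middle mass E lies above the chord from A to F; the mean conditions turn both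
  -- r₁-inequalities into this one.
  have hcomm : (A - E) / (b - a) < (E - F) / (c - b) ↔
      A * (c - b) + F * (b - a) < E * (c - a) := by
    rw [div_lt_div_iff₀ hba hcb]
    constructor <;> intro h <;> linarith
  have e1 : r₁ ξ b c a = ((b - a) * F + (c - b) * A) / (F * (c - a)) := by
    rw [r₁_eq, invSlope_comm ξ b a, invSlope_comm ξ c a, S.invSlope_eq hξ, hac]
    field_simp
  have e2 : r₁ ξ b a c = ((b - a) * F + (c - b) * A) / (A * (c - a)) := by
    rw [r₁_eq, T.invSlope_eq hξ, hac]
    field_simp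
  rw [hcomm, e1, e2]
  constructor
  · rw [div_lt_div_iff₀ (by positivity) hF]
    constructor <;> intro h <;> nlinarith
  · rw [div_mul_div_comm, div_lt_one (by positivity)]
    constructor <;> intro h <;> nlinarith

/-- `Γ` lists the tail masses at the points of a block, such that the first variation vanishes
together with its integral over each step. -/
structure IsBlockTail (ξ : ℝ → ℝ) (s : ℕ) (x Γ : ℕ → ℝ) : Prop where
  block : IsBlock s x
  step : ∀ l, 1 ≤ l → l ≤ s → IsStep ξ (x (l - 1)) (x l) (Γ (l - 1)) (Γ l)
  h_eq : ∀ l, 1 ≤ l → l ≤ s → h ξ (x (l - 1)) (x l) (Γ (l - 1) / Γ l) = 0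

/-- Optimality in the interior of the steps of a block. -/
def TailNonneg (ξ : ℝ → ℝ) (s : ℕ) (x Γ : ℕ → ℝ) : Prop :=
  ∀ l, 1 ≤ l → l ≤ s → ∀ y ∈ Set.Icc (x (l - 1)) (x l),
    0 ≤ ∫ t in y..x l, stepVariation ξ (x (l - 1)) (x l) (Γ (l - 1)) (Γ l) t

/-- The density increases from step to step. -/
def SlopesIncrease (s : ℕ) (x Γ : ℕ → ℝ) : Prop :=
  ∀ l, 1 ≤ l → l < s →
    (Γ (l - 1) - Γ l) / (x l - x (l - 1)) < (Γ l - Γ (l + 1)) / (x (l + 1) - x l)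

/-- The part of the criterion that concerns a single block, with `*` replaced by `ζ`. -/
structure BlockCriterion (ξ : ℝ → ℝ) (s : ℕ) (x : ℕ → ℝ) (ζ : ℝ) : Prop where
  h_eq : ∀ i, 1 ≤ i → i ≤ s →
    h ξ (x (i - 1)) (x i)
      (r₂ ξ (x (i - 1)) (x i) * (blockF ξ s x i)⁻¹ * ζ ^ ((-1 : ℤ) ^ (s - i))) = 0
  lower : blockY ξ s x ≤ ζ
  upper : ζ * blockZ ξ s x ≤ 1
  strict : ∀ i, 1 ≤ i → i < s → (Odd (s - i) → blockA ξ s x i < ζ) ∧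
    (Even (s - i) → ζ * blockA ξ s x i < 1)
  crit : ∀ i, 1 ≤ i → i ≤ s → ∀ y ∈ Set.Ioo (x (i - 1)) (x i),
    ζ ^ ((-1 : ℤ) ^ (s - i)) = critA ξ s x i y → 0 ≤ h ξ y (x i) (r₁ ξ y (x i) (x (i - 1)))

namespace IsBlockTail

variable {ξ : ℝ → ℝ} {s : ℕ} {x Γ : ℕ → ℝ}

/-- The product of the tail masses of a step is its inverse slope, so neighbouring ratios multiply
to 𝐫_l and `eq_blockRatio` applies. -/
theorem ratio_eq (hξ : IsCubicLike ξ) (T : IsBlockTail ξ s x Γ) :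
    ∀ l, 1 ≤ l → l ≤ s → Γ (l - 1) / Γ l = blockRatio ξ s x (Γ (s - 1) / Γ s) l := by
  refine T.block.eq_blockRatio hξ (z := fun l => Γ (l - 1) / Γ l) (fun l h1 hl => ?_)
    (fun l h1 hl => ?_)
  · exact div_pos (T.step l h1 hl).left_pos (T.step l h1 hl).pos
  · have S := T.step l h1 hl.le
    have S' := T.step (l + 1) (by omega) (by omega)
    have e := S'.invSlope_eq hξ
    have p1 := S.pos
    have p2 := S'.pos
    simp only [Nat.add_sub_cancel] at e p2 ⊢
    rw [rAt_eq, S.invSlope_eq hξ, e]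
    field_simp

theorem last_ratio_pos (T : IsBlockTail ξ s x Γ) (hs : 1 ≤ s) : 0 < Γ (s - 1) / Γ s :=
  div_pos (T.step s hs le_rfl).left_pos (T.step s hs le_rfl).pos

theorem slope_lt_iff_of_odd (hξ : IsCubicLike ξ) (T : IsBlockTail ξ s x Γ) {l : ℕ} (h1 : 1 ≤ l)
    (hl : l < s) (ho : Odd (s - l)) :
    (Γ (l - 1) - Γ l) / (x l - x (l - 1)) < (Γ l - Γ (l + 1)) / (x (l + 1) - x l) ↔
      blockA ξ s x l < Γ (s - 1) / Γ s := by
  have S' := T.step (l + 1) (by omega) (by omega)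
  have e := T.ratio_eq hξ (l + 1) (by omega) (by omega)
  rw [Nat.add_sub_cancel] at S' e
  rw [T.block.blockA_lt_iff hξ _ h1 ho, ← e, ((T.step l h1 hl.le).slope_lt_iff hξ S').1]

theorem slope_lt_iff_of_even (hξ : IsCubicLike ξ) (T : IsBlockTail ξ s x Γ) {l : ℕ} (h1 : 1 ≤ l)
    (hl : l < s) (he : Even (s - l)) :
    (Γ (l - 1) - Γ l) / (x l - x (l - 1)) < (Γ l - Γ (l + 1)) / (x (l + 1) - x l) ↔
      Γ (s - 1) / Γ s * blockA ξ s x l < 1 := by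
  have S' := T.step (l + 1) (by omega) (by omega)
  have e := T.ratio_eq hξ l h1 hl.le
  rw [Nat.add_sub_cancel] at S'
  rw [IsBlock.mul_blockA_lt_iff _ he, ← e, ((T.step l h1 hl.le).slope_lt_iff hξ S').2]

theorem r₂_right_eq (hξ : IsCubicLike ξ) (T : IsBlockTail ξ s x Γ) {l : ℕ} (h1 : 1 ≤ l)
    (hl : l ≤ s) : r₂ ξ (x (l - 1)) (x l) =
      iteratedDeriv 2 ξ (x l) * Γ l ^ 2 * (Γ (l - 1) / Γ l) := by
  have S := T.step l h1 hl
  have := S.pos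
  rw [r₂_eq, S.invSlope_eq hξ]
  field_simp

theorem r₂_left_mul (hξ : IsCubicLike ξ) (T : IsBlockTail ξ s x Γ) {l : ℕ} (hl : l < s) :
    r₂ ξ (x (l + 1)) (x l) * (Γ l / Γ (l + 1)) = iteratedDeriv 2 ξ (x l) * Γ l ^ 2 := by
  have S := T.step (l + 1) (by omega) (by omega)
  have := S.pos
  have e := S.invSlope_eq hξ
  rw [Nat.add_sub_cancel] at e
  rw [r₂_eq, invSlope_comm, e]
  field_simp

/-- On the last step r₂ is ξ''Γ² times the ratio of the masses, so the equality encodes the contact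
with the profile at the right end of the block. -/
theorem last_ratio_eq_iff (hξ : IsCubicLike ξ) (T : IsBlockTail ξ s x Γ) (hs : 1 ≤ s) :
    Γ (s - 1) / Γ s = blockF ξ s x s ↔ iteratedDeriv 2 ξ (x s) * Γ s ^ 2 = 1 := by
  have := T.last_ratio_pos hs
  rw [IsBlock.blockF_last hs, T.r₂_right_eq hξ hs le_rfl, eq_comm, mul_eq_right₀ this.ne']

theorem first_eq_iff (hξ : IsCubicLike ξ) (T : IsBlockTail ξ s x Γ) (hs : 1 ≤ s) :
    blockF ξ s x 0 = (Γ (s - 1) / Γ s) ^ ((-1 : ℤ) ^ s) ↔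
      iteratedDeriv 2 ξ (x 0) * Γ 0 ^ 2 = 1 := by
  rw [T.block.blockF_zero_eq_iff hξ hs (T.last_ratio_pos hs), ← T.ratio_eq hξ 1 le_rfl hs,
    ← T.r₂_left_mul hξ (l := 0) hs]

theorem second_order (hξ : IsCubicLike ξ) (T : IsBlockTail ξ s x Γ)
    (hnn : TailNonneg ξ s x Γ) (hs : 1 ≤ s) {l : ℕ} (hl : l ≤ s) :
    iteratedDeriv 2 ξ (x l) * Γ l ^ 2 ≤ 1 := by
  rcases Nat.eq_zero_or_pos l with rfl | h1
  · exact (T.step 1 le_rfl hs).second_order_left hξ (hnn 1 le_rfl hs) (T.h_eq 1 le_rfl hs)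
  · exact (T.step l h1 hl).second_order_right hξ (hnn l h1 hl)

/-- Every number in the two suprema has a meaning: an ℱ bounds ξ''Γ² by 1 at a block point, an 𝒜
compares the heights of neighbouring steps. The bounds are therefore checked one element at a time.
-/
theorem blockCriterion (hξ : IsCubicLike ξ) (T : IsBlockTail ξ s x Γ) (hs : 1 ≤ s)
    (hnn : TailNonneg ξ s x Γ) (hsl : SlopesIncrease s x Γ) :
    BlockCriterion ξ s x (Γ (s - 1) / Γ s) := by
  have hζ := T.last_ratio_pos hs
  have hA : ∀ i, 1 ≤ i → i < s → (Odd (s - i) → blockA ξ s x i < Γ (s - 1) / Γ s) ∧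
      (Even (s - i) → Γ (s - 1) / Γ s * blockA ξ s x i < 1) := fun i h1 hi =>
    ⟨fun ho => (T.slope_lt_iff_of_odd hξ h1 hi ho).1 (hsl i h1 hi),
      fun he => (T.slope_lt_iff_of_even hξ h1 hi he).1 (hsl i h1 hi)⟩
  refine ⟨fun i h1 hi => ?_, ?_, ?_, hA, fun i h1 hi y hy heq => ?_⟩
  · rw [T.block.h_arg_eq hξ _ h1 hi, ← T.ratio_eq hξ i h1 hi]
    exact T.h_eq i h1 hi
  · refine csSup_le ⟨_, Or.inl ⟨s, le_rfl, by simp, rfl⟩⟩ ?_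
    rintro v (⟨l, hl, he, rfl⟩ | ⟨l, h1, hl, ho, rfl⟩)
    · have h2 := T.second_order hξ hnn hs hl
      rcases Nat.eq_zero_or_pos l with rfl | h1
      · rw [IsBlock.blockF_zero_le_iff hs he hζ, ← T.ratio_eq hξ 1 le_rfl hs]
        rw [← T.r₂_left_mul hξ (l := 0) hs] at h2
        exact h2
      · rw [T.block.blockF_le_iff hξ _ h1 hl he, ← T.ratio_eq hξ l h1 hl, T.r₂_right_eq hξ h1 hl]
        exact mul_le_of_le_one_left
          (div_pos (T.step l h1 hl).left_pos (T.step l h1 hl).pos).le h2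
    · exact ((hA l h1 hl).1 ho).le
  · rw [← le_div_iff₀' hζ]
    refine csSup_le ⟨_, Or.inl ⟨s - 1, by omega, by rw [Nat.sub_sub_self hs]; simp, rfl⟩⟩ ?_
    rintro v (⟨l, hl, ho, rfl⟩ | ⟨l, h1, hl, he, rfl⟩)
    · have hls : l < s := by
        rcases hl.eq_or_lt with rfl | h
        · simp at ho
        · exact h
      have e := T.ratio_eq hξ (l + 1) (by omega) (by omega)
      rw [Nat.add_sub_cancel] at e
      rw [le_div_iff₀' hζ, IsBlock.mul_blockF_le_iff _ ho, ← e, T.r₂_left_mul hξ hls]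
      exact T.second_order hξ hnn hs hl
    · rw [le_div_iff₀' hζ]
      exact ((hA l h1 hl).2 he).le
  · rw [T.block.eq_critA_iff hξ _ h1 hi hy, ← T.ratio_eq hξ i h1 hi] at heq
    have S := T.step i h1 hi
    have hc := S.stepVariation_eq_zero_iff hξ hy
    have h0 := hc.1.2 heq
    rw [← hc.2 h0, ← S.integral_stepVariation hξ ⟨hy.1.le, hy.2⟩ h0]
    exact hnn i h1 hi y (Set.Ioo_subset_Icc_self hy)

end IsBlockTail

/-- The points prescribe the products and ζ prescribes the ratios of consecutive masses. The
h-equations make every ratio exceed 1, and the sign of the tail integrals reduces to the critical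
points. -/
theorem BlockCriterion.exists_tail {ξ : ℝ → ℝ} (hξ : IsCubicLike ξ) {s : ℕ} {x : ℕ → ℝ} {ζ : ℝ}
    (C : BlockCriterion ξ s x ζ) (B : IsBlock s x) (hs : 1 ≤ s) (hζ : 0 < ζ) :
    ∃ Γ : ℕ → ℝ, IsBlockTail ξ s x Γ ∧ Γ (s - 1) / Γ s = ζ ∧ TailNonneg ξ s x Γ ∧
      SlopesIncrease s x Γ := by
  set D : ℕ → ℝ := fun l => invSlope ξ (x (l - 1)) (x l) with hD
  set z : ℕ → ℝ := fun l => blockRatio ξ s x ζ l with hz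
  have hDpos : ∀ l, 1 ≤ l → l ≤ s → 0 < D l := fun l h1 hl => B.invSlope_pos hξ h1 hl
  have hzpos : ∀ l, 1 ≤ l → l ≤ s → 0 < z l := fun l h1 hl => B.blockRatio_pos hξ hζ h1 hl
  -- The solution of Γ_{l-1}Γ_l = D_l and Γ_{l-1}/Γ_l = z_l; index 0 is the left end of the first
  -- step only.
  set Γ : ℕ → ℝ := fun l => if l = 0 then √(D 1 * z 1) else √(D l / z l) with hΓ
  -- The masses computed from the two steps that meet at a point agree because z_k z_{k+1} =
  -- D_k/D_{k+1}.
  have hprev : ∀ l, 1 ≤ l → l ≤ s → Γ (l - 1) = √(D l * z l) := by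
    intro l h1 hl
    rcases h1.eq_or_lt with rfl | h1'
    · simp [hΓ]
    · obtain ⟨k, rfl⟩ : ∃ k, l = k + 1 := ⟨l - 1, by omega⟩
      have hmul := B.blockRatio_mul hξ hζ (l := k) (by omega) (by omega)
      have p1 := hzpos k (by omega) (by omega)
      have p2 := hDpos (k + 1) (by omega) (by omega)
      have : rAt ξ x k = D k / D (k + 1) := rAt_eq ξ x k
      rw [this, eq_div_iff p2.ne'] at hmul
      simp only [hΓ, Nat.add_sub_cancel]
      rw [if_neg (by omega), ← hmul]
      congr 1
      change z k * z (k + 1) * D (k + 1) / z k = _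
      field_simp
  have hcur : ∀ l, 1 ≤ l → Γ l = √(D l / z l) := fun l h1 => by
    simp only [hΓ]; rw [if_neg (by omega)]
  have hratio : ∀ l, 1 ≤ l → l ≤ s → Γ (l - 1) / Γ l = z l := by
    intro l h1 hl
    have p1 := hzpos l h1 hl
    have p2 := hDpos l h1 hl
    rw [hprev l h1 hl, hcur l h1, ← Real.sqrt_div (by positivity)]
    rw [show D l * z l / (D l / z l) = z l ^ 2 by field_simp]
    exact Real.sqrt_sq p1.le
  have hprod : ∀ l, 1 ≤ l → l ≤ s → Γ (l - 1) * Γ l = D l := by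
    intro l h1 hl
    have p1 := hzpos l h1 hl
    have p2 := hDpos l h1 hl
    rw [hprev l h1 hl, hcur l h1, ← Real.sqrt_mul (by positivity)]
    rw [show D l * z l * (D l / z l) = D l ^ 2 by field_simp]
    exact Real.sqrt_sq p2.le
  have hh : ∀ l, 1 ≤ l → l ≤ s → h ξ (x (l - 1)) (x l) (z l) = 0 := by
    intro l h1 hl
    have := C.h_eq l h1 hl
    rwa [B.h_arg_eq hξ _ h1 hl] at this
  have T : IsBlockTail ξ s x Γ := by
    refine ⟨B, fun l h1 hl => ?_, fun l h1 hl => ?_⟩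
    · have hlt := B.lt' h1 hl
      have h0 := B.nonneg (l - 1) (by omega)
      have p1 := hzpos l h1 hl
      have p2 := hDpos l h1 hl
      have hpos : 0 < Γ l := by
        rw [hcur l h1]; positivity
      refine ⟨h0, hlt, hpos, ?_, ?_⟩
      · have := one_lt_of_h_eq_zero hξ h0 hlt p1 (hh l h1 hl)
        rw [← hratio l h1 hl, one_lt_div hpos] at this
        exact this
      · rw [hprod l h1 hl]
        have := sub_pos.2 (hξ.deriv_lt h0 hlt)
        simp only [hD, invSlope]
        field_simp
    · rw [hratio l h1 hl]
      exact hh l h1 hl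
  have hlast : Γ (s - 1) / Γ s = ζ := by
    rw [hratio s hs le_rfl]
    exact IsBlock.blockRatio_last ζ
  refine ⟨Γ, T, hlast, fun l h1 hl => ?_, fun l h1 hl => ?_⟩
  · refine (T.step l h1 hl).integral_nonneg hξ (T.h_eq l h1 hl) fun y hy heq => ?_
    refine C.crit l h1 hl y hy ?_
    rw [B.eq_critA_iff hξ _ h1 hl hy, ← heq, hratio l h1 hl]
  · rcases Nat.even_or_odd (s - l) with he | ho
    · rw [T.slope_lt_iff_of_even hξ h1 hl he, hlast]
      exact (C.strict l h1 hl).2 he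
    · rw [T.slope_lt_iff_of_odd hξ h1 hl ho, hlast]
      exact (C.strict l h1 hl).1 ho

end SphericalSpin

namespace SphericalSpin

/-! ### Geometry of the block points -/

namespace BlockPoints

variable (B : BlockPoints)

theorem q_le {j i i' : ℕ} (hj : j < B.t) (h : i ≤ i') (hi : i' ≤ B.s j) : B.q j i ≤ B.q j i' := by
  induction i', h using Nat.le_induction with
  | base => exact le_rfl
  | succ k _ ih => exact (ih (by omega)).trans (B.lt_step j hj k (by omega)).le

theorem last_lt_first {j j' : ℕ} (h : j < j') (hj' : j' < B.t) :
    B.q j (B.s j) < B.q j' 0 := by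
  induction j', h using Nat.le_induction with
  | base => exact B.lt_gap j hj'
  | succ k hk ih =>
    exact ((ih (by omega)).trans_le (B.q_le (by omega) (Nat.zero_le _) le_rfl)).trans
      (B.lt_gap k hj')

theorem last_le_last {j j' : ℕ} (h : j ≤ j') (hj' : j' < B.t) :
    B.q j (B.s j) ≤ B.q j' (B.s j') := by
  rcases h.eq_or_lt with rfl | h
  · exact le_rfl
  · exact (B.last_lt_first h hj').le.trans (B.q_le hj' (Nat.zero_le _) le_rfl)

theorem first_le_first {j j' : ℕ} (h : j ≤ j') (hj' : j' < B.t) :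
    B.q j 0 ≤ B.q j' 0 := by
  rcases h.eq_or_lt with rfl | h
  · exact le_rfl
  · exact (B.q_le (h.trans hj') (Nat.zero_le _) le_rfl).trans (B.last_lt_first h hj').le

theorem t_pos : 0 < B.t := by have := B.two_le; omega

theorem q_mem {j i : ℕ} (hj : j < B.t) (hi : i ≤ B.s j) : B.q j i ∈ Set.Icc (0 : ℝ) 1 := by
  constructor
  · rw [← B.first_eq]
    exact (B.first_le_first (Nat.zero_le j) hj).trans (B.q_le hj (Nat.zero_le _) hi)
  · have := B.t_pos
    rw [← B.last_eq]
    exact (B.q_le hj hi le_rfl).trans (B.last_le_last (by omega) (by omega))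

theorem first_pos {j : ℕ} (h0 : 0 < j) (hj : j < B.t) : 0 < B.q j 0 :=
  (B.q_mem B.t_pos le_rfl).1.trans_lt (B.last_lt_first h0 hj)

/-- Induction along the block points, from left to right. -/
theorem chain {C : ℕ → ℕ → Prop} (h0 : C 0 0)
    (hstep : ∀ j < B.t, ∀ i < B.s j, C j i → C j (i + 1))
    (hgap : ∀ j, j + 1 < B.t → C j (B.s j) → C (j + 1) 0) :
    ∀ j < B.t, ∀ i ≤ B.s j, C j i := by
  have hin : ∀ j < B.t, C j 0 → ∀ i ≤ B.s j, C j i := by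
    intro j hj hj0 i
    induction i with
    | zero => exact fun _ => hj0
    | succ i ih => exact fun hi => hstep j hj i (by omega) (ih (by omega))
  intro j
  induction j with
  | zero => exact fun hj => hin 0 hj h0
  | succ j ih => exact fun hj => hin _ hj (hgap j hj (ih (by omega) _ le_rfl))

theorem chain_one {C : ℝ → Prop} (h0 : C 0)
    (hstep : ∀ j < B.t, ∀ i < B.s j, C (B.q j i) → C (B.q j (i + 1)))
    (hgap : ∀ j, j + 1 < B.t → C (B.q j (B.s j)) → C (B.q (j + 1) 0)) : C 1 := by
  have := B.t_pos
  rw [← B.last_eq]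
  exact B.chain (C := fun j i => C (B.q j i)) (by rwa [B.first_eq]) hstep hgap _ (by omega) _ le_rfl

/-- Every point of `[0,1)` lies in a step or in a smooth interval. -/
theorem cover {x : ℝ} (hx : x ∈ Set.Ico (0 : ℝ) 1) :
    (∃ j < B.t, ∃ i < B.s j, x ∈ Set.Ico (B.q j i) (B.q j (i + 1))) ∨
      ∃ j, j + 1 < B.t ∧ x ∈ Set.Ico (B.q j (B.s j)) (B.q (j + 1) 0) := by
  refine B.chain_one (C := fun c => ∀ x ∈ Set.Ico 0 c,
    (∃ j < B.t, ∃ i < B.s j, x ∈ Set.Ico (B.q j i) (B.q j (i + 1))) ∨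
      ∃ j, j + 1 < B.t ∧ x ∈ Set.Ico (B.q j (B.s j)) (B.q (j + 1) 0)) ?_ ?_ ?_ x hx
  · intro x hx
    exact absurd hx.2 hx.1.not_gt
  · intro j hj i hi ih x hx
    rcases lt_or_ge x (B.q j i) with h | h
    · exact ih x ⟨hx.1, h⟩
    · exact Or.inl ⟨j, hj, i, hi, h, hx.2⟩
  · intro j hj ih x hx
    rcases lt_or_ge x (B.q j (B.s j)) with h | h
    · exact ih x ⟨hx.1, h⟩
    · exact Or.inr ⟨j, hj, h, hx.2⟩

theorem step_unique {x : ℝ} {j i j' i' : ℕ} (hj : j < B.t) (hi : i < B.s j) (hj' : j' < B.t)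
    (hi' : i' < B.s j') (hx : x ∈ Set.Ico (B.q j i) (B.q j (i + 1)))
    (hx' : x ∈ Set.Ico (B.q j' i') (B.q j' (i' + 1))) : j = j' ∧ i = i' := by
  have aux : ∀ j i j' i', j < B.t → i < B.s j → j' < B.t → i' < B.s j' →
      x ∈ Set.Ico (B.q j i) (B.q j (i + 1)) → x ∈ Set.Ico (B.q j' i') (B.q j' (i' + 1)) →
      ¬ j < j' := by
    intro j i j' i' hj hi hj' hi' hx hx' hlt
    have h1 := B.q_le hj (show i + 1 ≤ B.s j by omega) le_rfl
    have h2 := B.last_lt_first hlt hj'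
    have h3 := B.q_le hj' (Nat.zero_le i') hi'.le
    linarith [hx.2, hx'.1]
  have aux2 : ∀ i i', i < B.s j → i' < B.s j →
      x ∈ Set.Ico (B.q j i) (B.q j (i + 1)) → x ∈ Set.Ico (B.q j i') (B.q j (i' + 1)) →
      ¬ i < i' := by
    intro i i' hi hi' hx hx' hlt
    have h1 := B.q_le hj (show i + 1 ≤ i' by omega) hi'.le
    linarith [hx.2, hx'.1]
  have e : j = j' := le_antisymm (not_lt.1 (aux j' i' j i hj' hi' hj hi hx' hx))
    (not_lt.1 (aux j i j' i' hj hi hj' hi' hx hx'))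
  subst e
  exact ⟨rfl, le_antisymm (not_lt.1 (aux2 i' i hi' hi hx' hx)) (not_lt.1 (aux2 i i' hi hi' hx hx'))⟩

theorem step_gap_disjoint {x : ℝ} {j i j' : ℕ} (hj : j < B.t) (hi : i < B.s j)
    (hj' : j' + 1 < B.t) (hx : x ∈ Set.Ico (B.q j i) (B.q j (i + 1)))
    (hx' : x ∈ Set.Ico (B.q j' (B.s j')) (B.q (j' + 1) 0)) : False := by
  rcases le_or_gt j j' with h | h
  · have h1 := B.q_le hj (show i + 1 ≤ B.s j by omega) le_rfl
    have h2 := B.last_le_last h (by omega)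
    linarith [hx.2, hx'.1]
  · have h1 := B.q_le hj (Nat.zero_le i) hi.le
    have h2 := B.first_le_first (show j' + 1 ≤ j from h) hj
    linarith [hx.1, hx'.2]

theorem gap_unique {x : ℝ} {j j' : ℕ} (hj : j + 1 < B.t) (hj' : j' + 1 < B.t)
    (hx : x ∈ Set.Ico (B.q j (B.s j)) (B.q (j + 1) 0))
    (hx' : x ∈ Set.Ico (B.q j' (B.s j')) (B.q (j' + 1) 0)) : j = j' := by
  have aux : ∀ j j', j + 1 < B.t → j' + 1 < B.t →
      x ∈ Set.Ico (B.q j (B.s j)) (B.q (j + 1) 0) →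
      x ∈ Set.Ico (B.q j' (B.s j')) (B.q (j' + 1) 0) → ¬ j < j' := by
    intro j j' _ hj' hx hx' hlt
    have h1 := B.first_le_first (show j + 1 ≤ j' from hlt) (by omega)
    have h2 := B.q_le (j := j') (by omega) (Nat.zero_le _) le_rfl
    linarith [hx.2, hx'.1]
  exact le_antisymm (not_lt.1 (aux j' j hj' hj hx' hx)) (not_lt.1 (aux j j' hj hj' hx hx'))

theorem density_step (m : ℕ → ℝ) (ω : ℝ → ℝ) {x : ℝ} {j i : ℕ} (hj : j < B.t) (hi : i < B.s j)
    (hx : x ∈ Set.Ico (B.q j i) (B.q j (i + 1))) :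
    B.density m ω x = m (B.w j + (i + 1)) := by
  rw [density, Finset.sum_eq_single j, Finset.sum_eq_single (i + 1),
    Finset.sum_eq_zero (s := Finset.range (B.t - 1)), add_zero, Set.indicator_of_mem]
  · simpa using hx
  · intro j' hj'
    rw [Finset.mem_range] at hj'
    exact Set.indicator_of_notMem (fun hx' => B.step_gap_disjoint hj hi (by omega) hx hx') _
  · intro i' hi' hne
    rw [Finset.mem_Icc] at hi'
    refine Set.indicator_of_notMem (fun hx' => hne ?_) _
    obtain ⟨k, rfl⟩ : ∃ k, i' = k + 1 := ⟨i' - 1, by omega⟩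
    rw [Nat.add_sub_cancel] at hx'
    rw [(B.step_unique hj hi hj (by omega) hx hx').2]
  · intro h
    exact absurd (Finset.mem_Icc.2 ⟨by omega, by omega⟩) h
  · intro j' hj' hne
    rw [Finset.mem_range] at hj'
    refine Finset.sum_eq_zero fun i' hi' => ?_
    rw [Finset.mem_Icc] at hi'
    refine Set.indicator_of_notMem (fun hx' => hne ?_) _
    obtain ⟨k, rfl⟩ : ∃ k, i' = k + 1 := ⟨i' - 1, by omega⟩
    rw [Nat.add_sub_cancel] at hx'
    exact (B.step_unique hj hi hj' (by omega) hx hx').1.symm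
  · intro h
    exact absurd (Finset.mem_range.2 hj) h

theorem density_gap (m : ℕ → ℝ) (ω : ℝ → ℝ) {x : ℝ} {j : ℕ} (hj : j + 1 < B.t)
    (hx : x ∈ Set.Ico (B.q j (B.s j)) (B.q (j + 1) 0)) : B.density m ω x = ω x := by
  rw [density, Finset.sum_eq_zero, zero_add, Finset.sum_eq_single j, Set.indicator_of_mem hx]
  · intro j' hj' hne
    rw [Finset.mem_range] at hj'
    exact Set.indicator_of_notMem (fun hx' => hne (B.gap_unique hj (by omega) hx hx').symm) _
  · intro h
    exact absurd (Finset.mem_range.2 (by omega)) h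
  · intro j' hj'
    rw [Finset.mem_range] at hj'
    refine Finset.sum_eq_zero fun i' hi' => ?_
    rw [Finset.mem_Icc] at hi'
    refine Set.indicator_of_notMem (fun hx' => ?_) _
    obtain ⟨k, rfl⟩ : ∃ k, i' = k + 1 := ⟨i' - 1, by omega⟩
    rw [Nat.add_sub_cancel] at hx'
    exact B.step_gap_disjoint hj' (by omega) hj hx' hx

theorem density_of_notMem (m : ℕ → ℝ) (ω : ℝ → ℝ) {x : ℝ} (hx : x ∉ Set.Ico (0 : ℝ) 1) :
    B.density m ω x = 0 := by
  have aux : ∀ {j i j' i'}, j < B.t → i ≤ B.s j → j' < B.t → i' ≤ B.s j' →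
      x ∉ Set.Ico (B.q j i) (B.q j' i') := fun hj hi hj' hi' hx' =>
    hx ⟨(B.q_mem hj hi).1.trans hx'.1, hx'.2.trans_le (B.q_mem hj' hi').2⟩
  rw [density, Finset.sum_eq_zero, Finset.sum_eq_zero, add_zero]
  · intro j hj
    rw [Finset.mem_range] at hj
    exact Set.indicator_of_notMem (aux (by omega) le_rfl (by omega) (Nat.zero_le _)) _
  · intro j hj
    rw [Finset.mem_range] at hj
    refine Finset.sum_eq_zero fun i hi => ?_
    rw [Finset.mem_Icc] at hi
    exact Set.indicator_of_notMem (aux hj (by omega) hj (by omega)) _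

theorem withDensity_density (m : ℕ → ℝ) (ω : ℝ → ℝ) (Δ : ℝ) :
    volume.withDensity (fun x => ENNReal.ofReal (B.density m ω x))
      + ENNReal.ofReal Δ • Measure.dirac 1 = densityMeasure (B.density m ω) Δ := by
  rw [densityMeasure, ← withDensity_indicator measurableSet_Ico]
  congr 2
  ext x
  by_cases hx : x ∈ Set.Ico (0 : ℝ) 1
  · rw [Set.indicator_of_mem hx]
  · rw [Set.indicator_of_notMem hx, B.density_of_notMem m ω hx, ENNReal.ofReal_zero]

theorem measurable_density (m : ℕ → ℝ) {ω : ℝ → ℝ} (hω : MonotoneOn ω B.smoothSet) :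
    AEMeasurable (B.density m ω) volume := by
  have : B.density m ω = fun x =>
      (∑ j ∈ Finset.range B.t, ∑ i ∈ Finset.Icc 1 (B.s j),
        (Set.Ico (B.q j (i - 1)) (B.q j i)).indicator (fun _ => m (B.w j + i)) x)
      + ∑ j ∈ Finset.range (B.t - 1),
        (Set.Ico (B.q j (B.s j)) (B.q (j + 1) 0)).indicator ω x := rfl
  rw [this]
  refine AEMeasurable.add ?_ ?_
  · refine Finset.aemeasurable_fun_sum _ fun j _ => Finset.aemeasurable_fun_sum _ fun i _ => ?_
    exact (measurable_const.indicator measurableSet_Ico).aemeasurable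
  · refine Finset.aemeasurable_fun_sum _ fun j hj => ?_
    rw [Finset.mem_range] at hj
    rw [aemeasurable_indicator_iff measurableSet_Ico]
    exact aemeasurable_restrict_of_monotoneOn measurableSet_Ico
      (hω.mono fun x hx => ⟨j, by omega, hx⟩)

/-! ### Numbering of the steps -/

theorem w_succ (j : ℕ) : B.w (j + 1) = B.w j + B.s j := Finset.sum_range_succ _ _

theorem w_mono : Monotone B.w := monotone_nat_of_le_succ fun j => by rw [w_succ]; omega

theorem index_lt {j i j' i' : ℕ} (hi : i ≤ B.s j) (hi' : 1 ≤ i')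
    (h : j < j') : B.w j + i < B.w j' + i' := by
  have h1 := B.w_mono (show j + 1 ≤ j' from h)
  rw [w_succ] at h1
  omega

theorem index_mem {j i : ℕ} (hj : j < B.t) (h1 : 1 ≤ i) (hi : i ≤ B.s j) :
    B.w j + i ∈ Set.Icc 1 B.k := by
  have := B.w_mono (show j + 1 ≤ B.t from hj)
  rw [w_succ] at this
  rw [k]
  exact ⟨by omega, by omega⟩

theorem exists_index {l : ℕ} (hl : l ∈ Set.Icc 1 B.k) :
    ∃ j < B.t, ∃ i, 1 ≤ i ∧ i ≤ B.s j ∧ l = B.w j + i := by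
  have key : ∀ T l, 1 ≤ l → l ≤ B.w T → ∃ j < T, ∃ i, 1 ≤ i ∧ i ≤ B.s j ∧ l = B.w j + i := by
    intro T
    induction T with
    | zero =>
      intro l h1 hl
      simp [w] at hl
      omega
    | succ T ih =>
      intro l h1 hl
      rcases le_or_gt l (B.w T) with h | h
      · obtain ⟨j, hj, r⟩ := ih l h1 h
        exact ⟨j, by omega, r⟩
      · rw [w_succ] at hl
        exact ⟨T, by omega, l - B.w T, by omega, by omega, by omega⟩
  exact key B.t l hl.1 hl.2

/-- The pair (j, i) with 1 ≤ i ≤ s_j is determined by the running index w_j + i, so any chosen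
representation returns the prescribed value. -/
theorem exists_numbering (σ : ℕ → ℕ → ℝ) :
    ∃ m : ℕ → ℝ, ∀ j < B.t, ∀ i, 1 ≤ i → i ≤ B.s j → m (B.w j + i) = σ j i := by
  classical
  refine ⟨fun l => if hl : l ∈ Set.Icc 1 B.k then
    σ (B.exists_index hl).choose (B.exists_index hl).choose_spec.2.choose else 0, ?_⟩
  intro j hj i h1 hi
  have hl := B.index_mem hj h1 hi
  simp only [hl, dif_pos]
  obtain ⟨g1, g2, g3⟩ := (B.exists_index hl).choose_spec.2.choose_spec
  generalize (B.exists_index hl).choose_spec.2.choose = i' at g1 g2 g3 ⊢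
  generalize (B.exists_index hl).choose = j' at g1 g2 g3 ⊢
  have e : j' = j := by
    rcases lt_trichotomy j j' with h | h | h
    · have := B.index_lt hi g1 h
      omega
    · exact h.symm
    · have := B.index_lt g2 h1 h
      omega
  subst e
  rw [show i' = i by omega]

end BlockPoints

end SphericalSpin

namespace SphericalSpin

/-! ### The first variation on steps and on smooth intervals -/

namespace Admissible

variable {ξ γ : ℝ → ℝ} {Δ a b M : ℝ}

theorem tailMass_sub_of_const (h : Admissible γ Δ) (ha : 0 ≤ a) (hb : b ≤ 1)
    (hM : ∀ x ∈ Set.Ico a b, γ x = M) {x : ℝ} (hx : x ∈ Set.Icc a b) :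
    tailMass γ Δ x = tailMass γ Δ b + M * (b - x) := by
  rw [h.tailMass_sub ⟨ha.trans hx.1, hx.2.trans hb⟩ ⟨(ha.trans hx.1).trans hx.2, hb⟩]
  congr 1
  have : ∫ t in x..b, γ t = ∫ t in x..b, M := by
    rw [intervalIntegral.integral_of_le hx.2, intervalIntegral.integral_of_le hx.2,
      integral_Ioc_eq_integral_Ioo, integral_Ioc_eq_integral_Ioo]
    exact setIntegral_congr_fun measurableSet_Ioo fun t ht => hM t ⟨hx.1.trans ht.1.le, ht.2⟩
  rw [this, intervalIntegral.integral_const, smul_eq_mul, mul_comm]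

theorem slope_of_const (h : Admissible γ Δ) (ha : 0 ≤ a) (hab : a < b) (hb : b ≤ 1)
    (hM : ∀ x ∈ Set.Ico a b, γ x = M) :
    (tailMass γ Δ a - tailMass γ Δ b) / (b - a) = M := by
  have := sub_pos.2 hab
  rw [h.tailMass_sub_of_const ha hb hM (Set.left_mem_Icc.2 hab.le)]
  field_simp
  ring

theorem tailMass_eq_affineTail (h : Admissible γ Δ) (ha : 0 ≤ a) (hab : a < b) (hb : b ≤ 1)
    (hM : ∀ x ∈ Set.Ico a b, γ x = M) {x : ℝ} (hx : x ∈ Set.Icc a b) :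
    tailMass γ Δ x = affineTail a b (tailMass γ Δ a) (tailMass γ Δ b) x := by
  rw [affineTail, h.slope_of_const ha hab hb hM, h.tailMass_sub_of_const ha hb hM hx]

theorem variation_eq_stepVariation (h : Admissible γ Δ) (ha : 0 ≤ a) (hab : a < b) (hb : b ≤ 1)
    (hM : ∀ x ∈ Set.Ico a b, γ x = M) (hM0 : 0 < M) {x : ℝ} (hx : x ∈ Set.Icc a b) :
    variation ξ γ Δ x = variation ξ γ Δ a +
      stepVariation ξ a b (tailMass γ Δ a) (tailMass γ Δ b) x := by
  have ha' : a ∈ Set.Icc (0 : ℝ) 1 := ⟨ha, hab.le.trans hb⟩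
  have hb' : b ∈ Set.Icc (0 : ℝ) 1 := ⟨ha.trans hab.le, hb⟩
  have e := h.variation_sub (ξ := ξ) ha' ⟨ha.trans hx.1, hx.2.trans hb⟩
  have hlt : tailMass γ Δ b < tailMass γ Δ a := by
    rw [h.tailMass_sub_of_const ha hb hM (Set.left_mem_Icc.2 hab.le)]
    have := mul_pos hM0 (sub_pos.2 hab)
    linarith
  have e2 : ∫ t in a..x, (tailMass γ Δ t ^ 2)⁻¹ =
      (x - a) / (tailMass γ Δ a * affineTail a b (tailMass γ Δ a) (tailMass γ Δ b) x) := by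
    rw [← integral_inv_sq_affineTail hab (h.tailMass_pos hb') hlt hx]
    refine intervalIntegral.integral_congr fun t ht => ?_
    rw [Set.uIcc_of_le hx.1] at ht
    simp only [h.tailMass_eq_affineTail ha hab hb hM ⟨ht.1, ht.2.trans hx.2⟩]
  rw [e2] at e
  rw [stepVariation]
  linarith

/-- On an interval on which the tail mass is the profile, the first variation is constant. -/
theorem variation_eq_of_profile (hξ : IsCubicLike ξ) (h : Admissible γ Δ) (ha : 0 < a)
    (hb : b ≤ 1) (hp : ∀ x ∈ Set.Icc a b, tailMass γ Δ x = profile ξ x) {x : ℝ}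
    (hx : x ∈ Set.Icc a b) : variation ξ γ Δ x = variation ξ γ Δ a := by
  have hab := hx.1.trans hx.2
  have e := h.variation_sub (ξ := ξ) (x := a) (y := x) ⟨ha.le, hab.trans hb⟩
    ⟨ha.le.trans hx.1, hx.2.trans hb⟩
  have e2 : ∫ t in a..x, (tailMass γ Δ t ^ 2)⁻¹ = ∫ t in a..x, iteratedDeriv 2 ξ t := by
    refine intervalIntegral.integral_congr fun t ht => ?_
    rw [Set.uIcc_of_le hx.1] at ht
    rw [hp t ⟨ht.1, ht.2.trans hx.2⟩]
    exact (eq_inv_of_mul_eq_one_left (hξ.deriv2_mul_profile_sq (ha.trans_le ht.1))).symm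
  rw [e2, intervalIntegral.integral_eq_sub_of_hasDerivAt (fun t _ => hξ.hasDerivAt_deriv t)
    (hξ.continuous_deriv2.intervalIntegrable _ _)] at e
  linarith

end Admissible

/-- A measure of the form `densityMeasure` determines its density. -/
theorem ae_eq_of_densityMeasure_eq {γ γ' : ℝ → ℝ} {Δ Δ' : ℝ}
    (hm : AEMeasurable γ (volume.restrict (Set.Ico (0 : ℝ) 1)))
    (hm' : AEMeasurable γ' (volume.restrict (Set.Ico (0 : ℝ) 1)))
    (h0 : ∀ x ∈ Set.Ico (0 : ℝ) 1, 0 ≤ γ x) (h0' : ∀ x ∈ Set.Ico (0 : ℝ) 1, 0 ≤ γ' x)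
    (heq : densityMeasure γ Δ = densityMeasure γ' Δ') :
    ∀ᵐ x, x ∈ Set.Ico (0 : ℝ) 1 → γ x = γ' x := by
  have hres : ∀ (w : ℝ → ℝ) (D : ℝ), (densityMeasure w D).restrict (Set.Ico 0 1) =
      (volume.restrict (Set.Ico (0 : ℝ) 1)).withDensity (fun x => ENNReal.ofReal (w x)) := by
    intro w D
    rw [densityMeasure, Measure.restrict_add, Measure.restrict_smul,
      restrict_withDensity measurableSet_Ico, Measure.restrict_restrict measurableSet_Ico,
      Set.inter_self, Measure.restrict_eq_zero (μ := Measure.dirac (1 : ℝ)) |>.2 (by simp),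
        smul_zero, add_zero]
  have := congrArg (fun μ => μ.restrict (Set.Ico (0 : ℝ) 1)) heq
  simp only [hres] at this
  rw [withDensity_eq_iff_of_sigmaFinite hm.ennreal_ofReal hm'.ennreal_ofReal] at this
  have h2 := (ae_restrict_iff' measurableSet_Ico).1 this
  filter_upwards [h2] with x hx hmem
  exact (ENNReal.ofReal_eq_ofReal_iff (h0 x hmem) (h0' x hmem)).1 (hx hmem)

end SphericalSpin

namespace SphericalSpin

/-! ### Necessity of the criterion -/

variable {ξ γ : ℝ → ℝ} {Δ : ℝ} {B : BlockPoints}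

/-- A density that is constant on the steps, with increasing values in each block, and strictly
increasing on the smooth intervals. -/
structure HasBlockForm (γ : ℝ → ℝ) (B : BlockPoints) (σ : ℕ → ℕ → ℝ) : Prop where
  step : ∀ j < B.t, ∀ i < B.s j, ∀ x ∈ Set.Ico (B.q j i) (B.q j (i + 1)), γ x = σ j i
  step_pos : ∀ j < B.t, ∀ i < B.s j, 0 < σ j i
  step_lt : ∀ j < B.t, ∀ i, i + 1 < B.s j → σ j i < σ j (i + 1)
  gap : ∀ j, j + 1 < B.t → StrictMonoOn γ (Set.Ico (B.q j (B.s j)) (B.q (j + 1) 0))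

theorem exists_mem_Ioo_of_ae {P : ℝ → Prop} (hP : ∀ᵐ x, P x) {a b : ℝ} (hab : a < b) :
    ∃ x ∈ Set.Ioo a b, P x := by
  have hne : volume (Set.Ioo a b) ≠ 0 := by
    rw [Real.volume_Ioo]
    simpa using hab
  obtain ⟨x, hx, hPx⟩ := (Filter.Frequently.and_eventually
    (frequently_ae_iff.2 hne : ∃ᵐ x ∂volume, x ∈ Set.Ioo a b) hP).exists
  exact ⟨x, hx, hPx⟩

/-- The density of a `k`-FRSB measure. -/
theorem IsFRSBAt.exists_hasBlockForm (h : Admissible γ Δ)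
    (hF : IsFRSBAt (densityMeasure γ Δ) B) : ∃ σ, HasBlockForm γ B σ := by
  obtain ⟨m, ω, Δ', hm0, hm, hω0, hω, -, heq⟩ := hF
  rw [B.withDensity_density] at heq
  have hnn : ∀ x ∈ Set.Ico (0 : ℝ) 1, 0 ≤ B.density m ω x := by
    intro x hx
    rcases B.cover hx with ⟨j, hj, i, hi, hx'⟩ | ⟨j, hj, hx'⟩
    · rw [B.density_step m ω hj hi hx']
      exact (hm0 _ (B.index_mem hj (by omega) hi)).le
    · rw [B.density_gap m ω hj hx']
      exact hω0 x ⟨j, hj, hx'⟩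
  have hae := ae_eq_of_densityMeasure_eq
    (aemeasurable_restrict_of_monotoneOn measurableSet_Ico h.mono)
    (B.measurable_density m hω.monotoneOn).restrict h.nonneg hnn heq
  refine ⟨fun j i => m (B.w j + (i + 1)), ?_, ?_, ?_, ?_⟩
  · intro j hj i hi x hx
    have ha := B.q_mem hj (show i ≤ B.s j by omega)
    have hb := B.q_mem hj hi
    have hx01 : x ∈ Set.Ico (0 : ℝ) 1 := ⟨ha.1.trans hx.1, hx.2.trans_le hb.2⟩
    -- The two densities agree only almost everywhere. The value is found at points arbitrarily
    -- close to x on its right, and monotonicity and right-continuity of γ carry it to x.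
    have hex : ∀ c, x < c → c ≤ B.q j (i + 1) →
        ∃ y ∈ Set.Ioo x c, γ y = m (B.w j + (i + 1)) := by
      intro c hc hc'
      obtain ⟨y, hy, hPy⟩ := exists_mem_Ioo_of_ae hae hc
      refine ⟨y, hy, ?_⟩
      rw [hPy ⟨hx01.1.trans hy.1.le, (hy.2.trans_le hc').trans_le hb.2⟩,
        B.density_step m ω hj hi ⟨hx.1.trans hy.1.le, hy.2.trans_le hc'⟩]
    refine le_antisymm ?_ ?_
    · obtain ⟨y, hy, e⟩ := hex _ hx.2 le_rfl
      rw [← e]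
      exact h.mono hx01 ⟨hx01.1.trans hy.1.le, hy.2.trans_le hb.2⟩ hy.1.le
    · by_contra! hlt
      have hev := (h.right x hx01).eventually (gt_mem_nhds hlt)
      have hev' : ∀ᶠ y in nhdsWithin x (Set.Ioi x), γ y < m (B.w j + (i + 1)) :=
        hev.filter_mono (nhdsWithin_mono _ Set.Ioi_subset_Ici_self)
      obtain ⟨c, hc, hsub⟩ := (mem_nhdsGT_iff_exists_Ioo_subset' hx.2).1 hev'
      obtain ⟨y, hy, e⟩ := hex _ (lt_min hc hx.2) (min_le_right _ _)
      have : γ y < m (B.w j + (i + 1)) := hsub ⟨hy.1, hy.2.trans_le (min_le_left _ _)⟩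
      exact this.ne e
  · exact fun j hj i hi => hm0 _ (B.index_mem hj (by omega) hi)
  · exact fun j hj i hi => hm (B.index_mem hj (by omega) (by omega))
      (B.index_mem hj (by omega) (by omega)) (by omega)
  · intro j hj x hx y hy hxy
    have ha := (B.q_mem (show j < B.t by omega) le_rfl).1
    have hb := (B.q_mem hj (Nat.zero_le _)).2
    have h01 : ∀ z ∈ Set.Ico (B.q j (B.s j)) (B.q (j + 1) 0), z ∈ Set.Ico (0 : ℝ) 1 :=
      fun z hz => ⟨ha.trans hz.1, hz.2.trans_le hb⟩
    -- The strict inequality is transferred through points of agreement x' < c < y' between x and y.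
    obtain ⟨c, hxc, hcy⟩ := exists_between hxy
    obtain ⟨x', hx', e⟩ := exists_mem_Ioo_of_ae hae hxc
    obtain ⟨y', hy', e'⟩ := exists_mem_Ioo_of_ae hae hcy
    have mx : x' ∈ Set.Ico (B.q j (B.s j)) (B.q (j + 1) 0) :=
      ⟨hx.1.trans hx'.1.le, (hx'.2.trans hcy).trans hy.2⟩
    have my : y' ∈ Set.Ico (B.q j (B.s j)) (B.q (j + 1) 0) :=
      ⟨hx.1.trans (hxc.trans hy'.1).le, hy'.2.trans hy.2⟩
    calc γ x ≤ γ x' := h.mono (h01 x hx) (h01 x' mx) hx'.1.le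
      _ = ω x' := by rw [e (h01 x' mx), B.density_gap m ω hj mx]
      _ < ω y' := hω ⟨j, hj, mx⟩ ⟨j, hj, my⟩ (hx'.2.trans hy'.1)
      _ = γ y' := by rw [e' (h01 y' my), B.density_gap m ω hj my]
      _ ≤ γ y := h.mono (h01 y' my) (h01 y hy) hy'.2.le

/-! ### Complementary slackness at the block points and on the smooth intervals. -/

namespace Stationary

variable {σ : ℕ → ℕ → ℝ}

/-- The tail integral of the first variation vanishes at the points of increase. -/
theorem tail_zero_of_increase (hξ : IsCubicLike ξ) (h : Admissible γ Δ) (hs : Stationary ξ γ Δ)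
    {u : ℝ} (hu : u ∈ Set.Icc (0 : ℝ) 1)
    (hinc : ∀ ε > 0, ∃ α β, 0 ≤ α ∧ α ≤ β ∧ β < 1 ∧ u - ε < α ∧ β < u + ε ∧ γ α < γ β) :
    ∫ x in u..1, variation ξ γ Δ x = 0 := by
  by_contra hne
  have hpos := lt_of_le_of_ne (hs.tail_nonneg u hu) (Ne.symm hne)
  have hev := (continuousOn_tail hξ h u hu).eventually (lt_mem_nhds hpos)
  obtain ⟨ε, hε, hsub⟩ := Metric.mem_nhdsWithin_iff.1 hev
  obtain ⟨α, β, h0, hαβ, h1, hα, hβ, hlt⟩ := hinc ε hε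
  obtain ⟨v, hv, hv0⟩ := hs.exists_tail_eq_zero hξ h h0 hαβ h1 hlt
  have : 0 < ∫ x in v..1, variation ξ γ Δ x := by
    refine hsub ⟨?_, h0.trans hv.1, hv.2.trans h1.le⟩
    rw [Metric.mem_ball, Real.dist_eq, abs_lt]
    constructor <;> linarith [hv.1, hv.2]
  exact this.ne' hv0

/-- At an interior u the function G has a minimum, so G' = −g vanishes. At 0 and 1 the variation
vanishes anyway, by ξ'(0) = 0 and by stationarity. -/
theorem variation_eq_zero (hξ : IsCubicLike ξ) (h : Admissible γ Δ) (hs : Stationary ξ γ Δ)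
    {u : ℝ} (hu : u ∈ Set.Icc (0 : ℝ) 1) (h0 : ∫ x in u..1, variation ξ γ Δ x = 0) :
    variation ξ γ Δ u = 0 := by
  rcases hu.1.eq_or_lt with rfl | hu0
  · simp [variation, hξ.deriv_zero]
  rcases hu.2.eq_or_lt with rfl | hu1
  · exact hs.variation_one
  have hcv := h.continuousOn_variation hξ
  have hder : HasDerivAt (fun x => ∫ t in x..1, variation ξ γ Δ t) (-variation ξ γ Δ u) u := by
    refine intervalIntegral.integral_hasDerivAt_left
      ((hcv.mono (Set.uIcc_subset_Icc hu (by simp))).intervalIntegrable) ?_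
      (hcv.continuousAt (Icc_mem_nhds hu0 hu1))
    have := hcv.stronglyMeasurableAtFilter_nhdsWithin measurableSet_Icc (μ := volume) u
    rwa [nhdsWithin_eq_nhds.2 (Icc_mem_nhds hu0 hu1)] at this
  have hloc : IsLocalMin (fun x => ∫ t in x..1, variation ξ γ Δ t) u := by
    filter_upwards [Icc_mem_nhds hu0 hu1] with x hx
    rw [h0]
    exact hs.tail_nonneg x hx
  exact neg_eq_zero.1 (hloc.hasDerivAt_eq_zero hder)

theorem tail_zero_gap (hξ : IsCubicLike ξ) (h : Admissible γ Δ) (hs : Stationary ξ γ Δ)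
    (hB : HasBlockForm γ B σ) {j : ℕ} (hj : j + 1 < B.t) {u : ℝ}
    (hu : u ∈ Set.Icc (B.q j (B.s j)) (B.q (j + 1) 0)) :
    ∫ x in u..1, variation ξ γ Δ x = 0 := by
  have ha := (B.q_mem (show j < B.t by omega) le_rfl).1
  have hb := (B.q_mem hj (Nat.zero_le _)).2
  refine hs.tail_zero_of_increase hξ h ⟨ha.trans hu.1, hu.2.trans hb⟩ fun ε hε => ?_
  have hlt : max (B.q j (B.s j)) (u - ε) < min (B.q (j + 1) 0) (u + ε) := by
    have := B.lt_gap j hj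
    refine lt_min (max_lt this ?_) (max_lt ?_ ?_) <;> linarith [hu.1, hu.2]
  obtain ⟨β, hβ1, hβ2⟩ := exists_between hlt
  obtain ⟨α, hα1, hα2⟩ := exists_between hβ1
  rw [max_lt_iff] at hα1 hβ1
  rw [lt_min_iff] at hβ2
  exact ⟨α, β, ha.trans hα1.1.le, hα2.le, hβ2.1.trans_le hb, hα1.2, hβ2.2,
    hB.gap j hj ⟨hα1.1.le, hα2.trans hβ2.1⟩ ⟨hβ1.1.le, hβ2.1⟩ hα2⟩

/-- Every block point is a point of increase: it bounds a smooth interval, or separates two steps of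
different heights, or is 0 with a positive first step. At 1 the tail is empty. -/
theorem tail_zero_point (hξ : IsCubicLike ξ) (h : Admissible γ Δ) (hs : Stationary ξ γ Δ)
    (hB : HasBlockForm γ B σ) {j i : ℕ} (hj : j < B.t) (hi : i ≤ B.s j) :
    ∫ x in (B.q j i)..1, variation ξ γ Δ x = 0 := by
  rcases hi.eq_or_lt with rfl | his
  · rcases (show j + 1 ≤ B.t from hj).eq_or_lt with he | hlt
    · have : j = B.t - 1 := by omega
      rw [this, B.last_eq, intervalIntegral.integral_same]
    · exact hs.tail_zero_gap hξ h hB hlt ⟨le_rfl, (B.lt_gap j hlt).le⟩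
  rcases Nat.eq_zero_or_pos i with rfl | hi0
  · rcases Nat.eq_zero_or_pos j with rfl | hj0
    · have : 0 < γ (B.q 0 0) := by
        rw [hB.step 0 hj 0 his _ ⟨le_rfl, B.lt_step 0 hj 0 his⟩]
        exact hB.step_pos 0 hj 0 his
      rw [B.first_eq] at this ⊢
      exact hs.tail_zero_of_pos hξ h this
    · obtain ⟨k, rfl⟩ : ∃ k, j = k + 1 := ⟨j - 1, by omega⟩
      exact hs.tail_zero_gap hξ h hB hj ⟨(B.lt_gap k hj).le, le_rfl⟩
  · obtain ⟨k, rfl⟩ : ∃ k, i = k + 1 := ⟨i - 1, by omega⟩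
    have hlo := B.lt_step j hj k (by omega)
    have hup := B.lt_step j hj (k + 1) his
    refine hs.tail_zero_of_increase hξ h (B.q_mem hj hi) fun ε hε => ?_
    obtain ⟨α, hα1, hα2⟩ := exists_between (max_lt hlo (show B.q j (k + 1) - ε < _ by linarith))
    rw [max_lt_iff] at hα1
    refine ⟨α, B.q j (k + 1), ((B.q_mem hj (show k ≤ B.s j by omega)).1.trans hα1.1.le), hα2.le,
      hup.trans_le (B.q_mem hj his).2, hα1.2, by linarith, ?_⟩
    rw [hB.step j hj k (by omega) α ⟨hα1.1.le, hα2⟩, hB.step j hj (k + 1) his _ ⟨le_rfl, hup⟩]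
    exact hB.step_lt j hj k his

/-- On the smooth intervals, `ξ''(x) ν((x,1])² = 1`. -/
theorem deriv2_mul_tailMass_sq (hξ : IsCubicLike ξ) (h : Admissible γ Δ) (hs : Stationary ξ γ Δ)
    (hB : HasBlockForm γ B σ) {j : ℕ} (hj : j + 1 < B.t) {u : ℝ}
    (hu : u ∈ Set.Icc (B.q j (B.s j)) (B.q (j + 1) 0)) :
    iteratedDeriv 2 ξ u * tailMass γ Δ u ^ 2 = 1 := by
  have ha := (B.q_mem (show j < B.t by omega) le_rfl).1
  have hb := (B.q_mem hj (Nat.zero_le _)).2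
  have hsub : Set.Icc (B.q j (B.s j)) (B.q (j + 1) 0) ⊆ Set.Icc 0 1 := Set.Icc_subset_Icc ha hb
  have hint : ∀ x ∈ Set.Ioo (B.q j (B.s j)) (B.q (j + 1) 0),
      iteratedDeriv 2 ξ x * tailMass γ Δ x ^ 2 = 1 := by
    intro x hx
    have hx01 : x ∈ Set.Ioo (0 : ℝ) 1 := ⟨ha.trans_lt hx.1, hx.2.trans_le hb⟩
    have hd := h.hasDerivAt_variation hξ hx01
    have hd0 : HasDerivAt (variation ξ γ Δ) 0 x := by
      refine (hasDerivAt_const x (0 : ℝ)).congr_of_eventuallyEq ?_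
      filter_upwards [Icc_mem_nhds hx.1 hx.2] with y hy
      exact hs.variation_eq_zero hξ h (hsub hy) (hs.tail_zero_gap hξ h hB hj hy)
    have := sub_eq_zero.1 (hd.unique hd0)
    rw [this]
    exact inv_mul_cancel₀ (pow_pos (h.tailMass_pos (Set.Ioo_subset_Icc_self hx01)) 2).ne'
  have hcont : ContinuousOn (fun x => iteratedDeriv 2 ξ x * tailMass γ Δ x ^ 2)
      (Set.Icc (B.q j (B.s j)) (B.q (j + 1) 0)) :=
    hξ.continuous_deriv2.continuousOn.mul ((h.continuousOn_tailMass.mono hsub).pow 2)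
  -- Inside the interval the variation is locally 0 and so is its derivative; the ends follow by
  -- continuity.
  have hcl := Set.EqOn.of_subset_closure (s := Set.Ioo (B.q j (B.s j)) (B.q (j + 1) 0))
    (g := fun _ => (1 : ℝ)) hint hcont continuousOn_const Set.Ioo_subset_Icc_self
    (by rw [closure_Ioo (B.lt_gap j hj).ne])
  exact hcl hu

/-- ξ''Γ² = 1 is incompatible with ξ''(0) = 0; in particular the first block is not the single point
0. -/
theorem gap_left_pos (hξ : IsCubicLike ξ) (h : Admissible γ Δ) (hs : Stationary ξ γ Δ)
    (hB : HasBlockForm γ B σ) {j : ℕ} (hj : j + 1 < B.t) : 0 < B.q j (B.s j) := by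
  refine lt_of_le_of_ne (B.q_mem (show j < B.t by omega) le_rfl).1 fun h0 => ?_
  have := hs.deriv2_mul_tailMass_sq hξ h hB hj ⟨le_rfl, (B.lt_gap j hj).le⟩
  rw [← h0, hξ.deriv2_zero, zero_mul] at this
  exact zero_ne_one this

theorem tailMass_eq_profile (hξ : IsCubicLike ξ) (h : Admissible γ Δ) (hs : Stationary ξ γ Δ)
    (hB : HasBlockForm γ B σ) {j : ℕ} (hj : j + 1 < B.t) {u : ℝ}
    (hu : u ∈ Set.Icc (B.q j (B.s j)) (B.q (j + 1) 0)) : tailMass γ Δ u = profile ξ u := by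
  have ha := hs.gap_left_pos hξ h hB hj
  have hb := (B.q_mem hj (Nat.zero_le _)).2
  exact hξ.eq_profile (ha.trans_le hu.1)
    (h.tailMass_pos ⟨ha.le.trans hu.1, hu.2.trans hb⟩) (hs.deriv2_mul_tailMass_sq hξ h hB hj hu)

/-- Concavity of the profile on the smooth intervals. -/
theorem concave (hξ : IsCubicLike ξ) (h : Admissible γ Δ) (hs : Stationary ξ γ Δ)
    (hB : HasBlockForm γ B σ) {j : ℕ} (hj : j + 1 < B.t) {u : ℝ}
    (hu : u ∈ Set.Icc (B.q j (B.s j)) (B.q (j + 1) 0)) : iteratedDeriv 2 (profile ξ) u ≤ 0 := by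
  by_contra! hpos
  have ha := hs.gap_left_pos hξ h hB hj
  have hb := (B.q_mem hj (Nat.zero_le _)).2
  have hev := (hξ.continuousOn_deriv2_profile.continuousAt
    (Ioi_mem_nhds (ha.trans_le hu.1))).eventually (lt_mem_nhds hpos)
  obtain ⟨ε, hε, hsub⟩ := Metric.mem_nhds_iff.1 hev
  have hlt : max (B.q j (B.s j)) (u - ε) < min (B.q (j + 1) 0) (u + ε) := by
    have := B.lt_gap j hj
    refine lt_min (max_lt this ?_) (max_lt ?_ ?_) <;> linarith [hu.1, hu.2]
  obtain ⟨d, hd1, hd2⟩ := exists_between hlt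
  obtain ⟨c, hc1, hc2⟩ := exists_between hd1
  rw [max_lt_iff] at hc1 hd1
  rw [lt_min_iff] at hd2
  have hgap : ∀ x ∈ Set.Icc c d, x ∈ Set.Icc (B.q j (B.s j)) (B.q (j + 1) 0) := fun x hx =>
    ⟨hc1.1.le.trans hx.1, hx.2.trans hd2.1.le⟩
  have h01 : ∀ x ∈ Set.Icc c d, x ∈ Set.Ico (0 : ℝ) 1 := fun x hx =>
    ⟨ha.le.trans (hgap x hx).1, hx.2.trans_lt (hd2.1.trans_le hb)⟩
  -- The tail mass, equal to the profile on [c, d], would be strictly convex there, while a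
  -- nondecreasing density makes it concave; the midpoint gives the contradiction.
  have hconv : StrictConvexOn ℝ (Set.Icc c d) (profile ξ) := by
    refine strictConvexOn_of_deriv2_pos' (convex_Icc c d) ?_ ?_
    · exact hξ.contDiffOn_profile.continuousOn.mono fun x hx => ha.trans_le (hgap x hx).1
    · intro x hx
      rw [← iteratedDeriv_eq_iterate]
      refine hsub ?_
      rw [Metric.mem_ball, Real.dist_eq, abs_lt]
      constructor <;> linarith [hx.1, hx.2]
  have hmid := hconv.2 (Set.left_mem_Icc.2 hc2.le) (Set.right_mem_Icc.2 hc2.le) hc2.ne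
    (show (0 : ℝ) < 1 / 2 by norm_num) (show (0 : ℝ) < 1 / 2 by norm_num) (by norm_num)
  simp only [smul_eq_mul] at hmid
  set μ := 1 / 2 * c + 1 / 2 * d with hμ
  have hcμ : c ≤ μ := by rw [hμ]; linarith
  have hμd : μ ≤ d := by rw [hμ]; linarith
  have mc : c ∈ Set.Icc c d := Set.left_mem_Icc.2 hc2.le
  have md : d ∈ Set.Icc c d := Set.right_mem_Icc.2 hc2.le
  have mμ : μ ∈ Set.Icc c d := ⟨hcμ, hμd⟩
  have I := fun {x : ℝ} (hx : x ∈ Set.Icc c d) => Set.Ico_subset_Icc_self (h01 x hx)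
  rw [← hs.tailMass_eq_profile hξ h hB hj (hgap c mc),
    ← hs.tailMass_eq_profile hξ h hB hj (hgap d md),
    ← hs.tailMass_eq_profile hξ h hB hj (hgap μ mμ), h.tailMass_sub (I mc) (I mμ),
    h.tailMass_sub (I mμ) (I md)] at hmid
  have e1 : ∫ t in c..μ, γ t ≤ ∫ t in c..μ, γ μ :=
    intervalIntegral.integral_mono_on hcμ (h.integrable_sub (I mc) (I mμ))
      intervalIntegrable_const
      fun x hx => h.mono (h01 x ⟨hx.1, hx.2.trans hμd⟩) (h01 μ mμ) hx.2
  have e2 : ∫ t in μ..d, γ μ ≤ ∫ t in μ..d, γ t :=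
    intervalIntegral.integral_mono_on hμd intervalIntegrable_const
      (h.integrable_sub (I mμ) (I md))
      fun x hx => h.mono (h01 μ mμ) (h01 x ⟨hcμ.trans hx.1, hx.2⟩) hx.1
  rw [intervalIntegral.integral_const, smul_eq_mul] at e1 e2
  have : μ - c = d - μ := by rw [hμ]; ring
  rw [this] at e1
  linarith

end Stationary

/-- The variation vanishes at every block point, so on a step it coincides with `stepVariation`;
since the tail from the right end is 0 as well, the tail integrals within the step are those up to
1. -/
theorem HasBlockForm.isBlockTail {σ : ℕ → ℕ → ℝ} (hB : HasBlockForm γ B σ) (hξ : IsCubicLike ξ)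
    (h : Admissible γ Δ) (hs : Stationary ξ γ Δ) {j : ℕ} (hj : j < B.t) :
    IsBlockTail ξ (B.s j) (B.q j) (fun i => tailMass γ Δ (B.q j i)) ∧
      TailNonneg ξ (B.s j) (B.q j) (fun i => tailMass γ Δ (B.q j i)) ∧
      SlopesIncrease (B.s j) (B.q j) (fun i => tailMass γ Δ (B.q j i)) := by
  have hblock : IsBlock (B.s j) (B.q j) := ⟨(B.q_mem hj (Nat.zero_le _)).1, B.lt_step j hj⟩
  have hvar : ∀ i ≤ B.s j, variation ξ γ Δ (B.q j i) = 0 := fun i hi =>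
    hs.variation_eq_zero hξ h (B.q_mem hj hi) (hs.tail_zero_point hξ h hB hj hi)
  have hγ : ∀ l, 1 ≤ l → l ≤ B.s j → ∀ x ∈ Set.Ico (B.q j (l - 1)) (B.q j l),
      γ x = σ j (l - 1) := by
    intro l h1 hl x hx
    refine hB.step j hj (l - 1) (by omega) x ?_
    rwa [Nat.sub_add_cancel h1]
  have hslope : ∀ l, 1 ≤ l → l ≤ B.s j →
      (tailMass γ Δ (B.q j (l - 1)) - tailMass γ Δ (B.q j l)) / (B.q j l - B.q j (l - 1)) =
        σ j (l - 1) := fun l h1 hl =>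
    h.slope_of_const (hblock.nonneg _ (by omega)) (hblock.lt' h1 hl) (B.q_mem hj hl).2
      (hγ l h1 hl)
  have hpos : ∀ l, 1 ≤ l → l ≤ B.s j → 0 < σ j (l - 1) := fun l h1 hl =>
    hB.step_pos j hj (l - 1) (by omega)
  have hvs : ∀ l, 1 ≤ l → l ≤ B.s j → ∀ x ∈ Set.Icc (B.q j (l - 1)) (B.q j l),
      variation ξ γ Δ x = stepVariation ξ (B.q j (l - 1)) (B.q j l)
        (tailMass γ Δ (B.q j (l - 1))) (tailMass γ Δ (B.q j l)) x := by
    intro l h1 hl x hx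
    rw [h.variation_eq_stepVariation (hblock.nonneg _ (by omega)) (hblock.lt' h1 hl)
      (B.q_mem hj hl).2 (hγ l h1 hl) (hpos l h1 hl) hx, hvar _ (by omega), zero_add]
  have hint : ∀ l, 1 ≤ l → l ≤ B.s j → ∀ y ∈ Set.Icc (B.q j (l - 1)) (B.q j l),
      ∫ t in y..B.q j l, stepVariation ξ (B.q j (l - 1)) (B.q j l)
        (tailMass γ Δ (B.q j (l - 1))) (tailMass γ Δ (B.q j l)) t =
      ∫ t in y..1, variation ξ γ Δ t := by
    intro l h1 hl y hy
    have hy01 : y ∈ Set.Icc (0 : ℝ) 1 :=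
      ⟨(hblock.nonneg _ (by omega)).trans hy.1, hy.2.trans (B.q_mem hj hl).2⟩
    have hi : ∀ {a b}, a ∈ Set.Icc (0 : ℝ) 1 → b ∈ Set.Icc (0 : ℝ) 1 →
        IntervalIntegrable (variation ξ γ Δ) volume a b := fun ha hb =>
      ((h.continuousOn_variation hξ).mono (Set.uIcc_subset_Icc ha hb)).intervalIntegrable
    rw [← intervalIntegral.integral_add_adjacent_intervals (hi hy01 (B.q_mem hj hl))
      (hi (B.q_mem hj hl) (by simp)), hs.tail_zero_point hξ h hB hj hl, add_zero]
    refine intervalIntegral.integral_congr fun t ht => ?_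
    rw [Set.uIcc_of_le hy.2] at ht
    exact (hvs l h1 hl t ⟨hy.1.trans ht.1, ht.2⟩).symm
  have hstep : ∀ l, 1 ≤ l → l ≤ B.s j → IsStep ξ (B.q j (l - 1)) (B.q j l)
      (tailMass γ Δ (B.q j (l - 1))) (tailMass γ Δ (B.q j l)) := by
    intro l h1 hl
    have hlt := hblock.lt' h1 hl
    have hE := h.tailMass_pos (B.q_mem hj hl)
    have hEA : tailMass γ Δ (B.q j l) < tailMass γ Δ (B.q j (l - 1)) := by
      have := hpos l h1 hl
      rw [← hslope l h1 hl, div_pos_iff_of_pos_right (sub_pos.2 hlt)] at this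
      linarith
    refine ⟨hblock.nonneg _ (by omega), hlt, hE, hEA, ?_⟩
    have := hvs l h1 hl _ (Set.right_mem_Icc.2 hlt.le)
    rw [hvar l hl, stepVariation, affineTail_right, eq_comm, sub_eq_zero,
      eq_div_iff (mul_pos (hE.trans hEA) hE).ne'] at this
    exact this
  refine ⟨⟨hblock, hstep, fun l h1 hl => ?_⟩, fun l h1 hl y hy => ?_, fun l h1 hl => ?_⟩
  · rw [← (hstep l h1 hl).integral_stepVariation_eq_h hξ,
      hint l h1 hl _ (Set.left_mem_Icc.2 (hblock.lt' h1 hl).le)]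
    exact hs.tail_zero_point hξ h hB hj (by omega)
  · simp only []
    rw [hint l h1 hl y hy]
    exact hs.tail_nonneg y ⟨(hblock.nonneg _ (by omega)).trans hy.1,
      hy.2.trans (B.q_mem hj hl).2⟩
  · have e := hslope (l + 1) (by omega) hl
    rw [Nat.add_sub_cancel] at e
    rw [hslope l h1 hl.le, e]
    have := hB.step_lt j hj (l - 1) (by omega)
    rwa [Nat.sub_add_cancel h1] at this

theorem zpow_zpow_neg_one_pow (n : ℕ) (a : ℝ) :
    (a ^ ((-1 : ℤ) ^ n)) ^ ((-1 : ℤ) ^ n) = a := by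
  rw [← zpow_mul, ← mul_pow]
  simp

/-- The criterion in terms of the blocks. -/
theorem frsbCriterion_iff : FRSBCriterion ξ B ↔
    (∀ j < B.t, 0 < B.s j → BlockCriterion ξ (B.s j) (B.q j) (B.star ξ j)) ∧
    (∀ j, 0 < j → j + 1 < B.t → 0 < B.s j →
      B.F ξ j 0 = (B.F ξ j (B.s j)) ^ ((-1 : ℤ) ^ B.s j)) ∧
    (∀ j, j + 1 < B.t → ∀ x ∈ Set.Icc (B.q j (B.s j)) (B.q (j + 1) 0),
      iteratedDeriv 2 (profile ξ) x ≤ 0) := by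
  constructor
  · intro H
    exact ⟨fun j hj hs => ⟨H.h_eq j hj, H.lower j hj hs, H.upper j hj hs, H.strict j hj,
      H.crit j hj⟩, H.matching, H.concave⟩
  · rintro ⟨H1, H2, H3⟩
    exact ⟨fun j hj i h1 hi => (H1 j hj (by omega)).h_eq i h1 hi, H2,
      fun j hj hs => (H1 j hj hs).lower, fun j hj hs => (H1 j hj hs).upper,
      fun j hj i h1 hi => (H1 j hj (by omega)).strict i h1 hi,
      fun j hj i h1 hi => (H1 j hj (by omega)).crit i h1 hi, H3⟩

theorem IsFRSBAt.frsbCriterion (hξ : IsCubicLike ξ) {ν : Measure ℝ} (hν : IsParisiMeasure ξ ν)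
    (hF : IsFRSBAt ν B) : FRSBCriterion ξ B := by
  obtain ⟨γ, Δ, h, rfl⟩ := hν.exists_admissible hξ
  have hs := hν.stationary hξ h
  obtain ⟨σ, hB⟩ := hF.exists_hasBlockForm h
  have hright : ∀ j, j + 1 < B.t → 0 < B.s j →
      tailMass γ Δ (B.q j (B.s j - 1)) / tailMass γ Δ (B.q j (B.s j)) = B.F ξ j (B.s j) := by
    intro j hj hsj
    refine ((hB.isBlockTail hξ h hs (show j < B.t by omega)).1.last_ratio_eq_iff hξ hsj).2 ?_
    exact hs.deriv2_mul_tailMass_sq hξ h hB hj ⟨le_rfl, (B.lt_gap j hj).le⟩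
  have hleft : ∀ j, 0 < j → j < B.t → 0 < B.s j → B.F ξ j 0 =
      (tailMass γ Δ (B.q j (B.s j - 1)) / tailMass γ Δ (B.q j (B.s j))) ^ ((-1 : ℤ) ^ B.s j) := by
    intro j hj0 hj hsj
    refine ((hB.isBlockTail hξ h hs hj).1.first_eq_iff hξ hsj).2 ?_
    obtain ⟨k, rfl⟩ : ∃ k, j = k + 1 := ⟨j - 1, by omega⟩
    exact hs.deriv2_mul_tailMass_sq hξ h hB hj ⟨(B.lt_gap k hj).le, le_rfl⟩
  refine frsbCriterion_iff.2 ⟨fun j hj hsj => ?_, fun j hj0 hj hsj => ?_,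
    fun j hj x hx => hs.concave hξ h hB hj hx⟩
  · obtain ⟨T, hnn, hsl⟩ := hB.isBlockTail hξ h hs hj
    -- In the last block the ratio is read off at the left end: F_0 is its power with exponent ±1,
    -- and that exponent is undone by applying it again.
    have hstar : B.star ξ j =
        tailMass γ Δ (B.q j (B.s j - 1)) / tailMass γ Δ (B.q j (B.s j)) := by
      rw [BlockPoints.star]
      split_ifs with hlt
      · exact (hright j hlt hsj).symm
      · have := B.two_le
        rw [hleft j (by omega) hj hsj, zpow_zpow_neg_one_pow]
    rw [hstar]
    exact T.blockCriterion hξ hsj hnn hsl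
  · rw [hleft j hj0 (by omega) hsj, hright j hj hsj]

end SphericalSpin

namespace SphericalSpin

theorem monotoneOn_Ico_glue {f : ℝ → ℝ} {a b : ℝ}
    (h1 : MonotoneOn f (Set.Ico 0 a)) (ha : ∀ x ∈ Set.Ico 0 a, f x ≤ f a)
    (h2 : MonotoneOn f (Set.Ico a b)) : MonotoneOn f (Set.Ico 0 b) := by
  intro x hx y hy hxy
  rcases lt_or_ge y a with hya | hya
  · exact h1 ⟨hx.1, hxy.trans_lt hya⟩ ⟨hy.1, hya⟩ hxy
  rcases lt_or_ge x a with hxa | hxa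
  · exact (ha x ⟨hx.1, hxa⟩).trans (h2 ⟨le_rfl, hya.trans_lt hy.2⟩ ⟨hya, hy.2⟩ hya)
  · exact h2 ⟨hxa, hx.2⟩ ⟨hya, hy.2⟩ hxy

/-! ### Sufficiency of the criterion -/

variable {ξ : ℝ → ℝ} {B : BlockPoints}

/-- A profile with nonpositive second derivative stays bounded near the left end, so that it cannot
be concave up to `0`. -/
theorem IsCubicLike.not_concave_at_zero (hξ : IsCubicLike ξ) {b : ℝ} (hb : 0 < b)
    (h : ∀ x ∈ Set.Icc 0 b, iteratedDeriv 2 (profile ξ) x ≤ 0) : False := by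
  -- The value at 0 of the tangent at b. Concavity keeps the profile below c, so that ξ''·c² ≥ 1 on
  -- (0, b), against ξ''(0) = 0.
  set c := profile ξ b - deriv (profile ξ) b * b with hc
  have hneg := hξ.deriv_profile_neg hb
  have hbound : ∀ x ∈ Set.Ioo 0 b, profile ξ x ≤ c := by
    intro x hx
    obtain ⟨y, hy, hy'⟩ := exists_deriv_eq_slope (profile ξ) hx.2
      (fun w hw => (hξ.hasDerivAt_profile (hx.1.trans_le hw.1)).continuousAt.continuousWithinAt)
      (fun w hw => (hξ.hasDerivAt_profile
        (hx.1.trans hw.1)).differentiableAt.differentiableWithinAt)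
    have hlt := hξ.deriv_profile_strictAntiOn hx.1 (fun w hw => h w ⟨hx.1.le.trans hw.1, hw.2⟩)
      (Set.Ioo_subset_Icc_self hy) (Set.right_mem_Icc.2 hx.2.le) hy.2
    rw [eq_div_iff (by linarith [hx.2])] at hy'
    rw [hc]
    nlinarith [hx.1, hx.2]
  have hlim : Filter.Tendsto (fun x => iteratedDeriv 2 ξ x * c ^ 2)
      (nhdsWithin 0 (Set.Ioi 0)) (nhds (iteratedDeriv 2 ξ 0 * c ^ 2)) :=
    (hξ.continuous_deriv2.continuousAt.mul continuousAt_const).tendsto.mono_left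
      nhdsWithin_le_nhds
  have hge : 1 ≤ iteratedDeriv 2 ξ 0 * c ^ 2 := by
    refine ge_of_tendsto hlim ?_
    filter_upwards [Ioo_mem_nhdsGT hb] with x hx
    rw [← hξ.deriv2_mul_profile_sq hx.1]
    have h1 := hξ.deriv2_pos hx.1
    have h2 := (hξ.profile_pos hx.1).le
    have h3 := hbound x hx
    gcongr
  rw [hξ.deriv2_zero, zero_mul] at hge
  linarith

/-- The tail masses at the block points, matched to the profile on the smooth intervals. -/
structure IsTailData (ξ : ℝ → ℝ) (B : BlockPoints) (V : ℕ → ℕ → ℝ) : Prop where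
  tail : ∀ j < B.t, 0 < B.s j → IsBlockTail ξ (B.s j) (B.q j) (V j)
  nonneg : ∀ j < B.t, 0 < B.s j → TailNonneg ξ (B.s j) (B.q j) (V j)
  slopes : ∀ j < B.t, 0 < B.s j → SlopesIncrease (B.s j) (B.q j) (V j)
  right : ∀ j, j + 1 < B.t → V j (B.s j) = profile ξ (B.q j (B.s j))
  left : ∀ j, 0 < j → j < B.t → V j 0 = profile ξ (B.q j 0)
  concave : ∀ j, j + 1 < B.t → ∀ x ∈ Set.Icc (B.q j (B.s j)) (B.q (j + 1) 0),
    iteratedDeriv 2 (profile ξ) x ≤ 0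
  first_pos : 0 < B.s 0

theorem BlockPoints.isBlock (B : BlockPoints) {j : ℕ} (hj : j < B.t) :
    IsBlock (B.s j) (B.q j) := ⟨(B.q_mem hj (Nat.zero_le _)).1, B.lt_step j hj⟩

theorem IsBlock.blockF_zero_pos (hξ : IsCubicLike ξ) {s : ℕ} {x : ℕ → ℝ} (hB : IsBlock s x)
    (hs : 1 ≤ s) (h0 : 0 < x 0) : 0 < blockF ξ s x 0 := by
  have hr : 0 < r₂ ξ (x 1) (x 0) := by
    rw [r₂_eq, invSlope_comm]
    exact mul_pos (hξ.deriv2_pos h0) (hB.invSlope_pos hξ (l := 1) le_rfl hs)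
  have hP := hB.ratioProd_pos hξ (N := (s - 1) / 2) (by omega)
  by_cases he : Even s
  · have h2 : 1 < s := by
      rw [Nat.even_iff] at he; omega
    rw [blockF_zero_even hs he]
    exact mul_pos hr (mul_pos (hB.rAt_pos hξ le_rfl h2) hP)
  · have hd : (s - 0) / 2 = (s - 1) / 2 := by
      rw [Nat.not_even_iff_odd, Nat.odd_iff] at he; omega
    rw [blockF, if_pos (by simpa using he), hd]
    exact mul_pos hr (inv_pos.2 hP)

/-- Each block with steps is reconstructed with last ratio `star`; its definition and the matching
conditions put the masses at the ends adjacent to smooth intervals on the profile. The first block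
has steps by `not_concave_at_zero`. -/
theorem FRSBCriterion.exists_tailData (hξ : IsCubicLike ξ) (H : FRSBCriterion ξ B) :
    ∃ V, IsTailData ξ B V := by
  obtain ⟨hblock, hmatch, hconc⟩ := frsbCriterion_iff.1 H
  have ht := B.two_le
  have hs0 : 0 < B.s 0 := by
    by_contra! hs
    have hs : B.s 0 = 0 := by omega
    have hgap := hconc 0 (by omega)
    have hlt := B.lt_gap 0 (by omega)
    rw [hs, B.first_eq] at hgap hlt
    exact hξ.not_concave_at_zero hlt hgap
  have hstar : ∀ j < B.t, 0 < B.s j → 0 < B.star ξ j := by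
    intro j hj hsj
    rw [BlockPoints.star]
    split_ifs with hlt
    · rw [BlockPoints.F, IsBlock.blockF_last hsj]
      exact (B.isBlock hj).r₂_pos hξ hsj le_rfl
    · exact zpow_pos ((B.isBlock hj).blockF_zero_pos hξ hsj (B.first_pos (by omega) hj)) _
  have hex : ∀ j, ∃ Γ : ℕ → ℝ, j < B.t → 0 < B.s j → IsBlockTail ξ (B.s j) (B.q j) Γ ∧
      Γ (B.s j - 1) / Γ (B.s j) = B.star ξ j ∧ TailNonneg ξ (B.s j) (B.q j) Γ ∧
      SlopesIncrease (B.s j) (B.q j) Γ := by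
    intro j
    by_cases hj : j < B.t ∧ 0 < B.s j
    · obtain ⟨Γ, hΓ⟩ := (hblock j hj.1 hj.2).exists_tail hξ (B.isBlock hj.1) hj.2
        (hstar j hj.1 hj.2)
      exact ⟨Γ, fun _ _ => hΓ⟩
    · exact ⟨fun _ => 0, fun h1 h2 => absurd ⟨h1, h2⟩ hj⟩
  choose Γ hΓ using hex
  have hV : ∀ j, 0 < B.s j → (fun i => if B.s j = 0 then profile ξ (B.q j i) else Γ j i) = Γ j :=
    fun j hsj => by
      ext i
      rw [if_neg hsj.ne']
  -- A block without steps carries no equation; its mass is taken from the profile so that the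
  -- adjacent smooth intervals fit.
  refine ⟨fun j i => if B.s j = 0 then profile ξ (B.q j i) else Γ j i,
    fun j hj hsj => ?_, fun j hj hsj => ?_, fun j hj hsj => ?_, fun j hj => ?_,
    fun j hj0 hj => ?_, hconc, hs0⟩
  · rw [hV j hsj]; exact (hΓ j hj hsj).1
  · rw [hV j hsj]; exact (hΓ j hj hsj).2.2.1
  · rw [hV j hsj]; exact (hΓ j hj hsj).2.2.2
  · by_cases hsj : B.s j = 0
    · simp only [hsj, if_true]
    · have hsj' : 0 < B.s j := Nat.pos_of_ne_zero hsj
      obtain ⟨T, hlast, -, -⟩ := hΓ j (by omega) hsj'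
      simp only [hsj, if_false]
      refine hξ.eq_profile ((B.isBlock (show j < B.t by omega)).pos hsj' le_rfl)
        (T.step _ hsj' le_rfl).pos ((T.last_ratio_eq_iff hξ hsj').1 ?_)
      rw [hlast, BlockPoints.star, if_pos hj, BlockPoints.F]
  · by_cases hsj : B.s j = 0
    · simp only [hsj, if_true]
    · have hsj' : 0 < B.s j := Nat.pos_of_ne_zero hsj
      obtain ⟨T, hlast, -, -⟩ := hΓ j hj hsj'
      simp only [hsj, if_false]
      refine hξ.eq_profile (B.first_pos hj0 hj)
        (T.step 1 le_rfl hsj').left_pos ((T.first_eq_iff hξ hsj').1 ?_)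
      rw [hlast, BlockPoints.star]
      split_ifs with hlt
      · exact hmatch j hj0 hlt hsj'
      · rw [zpow_zpow_neg_one_pow]
        rfl

/-! ### The density glued from the tail data, and its optimality. -/

namespace IsTailData

variable {V : ℕ → ℕ → ℝ}

theorem gap_left_pos (D : IsTailData ξ B V) {j : ℕ} (hj : j + 1 < B.t) : 0 < B.q j (B.s j) := by
  rcases Nat.eq_zero_or_pos j with rfl | hj0
  · exact (B.isBlock B.t_pos).pos D.first_pos le_rfl
  · exact (B.first_pos hj0 (by omega)).trans_le (B.q_le (by omega) (Nat.zero_le _) le_rfl)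

theorem step (D : IsTailData ξ B V) {j i : ℕ} (hj : j < B.t) (hi : i < B.s j) :
    IsStep ξ (B.q j i) (B.q j (i + 1)) (V j i) (V j (i + 1)) :=
  (D.tail j hj (by omega)).step (i + 1) (by omega) hi

theorem h_eq (D : IsTailData ξ B V) {j i : ℕ} (hj : j < B.t) (hi : i < B.s j) :
    h ξ (B.q j i) (B.q j (i + 1)) (V j i / V j (i + 1)) = 0 :=
  (D.tail j hj (by omega)).h_eq (i + 1) (by omega) hi

theorem step_nonneg (D : IsTailData ξ B V) {j i : ℕ} (hj : j < B.t) (hi : i < B.s j) :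
    ∀ y ∈ Set.Icc (B.q j i) (B.q j (i + 1)),
      0 ≤ ∫ t in y..B.q j (i + 1),
        stepVariation ξ (B.q j i) (B.q j (i + 1)) (V j i) (V j (i + 1)) t :=
  D.nonneg j hj (by omega) (i + 1) (by omega) hi

theorem last_pos (hξ : IsCubicLike ξ) (D : IsTailData ξ B V) :
    0 < V (B.t - 1) (B.s (B.t - 1)) := by
  have ht := B.two_le
  have hj : B.t - 1 < B.t := by omega
  rcases Nat.eq_zero_or_pos (B.s (B.t - 1)) with h0 | hs
  · rw [h0, D.left _ (by omega) hj]
    exact hξ.profile_pos (B.first_pos (by omega) hj)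
  · exact ((D.tail _ hj hs).step _ hs le_rfl).pos

/-- The density that is built from tail data. -/
structure IsDensity (ξ : ℝ → ℝ) (B : BlockPoints) (V : ℕ → ℕ → ℝ) (γ : ℝ → ℝ) : Prop where
  step : ∀ j < B.t, ∀ i < B.s j, ∀ x ∈ Set.Ico (B.q j i) (B.q j (i + 1)),
    γ x = (V j i - V j (i + 1)) / (B.q j (i + 1) - B.q j i)
  gap : ∀ j, j + 1 < B.t → ∀ x ∈ Set.Ico (B.q j (B.s j)) (B.q (j + 1) 0),
    γ x = -deriv (profile ξ) x

variable {γ : ℝ → ℝ}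

theorem slope_lt (D : IsTailData ξ B V) {j i : ℕ} (hj : j < B.t) (hi : i + 1 < B.s j) :
    (V j i - V j (i + 1)) / (B.q j (i + 1) - B.q j i) <
      (V j (i + 1) - V j (i + 2)) / (B.q j (i + 2) - B.q j (i + 1)) :=
  D.slopes j hj (by omega) (i + 1) (by omega) hi

theorem slope_le_last (hξ : IsCubicLike ξ) (D : IsTailData ξ B V) {j i : ℕ} (hj : j + 1 < B.t)
    (hi : i + 1 = B.s j) :
    (V j i - V j (i + 1)) / (B.q j (i + 1) - B.q j i) ≤
      -deriv (profile ξ) (B.q j (i + 1)) := by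
  refine (D.step (by omega) (by omega)).slope_le_of_profile hξ
    (D.step_nonneg (by omega) (by omega)) ?_
  rw [hi]
  exact D.right j hj

theorem first_le_slope (hξ : IsCubicLike ξ) (D : IsTailData ξ B V) {j : ℕ} (hj0 : 0 < j)
    (hj : j < B.t) (hs : 0 < B.s j) :
    -deriv (profile ξ) (B.q j 0) ≤ (V j 0 - V j 1) / (B.q j 1 - B.q j 0) :=
  (D.step hj hs).le_slope_of_profile hξ (D.step_nonneg hj hs) (D.h_eq hj hs)
    (B.first_pos hj0 hj) (D.left j hj0 hj)

theorem gap_strictAntiOn (hξ : IsCubicLike ξ) (D : IsTailData ξ B V) {j : ℕ} (hj : j + 1 < B.t) :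
    StrictAntiOn (deriv (profile ξ)) (Set.Icc (B.q j (B.s j)) (B.q (j + 1) 0)) :=
  hξ.deriv_profile_strictAntiOn (D.gap_left_pos hj) (D.concave j hj)

namespace IsDensity

theorem nonneg (hξ : IsCubicLike ξ) (D : IsTailData ξ B V) (hγ : IsDensity ξ B V γ) :
    ∀ x ∈ Set.Ico (0 : ℝ) 1, 0 ≤ γ x := by
  intro x hx
  rcases B.cover hx with ⟨j, hj, i, hi, hx'⟩ | ⟨j, hj, hx'⟩
  · rw [hγ.step j hj i hi x hx']
    exact (D.step hj hi).slope_pos.le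
  · rw [hγ.gap j hj x hx']
    have := hξ.deriv_profile_neg ((D.gap_left_pos hj).trans_le hx'.1)
    linarith

theorem right (hξ : IsCubicLike ξ) (D : IsTailData ξ B V) (hγ : IsDensity ξ B V γ) :
    ∀ x ∈ Set.Ico (0 : ℝ) 1, ContinuousWithinAt γ (Set.Ici x) x := by
  intro x hx
  rcases B.cover hx with ⟨j, hj, i, hi, hx'⟩ | ⟨j, hj, hx'⟩
  · refine (continuousWithinAt_const
      (b := (V j i - V j (i + 1)) / (B.q j (i + 1) - B.q j i))).congr_of_eventuallyEq ?_
      (hγ.step j hj i hi x hx')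
    filter_upwards [Ico_mem_nhdsGE hx'.2] with y hy
    exact hγ.step j hj i hi y ⟨hx'.1.trans hy.1, hy.2⟩
  · have hx0 := (D.gap_left_pos hj).trans_le hx'.1
    refine ContinuousWithinAt.congr_of_eventuallyEq
      (hξ.hasDerivAt_deriv_profile hx0).continuousAt.neg.continuousWithinAt
      ?_ (hγ.gap j hj x hx')
    filter_upwards [Ico_mem_nhdsGE hx'.2] with y hy
    exact hγ.gap j hj y ⟨hx'.1.trans hy.1, hy.2⟩

/-- The next value is the following slope of the block or, at its end, minus the derivative of the
profile; the second comparison rests on the tail integrals through `slope_le_last`. -/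
theorem le_of_step (hξ : IsCubicLike ξ) (D : IsTailData ξ B V) (hγ : IsDensity ξ B V γ) {j i : ℕ}
    (hj : j < B.t) (hi : i < B.s j) (h1 : B.q j (i + 1) < 1) :
    ∀ x ∈ Set.Ico (B.q j i) (B.q j (i + 1)), γ x ≤ γ (B.q j (i + 1)) := by
  intro x hx
  rw [hγ.step j hj i hi x hx]
  rcases (show i + 1 ≤ B.s j from hi).eq_or_lt with he | hlt
  · have hjt : j + 1 < B.t := by
      by_contra! hcon
      have : j = B.t - 1 := by omega
      rw [he, this, B.last_eq] at h1
      exact lt_irrefl _ h1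
    rw [hγ.gap j hjt _ ⟨by rw [he], by rw [he]; exact B.lt_gap j hjt⟩]
    exact D.slope_le_last hξ hjt he
  · rw [hγ.step j hj (i + 1) hlt _ ⟨le_rfl, B.lt_step j hj _ hlt⟩]
    exact (D.slope_lt hj hlt).le

/-- Across a one-point block two smooth intervals join with the same formula for the density;
otherwise `first_le_slope` compares with the first step. -/
theorem le_of_gap (hξ : IsCubicLike ξ) (D : IsTailData ξ B V) (hγ : IsDensity ξ B V γ) {j : ℕ}
    (hj : j + 1 < B.t) (h1 : B.q (j + 1) 0 < 1) :
    ∀ x ∈ Set.Ico (B.q j (B.s j)) (B.q (j + 1) 0), γ x ≤ γ (B.q (j + 1) 0) := by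
  intro x hx
  have hle : -deriv (profile ξ) x ≤ -deriv (profile ξ) (B.q (j + 1) 0) :=
    neg_le_neg (D.gap_strictAntiOn hξ hj (Set.Ico_subset_Icc_self hx)
      (Set.right_mem_Icc.2 (B.lt_gap j hj).le) hx.2).le
  rw [hγ.gap j hj x hx]
  refine hle.trans ?_
  rcases Nat.eq_zero_or_pos (B.s (j + 1)) with h0 | hs
  · have hjt : j + 1 + 1 < B.t := by
      by_contra! hcon
      have hlast := B.last_eq
      rw [show B.t - 1 = j + 1 by omega, h0] at hlast
      rw [hlast] at h1
      exact lt_irrefl _ h1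
    have hgap := B.lt_gap (j + 1) hjt
    rw [hγ.gap (j + 1) hjt _ ⟨by rw [h0], by rwa [h0] at hgap⟩]
  · rw [hγ.step (j + 1) hj 0 hs _ ⟨le_rfl, B.lt_step _ hj 0 hs⟩]
    exact D.first_le_slope hξ (Nat.succ_pos j) hj hs

theorem mono (hξ : IsCubicLike ξ) (D : IsTailData ξ B V) (hγ : IsDensity ξ B V γ) :
    MonotoneOn γ (Set.Ico 0 1) := by
  -- The induction carries along the bound by the value at the right end, which gluing the next
  -- piece requires; at 1 the density is not constrained.
  have aux : ∀ {a b : ℝ}, a < b → b ≤ 1 → MonotoneOn γ (Set.Ico a b) →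
      (b < 1 → ∀ x ∈ Set.Ico a b, γ x ≤ γ b) →
      (MonotoneOn γ (Set.Ico 0 a) ∧ (a < 1 → ∀ x ∈ Set.Ico 0 a, γ x ≤ γ a)) →
      (MonotoneOn γ (Set.Ico 0 b) ∧ (b < 1 → ∀ x ∈ Set.Ico 0 b, γ x ≤ γ b)) := by
    rintro a b hab hb1 hm hb ⟨h1, h2⟩
    have h2' := h2 (hab.trans_le hb1)
    refine ⟨monotoneOn_Ico_glue h1 h2' hm, fun hlt x hx => ?_⟩
    rcases lt_or_ge x a with hxa | hxa
    · exact (h2' x ⟨hx.1, hxa⟩).trans (hb hlt a ⟨le_rfl, hab⟩)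
    · exact hb hlt x ⟨hxa, hx.2⟩
  refine (B.chain_one (C := fun c => MonotoneOn γ (Set.Ico 0 c) ∧
    (c < 1 → ∀ x ∈ Set.Ico 0 c, γ x ≤ γ c)) (by simp [MonotoneOn]) (fun j hj i hi => ?_)
    (fun j hj => ?_)).1
  · refine aux (B.lt_step j hj i hi) (B.q_mem hj hi).2 (fun x hx y hy _ => ?_)
      (hγ.le_of_step hξ D hj hi)
    rw [hγ.step j hj i hi x hx, hγ.step j hj i hi y hy]
  · refine aux (B.lt_gap j hj) (B.q_mem hj (Nat.zero_le _)).2 (fun x hx y hy hxy => ?_)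
      (hγ.le_of_gap hξ D hj)
    rw [hγ.gap j hj x hx, hγ.gap j hj y hy]
    exact neg_le_neg ((D.gap_strictAntiOn hξ hj).antitoneOn (Set.Ico_subset_Icc_self hx)
      (Set.Ico_subset_Icc_self hy) hxy)

theorem integral_step (hγ : IsDensity ξ B V γ) {j i : ℕ} (hj : j < B.t) (hi : i < B.s j) :
    IntervalIntegrable γ volume (B.q j i) (B.q j (i + 1)) ∧
      ∫ x in (B.q j i)..(B.q j (i + 1)), γ x = V j i - V j (i + 1) := by
  have hlt := B.lt_step j hj i hi
  have hlen := sub_pos.2 hlt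
  set M := (V j i - V j (i + 1)) / (B.q j (i + 1) - B.q j i) with hM
  have heq : Set.EqOn γ (fun _ => M) (Set.Ioo (B.q j i) (B.q j (i + 1))) := fun x hx =>
    hγ.step j hj i hi x (Set.Ioo_subset_Ico_self hx)
  constructor
  · rw [intervalIntegrable_iff_integrableOn_Ioo_of_le hlt.le, integrableOn_congr_fun heq
      measurableSet_Ioo]
    exact integrableOn_const (by simp)
  · rw [intervalIntegral.integral_of_le hlt.le, integral_Ioc_eq_integral_Ioo,
      setIntegral_congr_fun measurableSet_Ioo heq, ← integral_Ioc_eq_integral_Ioo,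
      ← intervalIntegral.integral_of_le hlt.le, intervalIntegral.integral_const, smul_eq_mul, hM]
    field_simp

theorem integral_gap (hξ : IsCubicLike ξ) (D : IsTailData ξ B V) (hγ : IsDensity ξ B V γ) {j : ℕ}
    (hj : j + 1 < B.t) {x : ℝ} (hx : x ∈ Set.Icc (B.q j (B.s j)) (B.q (j + 1) 0)) :
    IntervalIntegrable γ volume x (B.q (j + 1) 0) ∧
      ∫ t in x..(B.q (j + 1) 0), γ t = profile ξ x - profile ξ (B.q (j + 1) 0) := by
  have hpos := D.gap_left_pos hj
  have heq : Set.EqOn γ (fun t => -deriv (profile ξ) t) (Set.Ioo x (B.q (j + 1) 0)) :=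
    fun t ht => hγ.gap j hj t ⟨hx.1.trans ht.1.le, ht.2⟩
  have hpos' : ∀ t ∈ Set.uIcc x (B.q (j + 1) 0), 0 < t := by
    intro t ht
    rw [Set.uIcc_of_le hx.2] at ht
    exact (hpos.trans_le hx.1).trans_le ht.1
  have hint : IntervalIntegrable (fun t => -deriv (profile ξ) t) volume x (B.q (j + 1) 0) :=
    ContinuousOn.intervalIntegrable fun t ht =>
      (hξ.hasDerivAt_deriv_profile (hpos' t ht)).continuousAt.neg.continuousWithinAt
  constructor
  · rw [intervalIntegrable_iff_integrableOn_Ioo_of_le hx.2, integrableOn_congr_fun heq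
      measurableSet_Ioo, ← intervalIntegrable_iff_integrableOn_Ioo_of_le hx.2]
    exact hint
  · rw [intervalIntegral.integral_of_le hx.2, integral_Ioc_eq_integral_Ioo,
      setIntegral_congr_fun measurableSet_Ioo heq, ← integral_Ioc_eq_integral_Ioo,
      ← intervalIntegral.integral_of_le hx.2,
      intervalIntegral.integral_eq_sub_of_hasDerivAt (f := fun t => -profile ξ t)
        (fun t ht => (hξ.hasDerivAt_profile (hpos' t ht)).neg) hint]
    ring

/-- The increments telescope, because V agrees with the profile at both ends of each smooth
interval. -/
theorem integral_zero (hξ : IsCubicLike ξ) (D : IsTailData ξ B V) (hγ : IsDensity ξ B V γ) :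
    ∀ j < B.t, ∀ i ≤ B.s j, IntervalIntegrable γ volume 0 (B.q j i) ∧
      ∫ x in (0 : ℝ)..(B.q j i), γ x = V 0 0 - V j i := by
  refine B.chain ?_ ?_ ?_
  · rw [B.first_eq]
    simp
  · rintro j hj i hi ⟨h1, h2⟩
    obtain ⟨h3, h4⟩ := hγ.integral_step hj hi
    refine ⟨h1.trans h3, ?_⟩
    rw [← intervalIntegral.integral_add_adjacent_intervals h1 h3, h2, h4]
    ring
  · rintro j hj ⟨h1, h2⟩
    obtain ⟨h3, h4⟩ := hγ.integral_gap hξ D hj ⟨le_rfl, (B.lt_gap j hj).le⟩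
    refine ⟨h1.trans h3, ?_⟩
    rw [← intervalIntegral.integral_add_adjacent_intervals h1 h3, h2, h4, D.right j hj,
      D.left (j + 1) (Nat.succ_pos j) hj]
    ring

theorem admissible (hξ : IsCubicLike ξ) (D : IsTailData ξ B V) (hγ : IsDensity ξ B V γ) :
    Admissible γ (V (B.t - 1) (B.s (B.t - 1))) := by
  refine ⟨hγ.nonneg hξ D, hγ.mono hξ D, hγ.right hξ D, D.last_pos hξ, ?_⟩
  have := (hγ.integral_zero hξ D (B.t - 1) (by have := B.two_le; omega) _ le_rfl).1
  rwa [B.last_eq] at this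

theorem tailMass_point (hξ : IsCubicLike ξ) (D : IsTailData ξ B V) (hγ : IsDensity ξ B V γ)
    {j i : ℕ} (hj : j < B.t) (hi : i ≤ B.s j) :
    tailMass γ (V (B.t - 1) (B.s (B.t - 1))) (B.q j i) = V j i := by
  have h := hγ.admissible hξ D
  have e0 := hγ.integral_zero hξ D j hj i hi
  have e1 := (hγ.integral_zero hξ D (B.t - 1) (by have := B.two_le; omega) _ le_rfl).2
  rw [B.last_eq, ← intervalIntegral.integral_add_adjacent_intervals e0.1
    (h.integrable_sub (B.q_mem hj hi) (by simp)), e0.2] at e1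
  rw [tailMass]
  linarith

theorem tailMass_gap (hξ : IsCubicLike ξ) (D : IsTailData ξ B V) (hγ : IsDensity ξ B V γ)
    {j : ℕ} (hj : j + 1 < B.t) {x : ℝ} (hx : x ∈ Set.Icc (B.q j (B.s j)) (B.q (j + 1) 0)) :
    tailMass γ (V (B.t - 1) (B.s (B.t - 1))) x = profile ξ x := by
  have hb := B.q_mem hj (Nat.zero_le (B.s (j + 1)))
  rw [(hγ.admissible hξ D).tailMass_sub
    ⟨(D.gap_left_pos hj).le.trans hx.1, hx.2.trans hb.2⟩ hb,
    hγ.tailMass_point hξ D hj (Nat.zero_le _), (hγ.integral_gap hξ D hj hx).2,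
    D.left (j + 1) (Nat.succ_pos j) hj]
  ring

theorem variation_step_add (hξ : IsCubicLike ξ) (D : IsTailData ξ B V) (hγ : IsDensity ξ B V γ)
    {j i : ℕ} (hj : j < B.t) (hi : i < B.s j) {x : ℝ}
    (hx : x ∈ Set.Icc (B.q j i) (B.q j (i + 1))) :
    variation ξ γ (V (B.t - 1) (B.s (B.t - 1))) x =
      variation ξ γ (V (B.t - 1) (B.s (B.t - 1))) (B.q j i) +
        stepVariation ξ (B.q j i) (B.q j (i + 1)) (V j i) (V j (i + 1)) x := by
  rw [(hγ.admissible hξ D).variation_eq_stepVariation (B.q_mem hj hi.le).1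
    (B.lt_step j hj i hi) (B.q_mem hj hi).2 (hγ.step j hj i hi) (D.step hj hi).slope_pos hx,
    hγ.tailMass_point hξ D hj hi.le, hγ.tailMass_point hξ D hj hi]

theorem variation_point (hξ : IsCubicLike ξ) (D : IsTailData ξ B V) (hγ : IsDensity ξ B V γ) :
    ∀ j < B.t, ∀ i ≤ B.s j, variation ξ γ (V (B.t - 1) (B.s (B.t - 1))) (B.q j i) = 0 := by
  refine B.chain ?_ ?_ ?_
  · rw [B.first_eq]
    simp [variation, hξ.deriv_zero]
  · intro j hj i hi h0
    rw [hγ.variation_step_add hξ D hj hi (Set.right_mem_Icc.2 (B.lt_step j hj i hi).le), h0,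
      (D.step hj hi).stepVariation_right, add_zero]
  · intro j hj h0
    rw [(hγ.admissible hξ D).variation_eq_of_profile hξ (D.gap_left_pos hj)
      (B.q_mem hj (Nat.zero_le _)).2 (fun x hx => hγ.tailMass_gap hξ D hj hx)
      (Set.right_mem_Icc.2 (B.lt_gap j hj).le), h0]

theorem variation_step (hξ : IsCubicLike ξ) (D : IsTailData ξ B V) (hγ : IsDensity ξ B V γ)
    {j i : ℕ} (hj : j < B.t) (hi : i < B.s j) {x : ℝ}
    (hx : x ∈ Set.Icc (B.q j i) (B.q j (i + 1))) :
    variation ξ γ (V (B.t - 1) (B.s (B.t - 1))) x =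
      stepVariation ξ (B.q j i) (B.q j (i + 1)) (V j i) (V j (i + 1)) x := by
  rw [hγ.variation_step_add hξ D hj hi hx, hγ.variation_point hξ D j hj i hi.le, zero_add]

theorem variation_gap (hξ : IsCubicLike ξ) (D : IsTailData ξ B V) (hγ : IsDensity ξ B V γ)
    {j : ℕ} (hj : j + 1 < B.t) {x : ℝ} (hx : x ∈ Set.Icc (B.q j (B.s j)) (B.q (j + 1) 0)) :
    variation ξ γ (V (B.t - 1) (B.s (B.t - 1))) x = 0 := by
  rw [(hγ.admissible hξ D).variation_eq_of_profile hξ (D.gap_left_pos hj)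
      (B.q_mem hj (Nat.zero_le _)).2 (fun x hx => hγ.tailMass_gap hξ D hj hx) hx]
  exact hγ.variation_point hξ D j (by omega) _ le_rfl

/-- The variation is 0 on the smooth intervals and has integral `h` = 0 over each step. Hence its
tails from all block points vanish, its tail inside a step is the one controlled by the data, and it
is orthogonal to γ, which is constant on steps. -/
theorem stationary (hξ : IsCubicLike ξ) (D : IsTailData ξ B V) (hγ : IsDensity ξ B V γ) :
    Stationary ξ γ (V (B.t - 1) (B.s (B.t - 1))) := by
  have h := hγ.admissible hξ D
  set v := variation ξ γ (V (B.t - 1) (B.s (B.t - 1))) with hv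
  have ht := B.two_le
  have hi : ∀ {a b}, a ∈ Set.Icc (0 : ℝ) 1 → b ∈ Set.Icc (0 : ℝ) 1 →
      IntervalIntegrable v volume a b := fun ha hb =>
    ((h.continuousOn_variation hξ).mono (Set.uIcc_subset_Icc ha hb)).intervalIntegrable
  have hiγ : ∀ {a b}, a ∈ Set.Icc (0 : ℝ) 1 → b ∈ Set.Icc (0 : ℝ) 1 →
      IntervalIntegrable (fun x => v x * γ x) volume a b := fun ha hb =>
    (h.integrable_sub ha hb).continuousOn_mul
      ((h.continuousOn_variation hξ).mono (Set.uIcc_subset_Icc ha hb))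
  have z0 : (0 : ℝ) ∈ Set.Icc (0 : ℝ) 1 := by simp
  have z1 : (1 : ℝ) ∈ Set.Icc (0 : ℝ) 1 := by simp
  have hstep : ∀ j < B.t, ∀ i < B.s j, ∀ y ∈ Set.Icc (B.q j i) (B.q j (i + 1)),
      ∫ x in y..(B.q j (i + 1)), v x = ∫ x in y..(B.q j (i + 1)),
        stepVariation ξ (B.q j i) (B.q j (i + 1)) (V j i) (V j (i + 1)) x := by
    intro j hj i hi' y hy
    refine intervalIntegral.integral_congr fun x hx => ?_
    rw [Set.uIcc_of_le hy.2] at hx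
    exact hγ.variation_step hξ D hj hi' ⟨hy.1.trans hx.1, hx.2⟩
  have hgap : ∀ j, j + 1 < B.t → ∀ y ∈ Set.Icc (B.q j (B.s j)) (B.q (j + 1) 0),
      ∫ x in y..(B.q (j + 1) 0), v x = 0 := by
    intro j hj y hy
    rw [intervalIntegral.integral_congr (g := fun _ => (0 : ℝ)) fun x hx => ?_]
    · simp
    · rw [Set.uIcc_of_le hy.2] at hx
      exact hγ.variation_gap hξ D hj ⟨hy.1.trans hx.1, hx.2⟩
  have hstep0 : ∀ j < B.t, ∀ i < B.s j, ∫ x in (B.q j i)..(B.q j (i + 1)), v x = 0 := by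
    intro j hj i hi'
    rw [hstep j hj i hi' _ (Set.left_mem_Icc.2 (B.lt_step j hj i hi').le),
      (D.step hj hi').integral_stepVariation_eq_h hξ, D.h_eq hj hi']
  have hzero : ∀ j < B.t, ∀ i ≤ B.s j, ∫ x in (0 : ℝ)..(B.q j i), v x = 0 := by
    refine B.chain ?_ (fun j hj i hi' ih => ?_) (fun j hj ih => ?_)
    · rw [B.first_eq, intervalIntegral.integral_same]
    · rw [← intervalIntegral.integral_add_adjacent_intervals (hi z0 (B.q_mem hj hi'.le))
        (hi (B.q_mem hj hi'.le) (B.q_mem hj hi')), ih, hstep0 j hj i hi', add_zero]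
    · have m1 := B.q_mem (show j < B.t by omega) (le_refl (B.s j))
      rw [← intervalIntegral.integral_add_adjacent_intervals (hi z0 m1)
        (hi m1 (B.q_mem hj (Nat.zero_le _))), ih,
        hgap j hj _ (Set.left_mem_Icc.2 (B.lt_gap j hj).le), add_zero]
  have htot : ∫ x in (0 : ℝ)..1, v x = 0 := by
    have := hzero (B.t - 1) (by omega) _ le_rfl
    rwa [B.last_eq] at this
  have htail : ∀ j < B.t, ∀ i ≤ B.s j, ∫ x in (B.q j i)..1, v x = 0 := by
    intro j hj i hi'
    have e := intervalIntegral.integral_add_adjacent_intervals (hi z0 (B.q_mem hj hi'))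
      (hi (B.q_mem hj hi') z1)
    rw [hzero j hj i hi', htot, zero_add] at e
    exact e
  refine ⟨?_, fun u hu => ?_, ?_⟩
  · have := hγ.variation_point hξ D (B.t - 1) (by omega) _ le_rfl
    rwa [B.last_eq] at this
  · rcases hu.2.eq_or_lt with rfl | hu1
    · rw [intervalIntegral.integral_same]
    rcases B.cover ⟨hu.1, hu1⟩ with ⟨j, hj, i, hi', hx⟩ | ⟨j, hj, hx⟩
    · have m1 := B.q_mem hj hi'
      rw [← intervalIntegral.integral_add_adjacent_intervals (hi hu m1) (hi m1 z1),
        htail j hj _ hi', add_zero, hstep j hj i hi' u (Set.Ico_subset_Icc_self hx)]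
      exact D.step_nonneg hj hi' u (Set.Ico_subset_Icc_self hx)
    · have m1 := B.q_mem hj (Nat.zero_le (B.s (j + 1)))
      rw [← intervalIntegral.integral_add_adjacent_intervals (hi hu m1) (hi m1 z1),
        htail _ hj _ (Nat.zero_le _), add_zero, hgap j hj u (Set.Ico_subset_Icc_self hx)]
  · refine B.chain_one (C := fun c => ∫ x in (0 : ℝ)..c, v x * γ x = 0) ?_
      (fun j hj i hi' ih => ?_) (fun j hj ih => ?_)
    · rw [intervalIntegral.integral_same]
    · have m0 := B.q_mem hj hi'.le
      have m1 := B.q_mem hj hi'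
      have hlt := (B.lt_step j hj i hi').le
      rw [← intervalIntegral.integral_add_adjacent_intervals (hiγ z0 m0) (hiγ m0 m1), ih,
        zero_add]
      have : ∫ x in (B.q j i)..(B.q j (i + 1)), v x * γ x =
          ∫ x in (B.q j i)..(B.q j (i + 1)),
            v x * ((V j i - V j (i + 1)) / (B.q j (i + 1) - B.q j i)) := by
        rw [intervalIntegral.integral_of_le hlt, intervalIntegral.integral_of_le hlt,
          integral_Ioc_eq_integral_Ioo, integral_Ioc_eq_integral_Ioo]
        refine setIntegral_congr_fun measurableSet_Ioo fun x hx => ?_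
        simp only [hγ.step j hj i hi' x (Set.Ioo_subset_Ico_self hx)]
      rw [this, intervalIntegral.integral_mul_const, hstep0 j hj i hi', zero_mul]
    · have m0 := B.q_mem (show j < B.t by omega) (le_refl (B.s j))
      have m1 := B.q_mem hj (Nat.zero_le (B.s (j + 1)))
      rw [← intervalIntegral.integral_add_adjacent_intervals (hiγ z0 m0) (hiγ m0 m1), ih,
        zero_add, intervalIntegral.integral_congr (g := fun _ => (0 : ℝ)) fun x hx => ?_]
      · simp
      · rw [Set.uIcc_of_le (B.lt_gap j hj).le] at hx
        simp only [hv, hγ.variation_gap hξ D hj hx, zero_mul]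

end IsDensity

/-- The slopes increase along a block. -/
theorem slope_strictMono (D : IsTailData ξ B V) {j i i' : ℕ} (hj : j < B.t) (h : i < i')
    (hi' : i' < B.s j) :
    (V j i - V j (i + 1)) / (B.q j (i + 1) - B.q j i) <
      (V j i' - V j (i' + 1)) / (B.q j (i' + 1) - B.q j i') := by
  induction i', h using Nat.le_induction with
  | base => exact D.slope_lt hj hi'
  | succ k _ ih => exact (ih (by omega)).trans (D.slope_lt hj hi')

end IsTailData

theorem FRSBCriterion.isFRSBAt (hξ : IsCubicLike ξ) {ν : Measure ℝ} (hν : IsParisiMeasure ξ ν)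
    (H : FRSBCriterion ξ B) : IsFRSBAt ν B := by
  obtain ⟨V, D⟩ := H.exists_tailData hξ
  obtain ⟨m, hm⟩ := B.exists_numbering fun j i =>
    (V j (i - 1) - V j i) / (B.q j i - B.q j (i - 1))
  set ω : ℝ → ℝ := fun x => -deriv (profile ξ) x with hω
  set Δ := V (B.t - 1) (B.s (B.t - 1)) with hΔ
  have hms : ∀ j < B.t, ∀ i < B.s j, m (B.w j + (i + 1)) =
      (V j i - V j (i + 1)) / (B.q j (i + 1) - B.q j i) := fun j hj i hi => by
    rw [hm j hj (i + 1) (by omega) hi, Nat.add_sub_cancel]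
  have hγ : IsTailData.IsDensity ξ B V (B.density m ω) :=
    ⟨fun j hj i hi x hx => by rw [B.density_step m ω hj hi hx, hms j hj i hi],
      fun j hj x hx => B.density_gap m ω hj hx⟩
  have hadm := hγ.admissible hξ D
  have hst := hγ.stationary hξ D
  have hpos : ∀ x ∈ B.smoothSet, x ∈ Set.Ico (0 : ℝ) 1 ∧ 0 < x := by
    rintro x ⟨j, hj, hx⟩
    have h0 := (D.gap_left_pos hj).trans_le hx.1
    exact ⟨⟨h0.le, hx.2.trans_le (B.q_mem hj (Nat.zero_le _)).2⟩, h0⟩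
  have hgapω : ∀ j, j + 1 < B.t →
      StrictMonoOn ω (Set.Ico (B.q j (B.s j)) (B.q (j + 1) 0)) := fun j hj x hx y hy hxy =>
    neg_lt_neg (D.gap_strictAntiOn hξ hj (Set.Ico_subset_Icc_self hx)
      (Set.Ico_subset_Icc_self hy) hxy)
  refine ⟨m, ω, Δ, fun l hl => ?_, fun l hl l' hl' hlt => ?_, fun x hx => ?_,
    fun x hx y hy hxy => ?_, hadm.atom_pos, ?_⟩
  · obtain ⟨j, hj, i, h1, hi, rfl⟩ := B.exists_index hl
    obtain ⟨k, rfl⟩ : ∃ k, i = k + 1 := ⟨i - 1, by omega⟩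
    rw [hms j hj k hi]
    exact (D.step hj hi).slope_pos
  · obtain ⟨j, hj, i, h1, hi, rfl⟩ := B.exists_index hl
    obtain ⟨j', hj', i', h1', hi', rfl⟩ := B.exists_index hl'
    obtain ⟨k, rfl⟩ : ∃ k, i = k + 1 := ⟨i - 1, by omega⟩
    obtain ⟨k', rfl⟩ : ∃ k, i' = k + 1 := ⟨i' - 1, by omega⟩
    rcases lt_trichotomy j j' with hjj | rfl | hjj
    -- Different blocks are separated by a smooth interval, whose strictly increasing density makes
    -- the comparison of the two heights strict.
    · have hjt : j + 1 < B.t := by omega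
      have hgap := B.lt_gap j hjt
      obtain ⟨c, hc1, hc2⟩ := exists_between hgap
      have mc : c ∈ Set.Ico (B.q j (B.s j)) (B.q (j + 1) 0) := ⟨hc1.le, hc2⟩
      have me : B.q j (B.s j) ∈ Set.Ico (B.q j (B.s j)) (B.q (j + 1) 0) := ⟨le_rfl, hgap⟩
      have p1 : B.q j k ∈ Set.Ico (B.q j k) (B.q j (k + 1)) := ⟨le_rfl, B.lt_step j hj k hi⟩
      have p2 : B.q j' k' ∈ Set.Ico (B.q j' k') (B.q j' (k' + 1)) :=
        ⟨le_rfl, B.lt_step j' hj' k' hi'⟩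
      have hle : c ≤ B.q j' k' := (hc2.le.trans (B.first_le_first hjj hj')).trans
        (B.q_le hj' (Nat.zero_le _) (by omega))
      calc m (B.w j + (k + 1)) = B.density m ω (B.q j k) := (B.density_step m ω hj hi p1).symm
        _ ≤ B.density m ω (B.q j (B.s j)) :=
            hadm.mono ⟨(B.q_mem hj (by omega)).1, p1.2.trans_le (B.q_mem hj hi).2⟩
              (hpos _ ⟨j, hjt, me⟩).1 (B.q_le hj (by omega) le_rfl)
        _ = ω (B.q j (B.s j)) := B.density_gap m ω hjt me
        _ < ω c := hgapω j hjt me mc hc1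
        _ = B.density m ω c := (B.density_gap m ω hjt mc).symm
        _ ≤ B.density m ω (B.q j' k') :=
            hadm.mono (hpos _ ⟨j, hjt, mc⟩).1
              ⟨(B.q_mem hj' (by omega)).1, p2.2.trans_le (B.q_mem hj' hi').2⟩ hle
        _ = m (B.w j' + (k' + 1)) := B.density_step m ω hj' hi' p2
    · rw [hms j hj k hi, hms j hj k' hi']
      exact D.slope_strictMono hj (by omega) hi'
    · have := B.index_lt hi' h1 hjj
      omega
  · have := hξ.deriv_profile_neg (hpos x hx).2
    simp only [hω]
    linarith
  · obtain ⟨j, hj, hx'⟩ := hx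
    -- The points x and y may lie in different smooth intervals: strictness is gained between x and
    -- c in the same interval, and monotonicity of the whole density does the rest.
    obtain ⟨c, hc1, hc2⟩ := exists_between (lt_min hx'.2 hxy)
    rw [lt_min_iff] at hc2
    have mc : c ∈ Set.Ico (B.q j (B.s j)) (B.q (j + 1) 0) := ⟨hx'.1.trans hc1.le, hc2.1⟩
    obtain ⟨j', hj', hy'⟩ := hy
    calc ω x < ω c := hgapω j hj hx' mc hc1
      _ = B.density m ω c := (B.density_gap m ω hj mc).symm
      _ ≤ B.density m ω y :=
          hadm.mono (hpos _ ⟨j, hj, mc⟩).1 (hpos _ ⟨j', hj', hy'⟩).1 hc2.2.le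
      _ = ω y := B.density_gap m ω hj' hy'
  · rw [B.withDensity_density]
    exact hst.eq_of_isParisiMeasure hξ hadm hν

end SphericalSpin

theorem theorem9 {n : ℕ} (p : Fin n → ℕ) (lam : Fin n → ℝ)
    (hp : ∀ i, 2 < p i) (hp_mono : StrictMono p)
    (hlam : ∀ i, 0 ≤ lam i) (hlam_sum : ∑ i, lam i = 1)
    (ν : MeasureTheory.Measure ℝ)
    (hν : SphericalSpin.IsParisiMeasure (SphericalSpin.mixture p lam) ν) :
    (∀ B : SphericalSpin.BlockPoints,
      SphericalSpin.IsFRSBAt ν B ↔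
        SphericalSpin.FRSBCriterion (SphericalSpin.mixture p lam) B) ∧
    (∀ k : ℕ, SphericalSpin.IsFRSB k ν ↔
      ∃ B : SphericalSpin.BlockPoints, B.k = k ∧
        SphericalSpin.FRSBCriterion (SphericalSpin.mixture p lam) B) := by
  have hξ := SphericalSpin.mixture_isCubicLike p lam hp hlam hlam_sum
  have key : ∀ B : SphericalSpin.BlockPoints, SphericalSpin.IsFRSBAt ν B ↔
      SphericalSpin.FRSBCriterion (SphericalSpin.mixture p lam) B := fun B =>
    ⟨fun h => h.frsbCriterion hξ hν, fun h => h.isFRSBAt hξ hν⟩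
  exact ⟨key, fun k => exists_congr fun B => and_congr_right fun _ => key B⟩
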